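/- \textbf{Setting.} Let $\mathbb K$ be the field of complex Puiseux series in $t$, with $\mathrm{trop}=-\mathrm{val}$; write $\mathrm{ini}(a)$ for the initial coefficient of $a\in\mathbb K^\times$, applied coordinatewise to points. Let $(\Gamma,h)$ be a connected parametrized plane tropical curve, i.e. a finite metric graph with bounded edges of finite positive length and unbounded ends, mapped to $\mathbb R^2$ affinely on every edge $E$ with derivative $\mathrm{wt}(E)$ times a primitive integral vector, $\mathrm{wt}(E)\ge 1$, and balanced at every vertex. Assume every vertex $V$ is trivalent with dual lattice polygon a nondegenerate triangle $P_V$. The marked points of $\Gamma$ are finitely many distinct points in the relative interiors of edges and ends, at most one on each bounded edge, and points at infinity on distinct ends (the fixed ends). An \emph{enhancement} assigns to every vertex $V$ a peripherally unibranch rational curve $\varphi_V:\mathbb P^1\to C_V\subset \mathrm{Tor}_{\mathbb C}(P_V)$ such that for every edge or end $E$ at $V$ exactly one point of $\mathbb P^1$ lies over the toric divisor dual to $E$, with intersection multiplicity $\mathrm{wt}(E)$, and such that the two curves at the ends of a bounded edge $E$ meet the toric divisor $\mathrm{Tor}_{\mathbb C}(\sigma)$, $\sigma$ dual to $E$, at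 the same point. The \emph{point conditions} are points $p_i\in(\mathbb K^\times)^2$ and points $q_j$, with multiplicities $m_j\ge1$, in the open strata of toric divisors over $\mathbb K$, the divisor of $q_j$ having primitive outer normal $u_j$. The enhanced curve \emph{satisfies} them if the $i$-th inner marked point is mapped to $\mathrm{trop}(p_i)$; the $j$-th fixed end has direction $u_j$, weight $m_j$ and lies on the line $\mathrm{trop}(q_j)+\mathbb R u_j$; for every marked bounded edge the common point of the two adjacent limit curves on $\mathrm{Tor}_{\mathbb C}(\sigma)$ is the one defined by $\mathrm{ini}(p_i)$; and the limit curve adjacent to the $j$-th fixed end meets the corresponding divisor at the point defined by $\mathrm{ini}(q_j)$. \textbf{Modification data.} Let $E$ be a bounded edge of weight $\ell$ with endpoints $V_1,V_2$. A toric change of coordinates $\Phi$ for $E$ consists of coordinates $x=\chi^{m},y=\chi^{m'}$ with $m,m'$ a basis of $\mathbb Z^2$, in which $E$ is horizontal with $V_1$ on its left. In these coordinates $C_{V_1}$ and $C_{V_2}$ meet $\mathrm{Tor}_{\mathbb C}(\sigma)$ at one point $y=\eta$ and have, after multiplication by a scalar and a monomial, unique equations of the form $(y-\eta)^\ell+\vartheta_1(y)x^{-1}+O(x^{-2})$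 and $(y-\eta)^\ell+\vartheta_2(y)x+O(x^2)$. Put $\theta_i=\vartheta_i(\eta)$. (1) If $E$ is unmarked, a modification datum is a triple $(\Phi,\zeta,C_{mod})$ with $\zeta\in\mathbb K$ and $C_{mod}$ an irreducible rational curve given by an equation with Newton polygon $\mathrm{conv}\{(-1,0),(1,0),(0,\ell)\}$, in which $y^\ell$ has coefficient $1$ and $y^{\ell-1}$ has coefficient $0$. It is coherent if $\zeta$ has no negative powers of $t$, $\zeta(0)=\eta$, and the restrictions of the equation to $\mathrm{conv}\{(-1,0),(0,\ell)\}$ and $\mathrm{conv}\{(1,0),(0,\ell)\}$ are $y^\ell+\theta_1x^{-1}$ and $y^\ell+\theta_2x$. (2) If $\ell>1$ and $E$ contains the $i$-th inner marked point, a modification datum is a tuple $(\Phi,C_{1,mod},C_{2,mod},\Omega)$, where $C_{1,mod},C_{2,mod}$ are rational peripherally unibranch curves with Newton triangles $\mathrm{conv}\{(-1,0),(0,0),(0,\ell)\}$ and $\mathrm{conv}\{(0,0),(1,0),(0,\ell)\}$ (equations normalized to have $y^\ell$-coefficient $1$), and $\Omega$ is a datum as in (1) for the unmarked horizontal edge of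 weight $\ell$ dual to $\mathrm{conv}\{(0,0),(0,\ell)\}$, whose adjacent limit curves are $C_{1,mod}$ and $C_{2,mod}$. It is coherent if $\Omega$ is coherent, $C_{1,mod}$ meets the toric divisor of $\mathrm{conv}\{(-1,0),(0,0)\}$ at the point given by the initial coefficient of the first coordinate of $p_i$ after $\Phi$, and the equations of $C_{1,mod}$ and $C_{2,mod}$ restricted to $\mathrm{conv}\{(-1,0),(0,\ell)\}$ and $\mathrm{conv}\{(1,0),(0,\ell)\}$ are $y^\ell+\theta_1x^{-1}$ and $y^\ell+\theta_2x$. A marked bounded edge of weight $1$ carries only a trivial datum. Two data of an edge are \emph{equivalent} if they correspond to each other under a change of the toric coordinates, shifts $\zeta$ being compared only through $\zeta(0)$. Explicitly, if $x'=Axy^k$, $y'=By^{\varepsilon}$ with $k\in\mathbb Z$ and $\varepsilon=\pm1$, then near $y=\eta$ the coordinates $(x,y-\eta)$ in which the modification takes place transform, to leading order, by $(x,y-\eta)\mapsto (A\eta^kx,\;B\varepsilon\eta^{\varepsilon-1}(y-\eta))$. The curves are required to correspond under this map and $\zeta'(0)=B\,\zeta(0)^{\varepsilon}$. Here $A=B=1$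 for the toric change belonging to an edge of $\Gamma$, with $\eta=\zeta(0)$ if the edge is unmarked and $\eta$ the initial coefficient of the second coordinate of $p_i$ if it is marked. For the datum $\Omega$ of a marked edge, $\eta=\zeta_\Omega(0)$, and $A$ and $B$ are the values of the new coordinate characters of $\Omega$ at the two scaling factors induced by the first change. A coherent modification datum of the enhanced curve is a choice of a coherent datum on each bounded edge, and equivalence is taken edge by edge. \textbf{Lemma.} For an enhanced plane tropical curve satisfying the point conditions as above, the number of equivalence classes of coherent modification data is $$\prod_{E\in\Gamma^1_b}\mathrm{wt}(E)\cdot\prod_{i:\ p_i\text{ marks } E_i\in\Gamma^1_b}\mathrm{wt}(E_i),$$ where $\Gamma^1_b$ is the set of bounded edges. More precisely, a bounded edge $E$ carries exactly $\mathrm{wt}(E)$ equivalence classes of coherent modification data if it is unmarked, and exactly $\mathrm{wt}(E)^2$ if it is marked. -/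

import Mathlib

open scoped BigOperators

noncomputable section

namespace TropMod

/-! ### Puiseux series -/

/-- A Hahn series with rational exponents is a Puiseux series if the denominators of the exponents
which occur in it are bounded. -/
def IsPuiseux (f : HahnSeries ℚ ℂ) : Prop :=
  ∃ N : ℕ, 0 < N ∧ ∀ a ∈ f.support, ∃ k : ℤ, a = (k : ℚ) / (N : ℚ)

/-- The (underlying set of the) field `𝕂` of complex Puiseux series in `t`. -/
def Puiseux : Type := {f : HahnSeries ℚ ℂ // IsPuiseux f}

/-- The coefficient of the lowest power of `t`. -/
def Puiseux.ini (f : Puiseux) : ℂ := f.1.leadingCoeff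

/-- The tropicalization `-val` of a (nonzero) element of `𝕂`. -/
def Puiseux.trop (f : Puiseux) : ℝ := -((f.1.order : ℚ) : ℝ)

/-- `f` lies in the valuation ring, that is, it has no negative powers of `t`. -/
def Puiseux.IsIntegral (f : Puiseux) : Prop := ∀ a : ℚ, a < 0 → f.1.coeff a = 0

/-- The value `f(0)` at `t = 0` of an element `f` of the valuation ring. -/
def Puiseux.atZero (f : Puiseux) : ℂ := f.1.coeff 0

/-! ### Plane lattices -/

/-- The pairing of a monomial exponent with a direction. -/
def dot (m u : ℤ × ℤ) : ℤ := m.1 * u.1 + m.2 * u.2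

def det2 (u v : ℤ × ℤ) : ℤ := u.1 * v.2 - u.2 * v.1

/-- `u` rotated by a right angle. For primitive `u` this generates the exponents orthogonal
to `u`. -/
def rot (u : ℤ × ℤ) : ℤ × ℤ := (-u.2, u.1)

def IsPrimitive (u : ℤ × ℤ) : Prop := Int.gcd u.1 u.2 = 1

def toReal (u : ℤ × ℤ) : ℝ × ℝ := ((u.1 : ℝ), (u.2 : ℝ))

/-- The monomial `a ^ m.1 * b ^ m.2`. -/
def monom {F : Type*} [Field F] (a b : F) (m : ℤ × ℤ) : F := a ^ m.1 * b ^ m.2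

/-! ### Laurent polynomials in two variables -/

/-- Laurent polynomials in `x, y` over `ℂ`: the exponent `(i, j)` stands for `x ^ i * y ^ j`. -/
abbrev Laurent : Type := AddMonoidAlgebra ℂ (ℤ × ℤ)

/-- The Newton polygon. -/
def newtonPolygon (f : Laurent) : Set (ℝ × ℝ) :=
  convexHull ℝ (toReal '' (f.coeff.support : Set (ℤ × ℤ)))

/-- The value of a Laurent polynomial at a pair of (nonzero) elements of an extension field. -/
def evalAt {F : Type*} [Field F] [Algebra ℂ F] (a b : F) (f : Laurent) : F :=
  f.coeff.sum fun m c => algebraMap ℂ F c * monom a b m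

open Classical in
/-- The restriction (truncation) of `f` to the exponents in the set `S`. -/
def restrict (S : Set (ℝ × ℝ)) (f : Laurent) : Laurent :=
  AddMonoidAlgebra.ofCoeff (f.coeff.filter fun m => toReal m ∈ S)

/-- `f(a x, b y)`. -/
def scale (a b : ℂ) (f : Laurent) : Laurent :=
  f.coeff.sum fun m c => AddMonoidAlgebra.single m (c * monom a b m)

/-! ### Parametrized rational curves -/

/-- The order of vanishing of a nonzero rational function at a point of `ℙ¹ = ℂ ∪ {∞}`. -/
def ordAt (f : RatFunc ℂ) : OnePoint ℂ → ℤ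
  | none => -f.intDegree
  | some a => (f.num.rootMultiplicity a : ℤ) - (f.denom.rootMultiplicity a : ℤ)

/-- The value at a point of `ℙ¹ = ℂ ∪ {∞}` of a rational function of order zero at this point. -/
def valAt (f : RatFunc ℂ) : OnePoint ℂ → ℂ
  | none => f.num.leadingCoeff / f.denom.leadingCoeff
  | some a => f.eval (RingHom.id ℂ) a

/-- A rational map from `ℙ¹` to the torus `(ℂˣ)²`, equivalently a morphism from `ℙ¹` to a complete
toric surface which does not map `ℙ¹` into the toric boundary. -/
structure TorusMap where
  X : RatFunc ℂ
  Y : RatFunc ℂ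
  X_ne_zero : X ≠ 0
  Y_ne_zero : Y ≠ 0

/-- The orders of the two coordinates at a point of `ℙ¹`. The point is mapped to the toric divisor
with outer normal `n` if and only if this vector is a negative multiple of `n`, and to the torus if
and only if it is zero. -/
def TorusMap.ordVec (φ : TorusMap) (p : OnePoint ℂ) : ℤ × ℤ := (ordAt φ.X p, ordAt φ.Y p)

/-- The value of the character `m` at `φ(p)`, for a character of order zero at `p`. -/
def TorusMap.charVal (φ : TorusMap) (m : ℤ × ℤ) (p : OnePoint ℂ) : ℂ :=
  valAt (monom φ.X φ.Y m) p

/-- `f` is a defining equation of the image curve of `φ`. It is unique up to units of the ring of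
Laurent polynomials. -/
def IsDefiningEquation (f : Laurent) (φ : TorusMap) : Prop :=
  Irreducible f ∧ evalAt φ.X φ.Y f = 0

/-- `φ` maps `ℙ¹` birationally onto its image, and `f` is a defining equation of the image. -/
def Parametrizes (φ : TorusMap) (f : Laurent) : Prop :=
  IsDefiningEquation f φ ∧ IntermediateField.adjoin ℂ ({φ.X, φ.Y} : Set (RatFunc ℂ)) = ⊤

/-- Different points of `ℙ¹` which are mapped to the toric boundary are mapped to different toric
divisors. As every toric divisor meets the curve, there is exactly one point of `ℙ¹` over each
toric divisor of the toric surface of the Newton polygon. -/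
def TorusMap.PeripherallyUnibranch (φ : TorusMap) : Prop :=
  ∀ p q : OnePoint ℂ, φ.ordVec p ≠ 0 → φ.ordVec q ≠ 0 →
    (∃ c d : ℕ, 0 < c ∧ 0 < d ∧ c • φ.ordVec p = d • φ.ordVec q) → p = q

/-- The curve defined by `f` is an irreducible rational curve. -/
def IsRationalCurve (f : Laurent) : Prop := ∃ φ : TorusMap, Parametrizes φ f

/-- The curve defined by `f` is an irreducible rational peripherally unibranch curve. -/
def IsUnibranchRationalCurve (f : Laurent) : Prop :=
  ∃ φ : TorusMap, Parametrizes φ f ∧ φ.PeripherallyUnibranch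

/-! ### Plane tropical curves -/

/-- The combinatorial and metric data of a parametrized plane tropical curve: a finite graph with
vertices `V`, bounded edges `E` and unbounded ends `L`, together with a map to the plane which is
affine on all edges and ends. The primitive direction of a bounded edge points from its first
endpoint `tail e` to its second endpoint `head e`. The naming of the endpoints is an arbitrary
choice. -/
structure PlaneGraph (V E L : Type*) where
  tail : E → V
  head : E → V
  root : L → V
  wt : E → ℕ
  dir : E → ℤ × ℤ
  len : E → ℝ
  endWt : L → ℕ
  endDir : L → ℤ × ℤ
  pos : V → ℝ × ℝ
  wt_pos : ∀ e, 0 < wt e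
  endWt_pos : ∀ l, 0 < endWt l
  dir_primitive : ∀ e, IsPrimitive (dir e)
  endDir_primitive : ∀ l, IsPrimitive (endDir l)
  len_pos : ∀ e, 0 < len e
  pos_head : ∀ e, pos (head e) = pos (tail e) + (len e * (wt e : ℝ)) • toReal (dir e)

/-- Flags, that is, pairs of a vertex and an incident edge or end: in this order, a bounded edge at
its first endpoint, a bounded edge at its second endpoint, an end at its vertex. -/
abbrev Flag (E L : Type*) : Type _ := E ⊕ E ⊕ L

section Graph

variable {V E L : Type*} (G : PlaneGraph V E L)

/-- The vertex of a flag. -/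
def PlaneGraph.vertex : Flag E L → V := Sum.elim G.tail (Sum.elim G.head G.root)

/-- The outgoing integral direction vector of a flag, of lattice length equal to the weight. -/
def PlaneGraph.vec : Flag E L → ℤ × ℤ :=
  Sum.elim (fun e => G.wt e • G.dir e)
    (Sum.elim (fun e => -(G.wt e • G.dir e)) (fun l => G.endWt l • G.endDir l))

end Graph

/-- A connected parametrized plane tropical curve. -/
structure PlaneTropicalCurve (V E L : Type*) [Fintype V] [Fintype E] [Fintype L]
    [DecidableEq V] extends PlaneGraph V E L where
  balanced : ∀ v, ∑ f : Flag E L with toPlaneGraph.vertex f = v, toPlaneGraph.vec f = 0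
  connected : ∀ v w, Relation.EqvGen (fun a b => ∃ e, tail e = a ∧ head e = b) v w

section Curve

variable {V E L : Type*} [Fintype V] [Fintype E] [Fintype L] [DecidableEq V]

/-- Every vertex is trivalent, and its dual polygon is a nondegenerate triangle. -/
def PlaneTropicalCurve.Trivalent (Γ : PlaneTropicalCurve V E L) : Prop :=
  ∀ v, Nat.card {f : Flag E L // Γ.vertex f = v} = 3 ∧
    ∃ f g, Γ.vertex f = v ∧ Γ.vertex g = v ∧ det2 (Γ.vec f) (Γ.vec g) ≠ 0

/-- A point in the relative interior of a bounded edge or of an end, given by its distance from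
the first endpoint of the edge, respectively from the vertex of the end. -/
inductive InnerPoint (Γ : PlaneTropicalCurve V E L) : Type _
  | onEdge (e : E) (s : ℝ) (hs : 0 < s ∧ s < Γ.len e) : InnerPoint Γ
  | onEnd (l : L) (s : ℝ) (hs : 0 < s) : InnerPoint Γ

/-- The image of a point in the plane. -/
def InnerPoint.image {Γ : PlaneTropicalCurve V E L} : InnerPoint Γ → ℝ × ℝ
  | .onEdge e s _ => Γ.pos (Γ.tail e) + (s * (Γ.wt e : ℝ)) • toReal (Γ.dir e)
  | .onEnd l s _ => Γ.pos (Γ.root l) + (s * (Γ.endWt l : ℝ)) • toReal (Γ.endDir l)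

/-- The bounded edge which contains the point, if there is one. -/
def InnerPoint.edge {Γ : PlaneTropicalCurve V E L} : InnerPoint Γ → Option E
  | .onEdge e _ _ => some e
  | .onEnd _ _ _ => none

/-- The marked points: `n` points in the relative interiors of edges and ends, and `r` points at
infinity, which are given by the ends they lie on (the fixed ends). -/
structure Marking (Γ : PlaneTropicalCurve V E L) (n r : ℕ) where
  point : Fin n → InnerPoint Γ
  point_injective : Function.Injective point
  fixedEnd : Fin r → L
  fixedEnd_injective : Function.Injective fixedEnd

/-- The `i`-th marked point lies on the bounded edge `e`. -/
def Marking.OnEdge {Γ : PlaneTropicalCurve V E L} {n r : ℕ} (p : Marking Γ n r) (i : Fin n)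
    (e : E) : Prop := (p.point i).edge = some e

/-- The weight of the bounded edge which contains the `i`-th marked point, and `1` if this point
lies on an end. -/
def Marking.boundedWeight {Γ : PlaneTropicalCurve V E L} {n r : ℕ} (p : Marking Γ n r)
    (i : Fin n) : ℕ := (p.point i).edge.elim 1 Γ.wt

/-- An enhancement: for every vertex `v` a rational curve in the toric surface of the dual polygon,
with one point of `ℙ¹` over the toric boundary for every flag at `v`; at this point it meets the
toric divisor orthogonal to the flag with multiplicity equal to the weight. The two curves at the
endpoints of a bounded edge meet the common toric divisor at the same point. -/
structure Enhancement (Γ : PlaneTropicalCurve V E L) where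
  φ : V → TorusMap
  pt : Flag E L → OnePoint ℂ
  pt_injective : ∀ f g, Γ.vertex f = Γ.vertex g → pt f = pt g → f = g
  ord_pt : ∀ f, (φ (Γ.vertex f)).ordVec (pt f) = -Γ.vec f
  ord_other : ∀ v p, (∀ f, Γ.vertex f = v → pt f ≠ p) → (φ v).ordVec p = 0
  matching : ∀ e,
    (φ (Γ.tail e)).charVal (rot (Γ.dir e)) (pt (Sum.inl e)) =
      (φ (Γ.head e)).charVal (rot (Γ.dir e)) (pt (Sum.inr (Sum.inl e)))

end Curve

/-! ### Algebraic point conditions -/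

/-- A point of the torus `(𝕂ˣ)²`. -/
structure TorusPoint where
  X : Puiseux
  Y : Puiseux
  X_ne_zero : X.1 ≠ 0
  Y_ne_zero : Y.1 ≠ 0

/-- The value of the character `m` at the initial term of the point. -/
def TorusPoint.iniChar (p : TorusPoint) (m : ℤ × ℤ) : ℂ := monom p.X.ini p.Y.ini m

/-- A point of the open stratum of the toric divisor over `𝕂` with primitive outer normal `u`,
given by its coordinate `c`, the value of the character `rot u`, together with a tangency order
`m`. -/
structure BoundaryCondition where
  u : ℤ × ℤ
  c : Puiseux
  m : ℕ
  u_primitive : IsPrimitive u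
  c_ne_zero : c.1 ≠ 0
  m_pos : 0 < m

/-- Algebraic point conditions: `n` points in the torus and `r` points with tangency orders on the
toric divisors. -/
structure PointConditions (n r : ℕ) where
  inner : Fin n → TorusPoint
  boundary : Fin r → BoundaryCondition

section Enhanced

variable {V E L : Type*} [Fintype V] [Fintype E] [Fintype L] [DecidableEq V]
variable {Γ : PlaneTropicalCurve V E L} {n r : ℕ}

/-- The marked tropical curve satisfies the tropicalizations of the point conditions: the marked
points are mapped to the tropical points, and each fixed end has the prescribed direction and
weight and is mapped to the prescribed line. -/
def SatisfiesTropical (p : Marking Γ n r) (P : PointConditions n r) : Prop :=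
  (∀ i, (p.point i).image = ((P.inner i).X.trop, (P.inner i).Y.trop)) ∧
  (∀ j, Γ.endDir (p.fixedEnd j) = (P.boundary j).u ∧
    Γ.endWt (p.fixedEnd j) = (P.boundary j).m ∧
    ((rot (P.boundary j).u).1 : ℝ) * (Γ.pos (Γ.root (p.fixedEnd j))).1 +
      ((rot (P.boundary j).u).2 : ℝ) * (Γ.pos (Γ.root (p.fixedEnd j))).2 =
        (P.boundary j).c.trop)

/-- The enhanced tropical curve satisfies the algebraic point conditions. -/
def Satisfies (p : Marking Γ n r) (Φ : Enhancement Γ) (P : PointConditions n r) : Prop :=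
  SatisfiesTropical p P ∧
  (∀ i e, p.OnEdge i e →
    (Φ.φ (Γ.tail e)).charVal (rot (Γ.dir e)) (Φ.pt (Sum.inl e)) =
      (P.inner i).iniChar (rot (Γ.dir e))) ∧
  (∀ j, (Φ.φ (Γ.root (p.fixedEnd j))).charVal (rot (P.boundary j).u)
      (Φ.pt (Sum.inr (Sum.inr (p.fixedEnd j)))) = (P.boundary j).c.ini)

end Enhanced

/-! ### Toric coordinate changes and local equations -/

/-- A toric change of coordinates to the new coordinates `x = χ^mx`, `y = χ^my`, for a lattice
basis `mx, my`, which makes an edge of direction `u` horizontal, with its first endpoint on the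
left. -/
structure ToricChange (u : ℤ × ℤ) where
  mx : ℤ × ℤ
  my : ℤ × ℤ
  basis : det2 mx my = 1 ∨ det2 mx my = -1
  horizontal : dot my u = 0
  left_to_right : 0 < dot mx u

/-- The substitution `x ↦ χ^mx`, `y ↦ χ^my`. It turns an equation in the new coordinates into an
equation in the old coordinates. -/
def ToricChange.subst {u : ℤ × ℤ} (Φ : ToricChange u) : Laurent →+* Laurent :=
  AddMonoidAlgebra.mapDomainRingHom ℂ
    { toFun := fun m : ℤ × ℤ => m.1 • Φ.mx + m.2 • Φ.my
      map_zero' := by simp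
      map_add' := fun a b => by
        simp only [Prod.fst_add, Prod.snd_add, add_smul]
        abel }

/-- With `w = x ^ ε` for `ε = 1` or `ε = -1`, the Laurent polynomial `g` has the form
`(y - η) ^ ℓ + ϑ(y) w + O(w²)` where `ϑ(η) = θ`. -/
def HasLocalForm (ε : ℤ) (ℓ : ℕ) (η θ : ℂ) (g : Laurent) : Prop :=
  (∀ i j : ℤ, ε * i < 0 → g.coeff (i, j) = 0) ∧
  (∀ j : ℕ, g.coeff (0, (j : ℤ)) =
    ((Polynomial.X - Polynomial.C η : Polynomial ℂ) ^ ℓ).coeff j) ∧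
  (∀ j : ℤ, j < 0 → g.coeff (0, j) = 0) ∧
  (g.coeff.sum fun m c => if m.1 = ε then c * η ^ m.2 else 0) = θ

/-- In the coordinates `Φ`, the curves with equations `F₁` (on the left of the edge) and `F₂` (on
the right of the edge) meet the toric divisor common to both at the single point with `y = η`,
and the equations are there of the form `(y - η) ^ ℓ + ϑ₁(y) x⁻¹ + O(x⁻²)` and
`(y - η) ^ ℓ + ϑ₂(y) x + O(x²)` with `ϑ₁(η) = θ₁` and `ϑ₂(η) = θ₂`. -/
def LocalEquations {u : ℤ × ℤ} (Φ : ToricChange u) (ℓ : ℕ) (η θ₁ θ₂ : ℂ) (F₁ F₂ : Laurent) :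
    Prop :=
  ∃ g₁ g₂ : Laurent, Associated (Φ.subst g₁) F₁ ∧ Associated (Φ.subst g₂) F₂ ∧
    HasLocalForm (-1) ℓ η θ₁ g₁ ∧ HasLocalForm 1 ℓ η θ₂ g₂

/-- The edge `conv {(-1, 0), (0, ℓ)}`. -/
def leftEdge (ℓ : ℕ) : Set (ℝ × ℝ) := segment ℝ (-1, 0) (0, (ℓ : ℝ))

/-- The edge `conv {(1, 0), (0, ℓ)}`. -/
def rightEdge (ℓ : ℕ) : Set (ℝ × ℝ) := segment ℝ (1, 0) (0, (ℓ : ℝ))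

/-- `y ^ ℓ + θ * x ^ ε`. -/
def binomialEq (ε : ℤ) (ℓ : ℕ) (θ : ℂ) : Laurent :=
  AddMonoidAlgebra.single ((0 : ℤ), (ℓ : ℤ)) 1 + AddMonoidAlgebra.single (ε, (0 : ℤ)) θ

/-! ### Modification data of an unmarked edge -/

/-- A modification datum of an unmarked edge of direction `u` and weight `ℓ`. The curve `C_mod` is
given by its defining equation, normalized so that the coefficient of `y ^ ℓ` is `1`. -/
structure UnmarkedDatum (u : ℤ × ℤ) (ℓ : ℕ) where
  Φ : ToricChange u
  ζ : Puiseux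
  f : Laurent
  newton : newtonPolygon f = convexHull ℝ {((-1 : ℝ), (0 : ℝ)), (1, 0), (0, (ℓ : ℝ))}
  normalized : f.coeff (0, (ℓ : ℤ)) = 1
  rational : IsRationalCurve f
  vanishing : f.coeff (0, (ℓ : ℤ) - 1) = 0

/-- Coherence of a modification datum with the limit curves at the two endpoints of the edge, given
by their defining equations `F₁` (first endpoint) and `F₂` (second endpoint). -/
def UnmarkedDatum.Coherent {u : ℤ × ℤ} {ℓ : ℕ} (D : UnmarkedDatum u ℓ) (F₁ F₂ : Laurent) : Prop :=
  D.ζ.IsIntegral ∧ ∃ θ₁ θ₂ : ℂ, LocalEquations D.Φ ℓ D.ζ.atZero θ₁ θ₂ F₁ F₂ ∧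
    restrict (leftEdge ℓ) D.f = binomialEq (-1) ℓ θ₁ ∧
    restrict (rightEdge ℓ) D.f = binomialEq 1 ℓ θ₂

/-- The effect of a change of coordinates on modification data. Suppose that the ambient torus
coordinates are multiplied by `a` and `b`, and the toric change of coordinates of `D` is replaced
by the one of `D'`. Then the coordinates `(x, y)` of `D` and `(x', y')` of `D'` are related by
`x' = A * x * y ^ k` and `y' = B * y ^ ε` with `ε = ±1`. At the point `y = ζ₀`, the coordinates
`(x, y - ζ₀)` and `(x', y' - ζ₀')` in which the modification takes place are therefore related, to
leading order, by `x' = A * ζ₀ ^ k * x` and `y' - ζ₀' = (B * ε * ζ₀ ^ (ε - 1)) * (y - ζ₀)`, where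
`ζ₀' = B * ζ₀ ^ ε`. The relation requires that the curves of `D` and `D'` correspond to each
other under this change, and likewise the leading terms of the shifts. -/
def UnmarkedDatum.Related {u : ℤ × ℤ} {ℓ : ℕ} (a b : ℂ) (D D' : UnmarkedDatum u ℓ) : Prop :=
  ∃ k ε : ℤ, (ε = 1 ∨ ε = -1) ∧
    D'.Φ.mx = D.Φ.mx + k • D.Φ.my ∧ D'.Φ.my = ε • D.Φ.my ∧
    D'.ζ.atZero = monom a b D'.Φ.my * D.ζ.atZero ^ ε ∧
    Associated
      (scale (monom a b D'.Φ.mx * D.ζ.atZero ^ k)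
        (monom a b D'.Φ.my * ((ε : ℂ) * D.ζ.atZero ^ (ε - 1))) D'.f) D.f

/-! ### Modification data of a marked edge -/

/-- A modification datum of a marked edge of direction `u` and weight `ℓ`: two peripherally
unibranch rational curves, given by their normalized equations `f₁` and `f₂`, and a modification
datum of the unmarked (horizontal) edge of weight `ℓ` dual to `conv {(0, 0), (0, ℓ)}`. -/
structure MarkedDatum (u : ℤ × ℤ) (ℓ : ℕ) where
  Φ : ToricChange u
  f₁ : Laurent
  f₂ : Laurent
  Ω : UnmarkedDatum (1, 0) ℓ
  newton₁ : newtonPolygon f₁ = convexHull ℝ {((-1 : ℝ), (0 : ℝ)), (0, 0), (0, (ℓ : ℝ))}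
  newton₂ : newtonPolygon f₂ = convexHull ℝ {((0 : ℝ), (0 : ℝ)), (1, 0), (0, (ℓ : ℝ))}
  normalized₁ : f₁.coeff (0, (ℓ : ℤ)) = 1
  normalized₂ : f₂.coeff (0, (ℓ : ℤ)) = 1
  unibranch₁ : IsUnibranchRationalCurve f₁
  unibranch₂ : IsUnibranchRationalCurve f₂

/-- Coherence of a modification datum of an edge which contains a marked point with algebraic point
condition `q`. The curve `f₁ = 0` meets the toric divisor of the edge `conv {(-1, 0), (0, 0)}` at the
point whose coordinate is the initial term of the first coordinate of `q` after the change of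
coordinates, and the initial term of the second coordinate of `q` is the point around which the
modification takes place. -/
def MarkedDatum.Coherent {u : ℤ × ℤ} {ℓ : ℕ} (D : MarkedDatum u ℓ) (q : TorusPoint)
    (F₁ F₂ : Laurent) : Prop :=
  D.Ω.Coherent D.f₁ D.f₂ ∧
  evalAt (q.iniChar D.Φ.mx) 1 (restrict (segment ℝ (-1, 0) (0, 0)) D.f₁) = 0 ∧
  ∃ θ₁ θ₂ : ℂ, LocalEquations D.Φ ℓ (q.iniChar D.Φ.my) θ₁ θ₂ F₁ F₂ ∧
    restrict (leftEdge ℓ) D.f₁ = binomialEq (-1) ℓ θ₁ ∧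
    restrict (rightEdge ℓ) D.f₂ = binomialEq 1 ℓ θ₂

/-- The effect of a change of coordinates on modification data of a marked edge. With `η` the
initial term of the second coordinate of `q`, a change of coordinates `x' = x * y ^ k`, `y' = y ^ ε`
acts on the coordinates `(x, y - η)` of the first modification, to leading order, by
`x' = a * x` and `y' - η ^ ε = b * (y - η)` with `a = η ^ k` and `b = ε * η ^ (ε - 1)`. -/
def MarkedDatum.Related {u : ℤ × ℤ} {ℓ : ℕ} (q : TorusPoint) (D D' : MarkedDatum u ℓ) : Prop :=
  ∃ k ε : ℤ, (ε = 1 ∨ ε = -1) ∧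
    D'.Φ.mx = D.Φ.mx + k • D.Φ.my ∧ D'.Φ.my = ε • D.Φ.my ∧
    Associated (scale (q.iniChar D.Φ.my ^ k) ((ε : ℂ) * q.iniChar D.Φ.my ^ (ε - 1)) D'.f₁) D.f₁ ∧
    Associated (scale (q.iniChar D.Φ.my ^ k) ((ε : ℂ) * q.iniChar D.Φ.my ^ (ε - 1)) D'.f₂) D.f₂ ∧
    UnmarkedDatum.Related (q.iniChar D.Φ.my ^ k) ((ε : ℂ) * q.iniChar D.Φ.my ^ (ε - 1)) D.Ω D'.Ω

/-! ### Modification data of an enhanced tropical curve -/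

section Modification

variable {V E L : Type*} [Fintype V] [Fintype E] [Fintype L] [DecidableEq V]
variable {Γ : PlaneTropicalCurve V E L} {n r : ℕ}

/-- Modification data of a bounded edge. A marked edge of weight `1` is not modified, so it carries
only the trivial datum. -/
inductive EdgeDatum (p : Marking Γ n r) (e : E) : Type _
  | unmarked (h : ∀ i, ¬ p.OnEdge i e) (D : UnmarkedDatum (Γ.dir e) (Γ.wt e)) : EdgeDatum p e
  | marked (i : Fin n) (h : p.OnEdge i e) (hw : 1 < Γ.wt e)
      (D : MarkedDatum (Γ.dir e) (Γ.wt e)) : EdgeDatum p e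
  | trivial (i : Fin n) (h : p.OnEdge i e) (hw : Γ.wt e = 1) : EdgeDatum p e

/-- Coherence with the limit curves at the two endpoints of the edge. -/
def EdgeDatum.Coherent {p : Marking Γ n r} {e : E} (Φ : Enhancement Γ) (P : PointConditions n r) :
    EdgeDatum p e → Prop
  | .unmarked _ D => ∃ F₁ F₂ : Laurent, IsDefiningEquation F₁ (Φ.φ (Γ.tail e)) ∧
      IsDefiningEquation F₂ (Φ.φ (Γ.head e)) ∧ D.Coherent F₁ F₂
  | .marked i _ _ D => ∃ F₁ F₂ : Laurent, IsDefiningEquation F₁ (Φ.φ (Γ.tail e)) ∧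
      IsDefiningEquation F₂ (Φ.φ (Γ.head e)) ∧ D.Coherent (P.inner i) F₁ F₂
  | .trivial _ _ _ => True

/-- Modification data of an edge are equivalent if they are related by a change of the toric
coordinates in which the modification is performed. -/
def EdgeDatum.Related {p : Marking Γ n r} {e : E} (P : PointConditions n r) :
    EdgeDatum p e → EdgeDatum p e → Prop
  | .unmarked _ D, .unmarked _ D' => UnmarkedDatum.Related 1 1 D D'
  | .marked i _ _ D, .marked j _ _ D' => i = j ∧ MarkedDatum.Related (P.inner i) D D'
  | .trivial i _ _, .trivial j _ _ => i = j
  | _, _ => False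

/-- Coherent modification data of a bounded edge. -/
def CoherentEdgeDatum (p : Marking Γ n r) (Φ : Enhancement Γ) (P : PointConditions n r) (e : E) :
    Type _ := {D : EdgeDatum p e // D.Coherent Φ P}

/-- Equivalence classes of coherent modification data of a bounded edge. -/
def EdgeModificationClasses (p : Marking Γ n r) (Φ : Enhancement Γ) (P : PointConditions n r)
    (e : E) : Type _ :=
  Quot fun D D' : CoherentEdgeDatum p Φ P e => D.1.Related P D'.1

/-- Equivalence classes of coherent modification data of the enhanced tropical curve: one coherent
datum for every bounded edge, up to equivalence on every edge. -/
def ModificationClasses (p : Marking Γ n r) (Φ : Enhancement Γ) (P : PointConditions n r) :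
    Type _ :=
  Quot fun D D' : (∀ e : E, CoherentEdgeDatum p Φ P e) => ∀ e, (D e).1.Related P (D' e).1

end Modification

end TropMod

end

noncomputable section

namespace TropMod

/-! ### Monomials and evaluation -/

section Monom

variable {F : Type*} [Field F]

/-! Everything is local at one bounded edge `E` of weight `ℓ`. A limit curve at a trivalent vertex
meets the toric boundary in three points of the projective line. In the coordinate `T` with value
`1` at the point over `E` and `0`, `∞` at the other two, its torus coordinates are constants times
powers of `T` and `T - 1`. After a toric change the branch at `E` reads `y = η T ^ m` and `x ^ ε = c
T ^ k (T - 1) ^ ℓ`. A norm over the substitutions `T ↦ ζ T` produces the local equation, and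
expansion at `T = 1` forces `θ = -(η m) ^ ℓ / c`. Hence `η`, `θ₁`, `θ₂` are explicit nonzero
functions of the toric change (`BranchPair.localEquations_iff`).

Unmarked edge: the Newton triangle and the prescribed edges leave `θ₁ x⁻¹ + θ₂ x + P(y)` with `P`
monic of degree `ℓ` and without `y ^ (ℓ - 1)` term. Rationality forces a parametrization `x = c t ^
ℓ`, `y = a t + b + d t⁻¹`, so `P` is the Dickson polynomial with parameter `α`, where `α ^ ℓ = θ₁
θ₂` (`Parametrizes.eq_dickson`); conversely each such `α` gives a rational curve
(`isRationalCurve_dickson`). The number `z = α / η ^ 2` is unchanged by toric changes, `z ^ ℓ`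
depends only on the edge, and `z` is a complete invariant of the class
(`UnmarkedDatum.related_iff`). This gives `ℓ` classes.

Marked edge with `ℓ > 1`: unibranchness makes the two curves `θ₁ x⁻¹ + (y - ξ) ^ ℓ` and `θ₂ x + (y -
ξ) ^ ℓ`, with the same `ξ` because the refined datum `Ω` needs a common point. The point condition
fixes `(-ξ) ^ ℓ`, so, normalized by `η` and a sign, `ξ` is an `ℓ`-th root `w` of a constant of the
edge. For each `w` the datum `Ω` is an unmarked datum with its own invariant `z`, and `z ^ ℓ` does
not depend on which root `w` was taken. This gives `ℓ ^ 2` classes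
(`BranchPair.marked_coherent_iff`, `MarkedDatum.related_iff`). The total count is the product over
the bounded edges, since equivalence is edgewise. -/

theorem monom_zero (a b : F) : monom a b 0 = 1 := by simp [monom]

theorem monom_add {a b : F} (ha : a ≠ 0) (hb : b ≠ 0) (m n : ℤ × ℤ) :
    monom a b (m + n) = monom a b m * monom a b n := by
  simp only [monom, Prod.fst_add, Prod.snd_add, zpow_add₀ ha, zpow_add₀ hb]
  ring

theorem monom_ne_zero {a b : F} (ha : a ≠ 0) (hb : b ≠ 0) (m : ℤ × ℤ) : monom a b m ≠ 0 :=
  mul_ne_zero (zpow_ne_zero _ ha) (zpow_ne_zero _ hb)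

theorem monom_smul (a b : F) (k : ℤ) (m : ℤ × ℤ) : monom a b (k • m) = monom a b m ^ k := by
  simp only [monom, Prod.smul_fst, Prod.smul_snd, smul_eq_mul, mul_zpow]
  rw [mul_comm k, mul_comm k, zpow_mul, zpow_mul]

theorem monom_monom {a b : F} (ha : a ≠ 0) (hb : b ≠ 0) (m n k : ℤ × ℤ) :
    monom (monom a b m) (monom a b n) k = monom a b (k.1 • m + k.2 • n) := by
  rw [monom_add ha hb, monom_smul, monom_smul]
  rfl

theorem map_monom {F' : Type*} [Field F'] (τ : F →+* F') (a b : F) (m : ℤ × ℤ) :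
    τ (monom a b m) = monom (τ a) (τ b) m := by
  simp [monom, map_zpow₀]

variable [Algebra ℂ F]

/-- Evaluation of Laurent polynomials at a pair of nonzero elements, as a homomorphism. -/
def evalHom (a b : F) (ha : a ≠ 0) (hb : b ≠ 0) : Laurent →ₐ[ℂ] F :=
  AddMonoidAlgebra.lift ℂ F (ℤ × ℤ)
    { toFun := fun m => monom a b m.toAdd
      map_one' := monom_zero a b
      map_mul' := fun m n => monom_add ha hb m.toAdd n.toAdd }

theorem evalHom_apply (a b : F) (ha : a ≠ 0) (hb : b ≠ 0) (f : Laurent) :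
    evalHom a b ha hb f = evalAt a b f := by
  rw [evalHom, AddMonoidAlgebra.lift_apply, evalAt]
  simp only [Algebra.smul_def]
  rfl

theorem evalHom_single (a b : F) (ha : a ≠ 0) (hb : b ≠ 0) (m : ℤ × ℤ) (c : ℂ) :
    evalHom a b ha hb (AddMonoidAlgebra.single m c) = algebraMap ℂ F c * monom a b m := by
  rw [evalHom, AddMonoidAlgebra.lift_single, Algebra.smul_def]
  rfl

theorem evalAt_map {F' : Type*} [Field F'] [Algebra ℂ F'] (τ : F →ₐ[ℂ] F') (a b : F)
    (f : Laurent) : evalAt (τ a) (τ b) f = τ (evalAt a b f) := by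
  simp only [evalAt, Finsupp.sum, map_sum, map_mul, AlgHom.commutes]
  refine Finset.sum_congr rfl fun m _ => ?_
  exact congrArg _ (map_monom (τ : F →+* F') a b m).symm

end Monom

/-! ### Toric changes -/

section Toric

variable {u : ℤ × ℤ} (Φ : ToricChange u)

theorem ToricChange.subst_single (m : ℤ × ℤ) (c : ℂ) :
    Φ.subst (AddMonoidAlgebra.single m c) =
      AddMonoidAlgebra.single (m.1 • Φ.mx + m.2 • Φ.my) c := by
  simp [ToricChange.subst, AddMonoidAlgebra.mapDomainRingHom]

theorem ToricChange.evalAt_subst {F : Type*} [Field F] [Algebra ℂ F] {a b : F} (ha : a ≠ 0)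
    (hb : b ≠ 0) (g : Laurent) :
    evalAt a b (Φ.subst g) = evalAt (monom a b Φ.mx) (monom a b Φ.my) g := by
  rw [← evalHom_apply a b ha hb,
    ← evalHom_apply _ _ (monom_ne_zero ha hb Φ.mx) (monom_ne_zero ha hb Φ.my)]
  induction g using AddMonoidAlgebra.induction_linear with
  | zero => simp
  | add f g hf hg => rw [map_add, map_add, hf, hg, map_add]
  | single m c =>
    rw [Φ.subst_single, evalHom_single, evalHom_single, monom_monom ha hb]

theorem ToricChange.det_mul_self : det2 Φ.mx Φ.my * det2 Φ.mx Φ.my = 1 := by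
  rcases Φ.basis with h | h <;> rw [h] <;> norm_num

/-- The exponent map has determinant `±1`. Cramer's rule inverts it over the integers, with
multiplication by the determinant in place of division, since its square is `1`. -/
theorem ToricChange.subst_bijective : Function.Bijective Φ.subst := by
  have hd := Φ.det_mul_self
  constructor
  · refine AddMonoidAlgebra.mapDomain_injective ?_
    intro m n h
    simp only [AddMonoidHom.coe_mk, ZeroHom.coe_mk, Prod.ext_iff, Prod.fst_add, Prod.snd_add,
      Prod.smul_fst, Prod.smul_snd, smul_eq_mul] at h
    obtain ⟨h1, h2⟩ := h
    simp only [det2] at hd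
    ext
    · linear_combination (Φ.mx.1 * Φ.my.2 - Φ.mx.2 * Φ.my.1) * (Φ.my.2 * h1 - Φ.my.1 * h2) -
        (m.1 - n.1) * hd
    · linear_combination (Φ.mx.1 * Φ.my.2 - Φ.mx.2 * Φ.my.1) * (Φ.mx.1 * h2 - Φ.mx.2 * h1) -
        (m.2 - n.2) * hd
  · intro f
    induction f using AddMonoidAlgebra.induction_linear with
    | zero => exact ⟨0, map_zero _⟩
    | add f g hf hg =>
      obtain ⟨f', rfl⟩ := hf
      obtain ⟨g', rfl⟩ := hg
      exact ⟨f' + g', map_add _ _ _⟩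
    | single m c =>
      refine ⟨AddMonoidAlgebra.single (det2 Φ.mx Φ.my * det2 m Φ.my,
        det2 Φ.mx Φ.my * det2 Φ.mx m) c, ?_⟩
      rw [Φ.subst_single]
      congr 1
      simp only [det2] at hd ⊢
      ext
      · simp only [Prod.fst_add, Prod.smul_fst, smul_eq_mul]
        linear_combination m.1 * hd
      · simp only [Prod.snd_add, Prod.smul_snd, smul_eq_mul]
        linear_combination m.2 * hd

/-- The substitution as an isomorphism. -/
def ToricChange.substEquiv : Laurent ≃+* Laurent := RingEquiv.ofBijective Φ.subst Φ.subst_bijective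

theorem ToricChange.irreducible_subst_iff (g : Laurent) :
    Irreducible (Φ.subst g) ↔ Irreducible g :=
  MulEquiv.irreducible_iff (Φ.substEquiv : Laurent ≃* Laurent)

end Toric

/-! ### Laurent polynomials as polynomials in one variable over Laurent polynomials in the other -/

section Theta

open Polynomial LaurentPolynomial

/-- Laurent polynomials in the second variable. -/
def yHom : ℂ[T;T⁻¹] →+* Laurent :=
  AddMonoidAlgebra.mapDomainRingHom ℂ (AddMonoidHom.inr ℤ ℤ)

theorem yHom_single (j : ℤ) (c : ℂ) :
    yHom (AddMonoidAlgebra.single j c) = AddMonoidAlgebra.single (0, j) c := by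
  simp [yHom, AddMonoidAlgebra.mapDomainRingHom, -LaurentPolynomial.single_eq_C_mul_T]

/-- The substitution of `x ^ ε` for the variable of a polynomial over the Laurent polynomials in
`y`. -/
def theta (ε : ℤ) : ℂ[T;T⁻¹][X] →+* Laurent :=
  Polynomial.eval₂RingHom yHom (AddMonoidAlgebra.single (ε, 0) 1)

theorem theta_C (ε : ℤ) (p : ℂ[T;T⁻¹]) : theta ε (Polynomial.C p) = yHom p := by simp [theta]

theorem theta_monomial (ε : ℤ) (n : ℕ) (j : ℤ) (c : ℂ) :
    theta ε (Polynomial.monomial n (AddMonoidAlgebra.single j c)) =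
      AddMonoidAlgebra.single (ε * n, j) c := by
  rw [theta, Polynomial.coe_eval₂RingHom, Polynomial.eval₂_monomial, yHom_single,
    AddMonoidAlgebra.single_pow, AddMonoidAlgebra.single_mul_single]
  congr 1
  · ext <;> simp [mul_comm]
  · simp

theorem theta_coeff {ε : ℤ} (hε : ε = 1 ∨ ε = -1) (p : ℂ[T;T⁻¹][X]) (i j : ℤ) :
    (theta ε p).coeff (i, j) = if 0 ≤ ε * i then (p.coeff (ε * i).toNat).coeff j else 0 := by
  induction p using Polynomial.induction_on' with
  | add p q hp hq =>
    rw [map_add, AddMonoidAlgebra.coeff_add, Finsupp.add_apply, hp, hq]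
    split_ifs <;> simp
  | monomial n a =>
    induction a using AddMonoidAlgebra.induction_linear with
    | zero => simp
    | add f g hf hg =>
      rw [map_add, map_add, AddMonoidAlgebra.coeff_add, Finsupp.add_apply, hf, hg]
      split_ifs <;> simp
    | single k c =>
      rw [theta_monomial, AddMonoidAlgebra.coeff_single, Finsupp.single_apply]
      simp only [Prod.mk.injEq, Polynomial.coeff_monomial]
      rcases hε with rfl | rfl
      · by_cases hi : 0 ≤ i
        · lift i to ℕ using hi
          by_cases hn : n = i <;>
            simp [hn, Finsupp.single_apply, -LaurentPolynomial.single_eq_C_mul_T]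
        · have : (1 : ℤ) * n ≠ i := by omega
          simp [hi]
          omega
      · by_cases hi : 0 ≤ -i
        · obtain ⟨i', rfl⟩ : ∃ i' : ℕ, i = -i' := ⟨(-i).toNat, by omega⟩
          by_cases hn : n = i' <;>
            simp [hn, Finsupp.single_apply, -LaurentPolynomial.single_eq_C_mul_T]
        · simp [show ¬ i ≤ 0 by omega]
          omega

theorem exists_theta_eq {ε : ℤ} (hε : ε = 1 ∨ ε = -1) {g : Laurent}
    (hg : ∀ i j : ℤ, ε * i < 0 → g.coeff (i, j) = 0) : ∃ p, theta ε p = g := by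
  have key : g ∈ (theta ε).range := by
    rw [← AddMonoidAlgebra.sum_coeff_single g]
    refine Subring.sum_mem _ fun m hm => ?_
    have hm' : 0 ≤ ε * m.1 := by
      by_contra h
      exact (Finsupp.mem_support_iff.1 hm) (hg m.1 m.2 (by omega))
    refine ⟨Polynomial.monomial (ε * m.1).toNat (AddMonoidAlgebra.single m.2 (g.coeff m)), ?_⟩
    rw [theta_monomial, Int.toNat_of_nonneg hm', ← mul_assoc]
    rcases hε with rfl | rfl <;> simp
  exact key

/-- Clears the negative powers of `x ^ ε`. The factor is a unit, so divisibility questions about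
Laurent polynomials become questions about polynomials in one variable, where division by a monic
polynomial is available. -/
theorem exists_theta_eq_mul {ε : ℤ} (hε : ε = 1 ∨ ε = -1) (g : Laurent) :
    ∃ (p : ℂ[T;T⁻¹][X]) (N : ℕ), theta ε p = g * AddMonoidAlgebra.single (ε * N, 0) 1 := by
  obtain ⟨N, hN⟩ : ∃ N : ℕ, ∀ m ∈ g.coeff.support, -(N : ℤ) ≤ ε * m.1 := by
    refine ⟨g.coeff.support.sup fun m => (-(ε * m.1)).toNat, fun m hm => ?_⟩
    have := Finset.le_sup (f := fun m : ℤ × ℤ => (-(ε * m.1)).toNat) hm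
    omega
  have hc : ∀ i j : ℤ, ε * i < 0 →
      (g * AddMonoidAlgebra.single (ε * N, 0) 1 : Laurent).coeff (i, j) = 0 := by
    intro i j hij
    rw [AddMonoidAlgebra.coeff_mul_single_apply, mul_one]
    by_contra h
    have := hN _ (Finsupp.mem_support_iff.2 h)
    rcases hε with rfl | rfl <;> simp at this hij <;> omega
  obtain ⟨p, hp⟩ := exists_theta_eq hε hc
  exact ⟨p, N, hp⟩

theorem isUnit_single (m : ℤ × ℤ) {c : ℂ} (hc : c ≠ 0) :
    IsUnit (AddMonoidAlgebra.single m c : Laurent) := by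
  refine IsUnit.of_mul_eq_one (AddMonoidAlgebra.single (-m) c⁻¹) ?_
  rw [AddMonoidAlgebra.single_mul_single, add_neg_cancel, mul_inv_cancel₀ hc]
  rfl

end Theta

/-! ### Kernels of evaluation maps -/

section Kernel

open Polynomial LaurentPolynomial

variable {K : Type*} [Field K] [Algebra ℂ K]

/-- Evaluation of Laurent polynomials in one variable at a nonzero element. -/
def yEval (y : K) (hy : y ≠ 0) : ℂ[T;T⁻¹] →+* K :=
  LaurentPolynomial.eval₂ (algebraMap ℂ K) (Units.mk0 y hy)

theorem yEval_single (y : K) (hy : y ≠ 0) (j : ℤ) (c : ℂ) :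
    yEval y hy (AddMonoidAlgebra.single j c) = algebraMap ℂ K c * y ^ j := by
  rw [yEval, LaurentPolynomial.single_eq_C_mul_T, LaurentPolynomial.eval₂_C_mul_T]
  simp

theorem evalAt_theta (ε : ℤ) (x y : K) (hx : x ≠ 0) (hy : y ≠ 0) (p : ℂ[T;T⁻¹][X]) :
    evalAt x y (theta ε p) = p.eval₂ (yEval y hy) (x ^ ε) := by
  rw [← evalHom_apply x y hx hy]
  induction p using Polynomial.induction_on' with
  | add p q hp hq => rw [map_add, map_add, hp, hq, Polynomial.eval₂_add]
  | monomial n a =>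
    induction a using AddMonoidAlgebra.induction_linear with
    | zero => simp
    | add f g hf hg => rw [map_add, map_add, map_add, hf, hg, Polynomial.eval₂_add]
    | single k c =>
      rw [theta_monomial, evalHom_single, Polynomial.eval₂_monomial, yEval_single, monom]
      simp only [zpow_mul, zpow_natCast]
      ring

/-- A Galois argument without Galois theory. The remainder of `f` modulo the monic `p` has degree
below `deg p`. It vanishes at `x ^ ε` and hence at every `σ i x ^ ε`, because its coefficients are
functions of `y`, which each `σ i` fixes. At least `deg p` distinct roots force the remainder to be
zero. So `theta ε p` generates the ideal of the curve. -/
theorem theta_dvd_of_evalAt_eq_zero {ε : ℤ} (hε : ε = 1 ∨ ε = -1) {x y : K} (hx : x ≠ 0)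
    (hy : y ≠ 0) (hinj : Function.Injective (yEval y hy)) {p : ℂ[T;T⁻¹][X]} (hp : p.Monic)
    {ι : Type*} [Fintype ι] (σ : ι → K →ₐ[ℂ] K) (hσy : ∀ i, σ i y = y)
    (hσx : Function.Injective fun i => σ i x) (hcard : p.natDegree ≤ Fintype.card ι)
    (hp0 : evalAt x y (theta ε p) = 0) (f : Laurent) (hf : evalAt x y f = 0) :
    theta ε p ∣ f := by
  obtain ⟨q, N, hq⟩ := exists_theta_eq_mul hε f
  have hq0 : evalAt x y (theta ε q) = 0 := by
    rw [hq, ← evalHom_apply x y hx hy, map_mul, evalHom_apply, hf, zero_mul]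
  set r := q %ₘ p with hr
  have hr0 : evalAt x y (theta ε r) = 0 := by
    rw [hr, Polynomial.modByMonic_eq_sub_mul_div q p, map_sub, map_mul,
      ← evalHom_apply x y hx hy, map_sub, map_mul, evalHom_apply, evalHom_apply, hq0, hp0]
    simp
  have hroots : ∀ i, (r.map (yEval y hy)).eval (σ i x ^ ε) = 0 := by
    intro i
    rw [Polynomial.eval_map, ← evalAt_theta ε (σ i x) y
      ((map_ne_zero_iff _ (σ i).toRingHom.injective).2 hx) hy]
    conv_lhs => rw [← hσy i]
    rw [evalAt_map, hr0, map_zero]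
  have hr_zero : r.map (yEval y hy) = 0 := by
    refine Polynomial.eq_zero_of_natDegree_lt_card_of_eval_eq_zero _
      (f := fun i => σ i x ^ ε) ?_ hroots ?_
    · intro i j hij
      apply hσx
      rcases hε with rfl | rfl
      · simpa using hij
      · simpa using hij
    -- The strict degree bound for the remainder fails for `p = 1`; that case is impossible because
    -- `p` vanishes at the point.
    · by_cases h1 : p = 1
      · exfalso
        rw [h1, map_one, ← evalHom_apply x y hx hy, map_one] at hp0
        exact one_ne_zero hp0
      · exact lt_of_le_of_lt (Polynomial.natDegree_map_le)
          (lt_of_lt_of_le (Polynomial.natDegree_modByMonic_lt q hp h1) hcard)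
  have hr' : r = 0 := Polynomial.map_injective _ hinj (by rw [hr_zero, Polynomial.map_zero])
  obtain ⟨s, hs⟩ := (Polynomial.modByMonic_eq_zero_iff_dvd hp).1 hr'
  have hdvd : theta ε p ∣ f * AddMonoidAlgebra.single (ε * N, 0) 1 := by
    rw [← hq, hs, map_mul]
    exact dvd_mul_right _ _
  exact (isUnit_single _ one_ne_zero).dvd_mul_right.1 hdvd

/-- The kernel of a homomorphism to a field is a prime ideal, so a nonzero generator of it is a
prime element. -/
theorem irreducible_of_generates_kernel {x y : K} (hx : x ≠ 0) (hy : y ≠ 0) {g : Laurent}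
    (hg : g ≠ 0) (hg0 : evalAt x y g = 0) (h : ∀ f, evalAt x y f = 0 → g ∣ f) :
    Irreducible g := by
  refine Prime.irreducible ⟨hg, fun hu => ?_, fun a b hab => ?_⟩
  · have := hu.map (evalHom x y hx hy)
    rw [evalHom_apply, hg0] at this
    exact not_isUnit_zero this
  · obtain ⟨c, hc⟩ := hab
    have h0 : evalAt x y a * evalAt x y b = 0 := by
      rw [← evalHom_apply x y hx hy, ← evalHom_apply x y hx hy, ← map_mul, hc, map_mul,
        evalHom_apply, hg0, zero_mul]
    exact (mul_eq_zero.1 h0).imp (h a) (h b)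

theorem theta_injective {ε : ℤ} (hε : ε = 1 ∨ ε = -1) : Function.Injective (theta ε) := by
  rw [injective_iff_map_eq_zero]
  intro p hp
  ext n j
  have := theta_coeff hε p (ε * n) j
  rw [hp] at this
  rcases hε with rfl | rfl <;> simpa using this.symm

end Kernel

/-! ### Monomial substitutions in one variable -/

section Scale

open Polynomial LaurentPolynomial

/-- The substitution of `η * T ^ m` for the variable `T`. -/
def monoSubst (η : ℂˣ) (m : ℤ) : ℂ[T;T⁻¹] →+* ℂ[T;T⁻¹] :=
  LaurentPolynomial.eval₂ LaurentPolynomial.C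
    ((Units.map (LaurentPolynomial.C : ℂ →+* ℂ[T;T⁻¹]).toMonoidHom η) *
      (isUnit_T m : IsUnit (T m : ℂ[T;T⁻¹])).unit)

theorem monoSubst_T (η : ℂˣ) (m j : ℤ) :
    monoSubst η m (T j) = LaurentPolynomial.C ((η : ℂ) ^ j) * T (m * j) := by
  have hT : ∀ j : ℤ, (((isUnit_T m : IsUnit (T m : ℂ[T;T⁻¹])).unit ^ j : ℂ[T;T⁻¹]ˣ) : ℂ[T;T⁻¹]) =
      T (m * j) := by
    intro j
    induction j using Int.induction_on with
    | zero => simp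
    | succ j ih =>
      rw [zpow_add_one, Units.val_mul, ih, IsUnit.unit_spec, ← T_add]
      ring_nf
    | pred j ih =>
      rw [zpow_sub_one, Units.val_mul, ih, Units.mul_inv_eq_iff_eq_mul, IsUnit.unit_spec, ← T_add]
      ring_nf
  rw [monoSubst, LaurentPolynomial.eval₂_T, mul_zpow, Units.val_mul, hT, ← map_zpow]
  congr 1
  rw [← Units.val_zpow_eq_zpow_val]
  rfl

theorem monoSubst_single (η : ℂˣ) (m j : ℤ) (c : ℂ) :
    monoSubst η m (AddMonoidAlgebra.single j c) =
      AddMonoidAlgebra.single (m * j) (c * (η : ℂ) ^ j) := by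
  rw [single_eq_C_mul_T, map_mul, monoSubst_T, monoSubst, LaurentPolynomial.eval₂_C, ← mul_assoc, ← map_mul,
    single_eq_C_mul_T]

theorem monoSubst_coeff (η : ℂˣ) {m : ℤ} (hm : m ≠ 0) (f : ℂ[T;T⁻¹]) (j : ℤ) :
    (monoSubst η m f).coeff (m * j) = f.coeff j * (η : ℂ) ^ j := by
  induction f using AddMonoidAlgebra.induction_linear with
  | zero => simp
  | add f g hf hg =>
    rw [map_add, AddMonoidAlgebra.coeff_add, Finsupp.add_apply, hf, hg, AddMonoidAlgebra.coeff_add,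
      Finsupp.add_apply, add_mul]
  | single k c =>
    rw [monoSubst_single, AddMonoidAlgebra.coeff_single, AddMonoidAlgebra.coeff_single,
      Finsupp.single_apply, Finsupp.single_apply]
    by_cases h : k = j
    · simp [h]
    · simp [h, hm]

theorem monoSubst_injective (η : ℂˣ) {m : ℤ} (hm : m ≠ 0) :
    Function.Injective (monoSubst η m) := by
  rw [injective_iff_map_eq_zero]
  intro f hf
  refine LaurentPolynomial.ext fun j => ?_
  have := monoSubst_coeff η hm f j
  rw [hf] at this
  simpa [zpow_ne_zero] using this.symm

theorem monoSubst_mul_apply (ζ ξ : ℂˣ) (f : ℂ[T;T⁻¹]) :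
    monoSubst ζ 1 (monoSubst ξ 1 f) = monoSubst (ζ * ξ) 1 f := by
  refine LaurentPolynomial.ext fun j => ?_
  have h := monoSubst_coeff ζ one_ne_zero (monoSubst ξ 1 f) j
  have h2 := monoSubst_coeff ξ one_ne_zero f j
  have h3 := monoSubst_coeff (ζ * ξ) one_ne_zero f j
  rw [one_mul] at h h2 h3
  rw [h, h2, h3, Units.val_mul, mul_zpow]
  ring

/-- Invariance under one primitive `|m|`-th root of unity already forces every exponent of `f` to be
a multiple of `m`. This is the descent from functions of `T` to functions of `y = η T ^ m`. -/
theorem mem_range_monoSubst (η : ℂˣ) {m : ℤ} (hm : m ≠ 0) {f : ℂ[T;T⁻¹]}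
    (hf : ∀ ζ ∈ rootsOfUnity m.natAbs ℂ, monoSubst ζ 1 f = f) :
    f ∈ (monoSubst η m).range := by
  have hdvd : ∀ n ∈ f.coeff.support, m ∣ n := by
    intro n hn
    have hprim := Complex.isPrimitiveRoot_exp m.natAbs (by simpa using hm)
    obtain ⟨ζ, hζ⟩ := hprim.isUnit (by simpa using hm)
    have hζm : ζ ∈ rootsOfUnity m.natAbs ℂ := by
      rw [mem_rootsOfUnity]
      ext
      rw [Units.val_pow_eq_pow_val, hζ, hprim.pow_eq_one, Units.val_one]
    have h := monoSubst_coeff ζ one_ne_zero f n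
    rw [hf ζ hζm, one_mul] at h
    have hn0 : f.coeff n ≠ 0 := Finsupp.mem_support_iff.1 hn
    have hz : (ζ : ℂ) ^ n = 1 := by
      have : f.coeff n * ((ζ : ℂ) ^ n) = f.coeff n * 1 := by rw [← h, mul_one]
      exact mul_left_cancel₀ hn0 this
    rw [hζ, hprim.zpow_eq_one_iff_dvd] at hz
    exact Int.natAbs_dvd.1 hz
  rw [← AddMonoidAlgebra.sum_coeff_single f]
  refine Subring.sum_mem _ fun n hn => ?_
  obtain ⟨j, rfl⟩ := hdvd n hn
  refine ⟨AddMonoidAlgebra.single j (f.coeff (m * j) * (η : ℂ) ^ (-j)), ?_⟩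
  rw [monoSubst_single, mul_assoc, ← zpow_add₀ η.ne_zero]
  simp

theorem prod_rootsOfUnity_X_sub (M : ℕ) [NeZero M] [Fintype (rootsOfUnity M ℂ)] :
    ∏ ζ : rootsOfUnity M ℂ, (Polynomial.X - Polynomial.C (((ζ : ℂˣ) : ℂ))) =
      (Polynomial.X : ℂ[X]) ^ M - 1 := by
  rw [X_pow_sub_one_eq_prod (Nat.pos_of_ne_zero (NeZero.ne M))
    (Complex.isPrimitiveRoot_exp M (NeZero.ne M))]
  refine Finset.prod_bij (fun ζ _ => ((ζ : ℂˣ) : ℂ)) ?_ ?_ ?_ ?_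
  · intro ζ _
    rw [Polynomial.mem_nthRootsFinset (Nat.pos_of_ne_zero (NeZero.ne M))]
    have := (mem_rootsOfUnity M (ζ : ℂˣ)).1 ζ.2
    rw [← Units.val_pow_eq_pow_val, this, Units.val_one]
  · intro a _ b _ hab
    exact Subtype.ext (Units.ext hab)
  · intro z hz
    rw [Polynomial.mem_nthRootsFinset (Nat.pos_of_ne_zero (NeZero.ne M))] at hz
    exact ⟨rootsOfUnity.mkOfPowEq z hz, Finset.mem_univ _, by simp⟩
  · intros; rfl

end Scale

/-! ### Rational functions -/

section RatFuncMaps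

open Polynomial LaurentPolynomial

/-- The substitution of a transcendental rational function for the variable. -/
def substHom (t : RatFunc ℂ) (ht : Transcendental ℂ t) : RatFunc ℂ →ₐ[ℂ] RatFunc ℂ :=
  (IntermediateField.val _).comp (RatFunc.algEquivOfTranscendental t ht).toAlgHom

theorem substHom_X (t : RatFunc ℂ) (ht : Transcendental ℂ t) : substHom t ht RatFunc.X = t := by
  have := RatFunc.algEquivOfTranscendental_X t ht
  simp [substHom]

theorem transcendental_of_intDegree_ne_zero {t : RatFunc ℂ} (ht : t.intDegree ≠ 0) :
    Transcendental ℂ t := by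
  refine RatFunc.transcendental_of_ne_C _ ?_
  rintro ⟨c, rfl⟩
  exact ht (RatFunc.intDegree_C c)

theorem map_yEval {K K' : Type*} [Field K] [Field K'] [Algebra ℂ K] [Algebra ℂ K']
    (τ : K →ₐ[ℂ] K') (y : K) (hy : y ≠ 0) (hy' : τ y ≠ 0) (a : ℂ[T;T⁻¹]) :
    τ (yEval y hy a) = yEval (τ y) hy' a := by
  induction a using AddMonoidAlgebra.induction_linear with
  | zero => simp
  | add f g hf hg => rw [map_add, map_add, map_add, hf, hg]
  | single k c =>
    rw [yEval_single, yEval_single, map_mul, AlgHom.commutes, map_zpow₀]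

theorem yEval_monoSubst {K : Type*} [Field K] [Algebra ℂ K] (y y' : K) (hy : y ≠ 0)
    (hy0 : y' ≠ 0) (η : ℂˣ) (m : ℤ) (hy' : y' = algebraMap ℂ K η * y ^ m) (a : ℂ[T;T⁻¹]) :
    yEval y hy (monoSubst η m a) = yEval y' hy0 a := by
  induction a using AddMonoidAlgebra.induction_linear with
  | zero => simp
  | add f g hf hg => rw [map_add, map_add, map_add, hf, hg]
  | single k c =>
    rw [monoSubst_single, yEval_single, yEval_single, hy', mul_zpow, map_mul, map_zpow₀, zpow_mul]
    ring

theorem yEval_toLaurent {K : Type*} [Field K] [Algebra ℂ K] (y : K) (hy : y ≠ 0) (p : ℂ[X]) :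
    yEval y hy (toLaurent p) = aeval y p := by
  rw [yEval, LaurentPolynomial.eval₂_toLaurent]
  rfl

/-- A power of `T` is a unit, so a Laurent polynomial in the kernel may be replaced by an ordinary
polynomial, and transcendence applies. -/
theorem yEval_injective {K : Type*} [Field K] [Algebra ℂ K] {y : K} (hy : y ≠ 0)
    (htr : Transcendental ℂ y) : Function.Injective (yEval y hy) := by
  rw [injective_iff_map_eq_zero]
  intro f hf
  obtain ⟨n, f', hf'⟩ := f.exists_T_pow
  have h := yEval_toLaurent y hy f'
  rw [hf', map_mul, hf, zero_mul] at h
  have h0 : f' = 0 := by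
    by_contra h1
    exact htr ⟨f', h1, h.symm⟩
  rw [h0, map_zero] at hf'
  exact (isUnit_T (n : ℤ)).mul_left_eq_zero.1 hf'.symm

theorem yEval_X_injective :
    Function.Injective (yEval (RatFunc.X : RatFunc ℂ) RatFunc.X_ne_zero) :=
  yEval_injective _ RatFunc.transcendental_X

end RatFuncMaps

/-! ### Local equations of parametrized branches -/

section Branch

open Polynomial LaurentPolynomial

/-- The local parametrization `c * T ^ k * (T - 1) ^ ℓ` of the equation of a toric divisor. -/
def branchPoly (c : ℂ) (k : ℤ) (ℓ : ℕ) : ℂ[T;T⁻¹] :=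
  LaurentPolynomial.C c * T k * (T 1 - 1) ^ ℓ

theorem monoSubst_C (η : ℂˣ) (m : ℤ) (c : ℂ) :
    monoSubst η m (LaurentPolynomial.C c) = LaurentPolynomial.C c := by
  rw [monoSubst, LaurentPolynomial.eval₂_C]

theorem monoSubst_branchPoly (ζ : ℂˣ) (c : ℂ) (k : ℤ) (ℓ : ℕ) :
    monoSubst ζ 1 (branchPoly c k ℓ) = LaurentPolynomial.C (c * (ζ : ℂ) ^ k) * T k *
      (LaurentPolynomial.C (ζ : ℂ) * T 1 - 1) ^ ℓ := by
  simp only [branchPoly, map_mul, map_pow, map_sub, map_one, monoSubst_T, monoSubst_C, one_mul,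
    zpow_one]
  ring

/-- Evaluation of Laurent polynomials at a unit. -/
def unitEval (z : ℂˣ) : ℂ[T;T⁻¹] →+* ℂ := yEval (z : ℂ) z.ne_zero

theorem unitEval_C (z : ℂˣ) (c : ℂ) : unitEval z (LaurentPolynomial.C c) = c := by
  rw [unitEval, yEval, LaurentPolynomial.eval₂_C]
  rfl

theorem unitEval_T (z : ℂˣ) (j : ℤ) : unitEval z (T j) = (z : ℂ) ^ j := by
  rw [unitEval, T, yEval_single]
  simp

/-- The conjugate belonging to `ζ` has its only zero at `ζ⁻¹`, so `ζ` can be read off. This supplies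
the distinct roots required by `theta_dvd_of_evalAt_eq_zero`. -/
theorem monoSubst_branchPoly_injective {c : ℂ} (hc : c ≠ 0) (k : ℤ) {ℓ : ℕ} (hℓ : 0 < ℓ) :
    Function.Injective fun ζ : ℂˣ => monoSubst ζ 1 (branchPoly c k ℓ) := by
  intro ζ ξ h
  have h2 := congrArg (unitEval ζ⁻¹) h
  simp only [monoSubst_branchPoly, map_mul, map_pow, map_sub, map_one, unitEval_C, unitEval_T,
    zpow_one] at h2
  rw [show ((ζ⁻¹ : ℂˣ) : ℂ) = (ζ : ℂ)⁻¹ from Units.val_inv_eq_inv_val ζ,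
    mul_inv_cancel₀ ζ.ne_zero, sub_self, zero_pow hℓ.ne', mul_zero] at h2
  have h3 := h2.symm
  have hζ : (ζ : ℂ) ≠ 0 := ζ.ne_zero
  have hξ : (ξ : ℂ) ≠ 0 := ξ.ne_zero
  have h4 : (ξ : ℂ) * (ζ : ℂ)⁻¹ - 1 = 0 := by
    rcases mul_eq_zero.1 h3 with h4 | h4
    · exact absurd h4 (mul_ne_zero (mul_ne_zero hc (zpow_ne_zero _ hξ))
        (zpow_ne_zero _ (inv_ne_zero hζ)))
    · exact pow_eq_zero_iff hℓ.ne' |>.1 h4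
  ext
  field_simp at h4
  linear_combination -h4

theorem associated_T_sub_one (m : ℤ) :
    Associated (T (m.natAbs : ℤ) - 1 : ℂ[T;T⁻¹]) (T m - 1) := by
  rcases Int.natAbs_eq m with h | h
  · rw [← h]
  · rw [h]
    have h1 : (T (-(m.natAbs : ℤ)) - 1 : ℂ[T;T⁻¹]) =
        -(T (-(m.natAbs : ℤ)) * (T (m.natAbs : ℤ) - 1)) := by
      rw [mul_sub, ← T_add, neg_add_cancel, T_zero]
      ring
    rw [h1, Associated.neg_right_iff, Int.natAbs_neg, Int.natAbs_natCast]
    exact (associated_unit_mul_left _ _ (isUnit_T _)).symm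

theorem isUnit_C {c : ℂ} (hc : c ≠ 0) : IsUnit (LaurentPolynomial.C c : ℂ[T;T⁻¹]) :=
  (IsUnit.mk0 c hc).map _

/-- Up to units each factor is `(T - ζ⁻¹) ^ ℓ`, and the linear factors for all `M`-th roots of unity
multiply to `T ^ M - 1`. -/
theorem associated_prod_monoSubst (c : ℂ) (hc : c ≠ 0) (k : ℤ) (ℓ M : ℕ) [NeZero M]
    [Fintype (rootsOfUnity M ℂ)] :
    Associated (∏ ζ : rootsOfUnity M ℂ, -monoSubst (ζ : ℂˣ) 1 (branchPoly c k ℓ))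
      ((T (M : ℤ) - 1) ^ ℓ) := by
  have h1 : ∀ ζ : rootsOfUnity M ℂ, Associated (-monoSubst (ζ : ℂˣ) 1 (branchPoly c k ℓ))
      ((T 1 - LaurentPolynomial.C (((ζ⁻¹ : rootsOfUnity M ℂ) : ℂˣ) : ℂ)) ^ ℓ) := by
    intro ζ
    rw [monoSubst_branchPoly]
    have h2 : (LaurentPolynomial.C (((ζ : ℂˣ) : ℂ)) * T 1 - 1 : ℂ[T;T⁻¹]) =
        LaurentPolynomial.C (((ζ : ℂˣ) : ℂ)) *
          (T 1 - LaurentPolynomial.C (((ζ⁻¹ : rootsOfUnity M ℂ) : ℂˣ) : ℂ)) := by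
      rw [mul_sub, ← map_mul]
      simp
    rw [h2, mul_pow, ← mul_assoc, Associated.neg_left_iff]
    refine associated_unit_mul_left _ _ ?_
    exact ((isUnit_C (mul_ne_zero hc (zpow_ne_zero _ (Units.ne_zero _)))).mul (isUnit_T k)).mul
      ((isUnit_C (Units.ne_zero _)).pow ℓ)
  refine (Associated.prod _ _ _ fun ζ _ => h1 ζ).trans ?_
  have h4 := Equiv.prod_comp (Equiv.inv (rootsOfUnity M ℂ))
    (fun ζ => (T 1 - LaurentPolynomial.C ((ζ : ℂˣ) : ℂ) : ℂ[T;T⁻¹]))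
  simp only [Equiv.inv_apply] at h4
  rw [Finset.prod_pow, h4]
  have h3 := congrArg (toLaurent : ℂ[X] →+* ℂ[T;T⁻¹]) (prod_rootsOfUnity_X_sub M)
  simp only [map_prod, map_sub, map_one, toLaurent_X, toLaurent_C, toLaurent_X_pow] at h3
  rw [h3]
  exact Associated.refl _

theorem zpow_eq_one_of_mem_rootsOfUnity {m : ℤ} {ξ : ℂˣ} (hξ : ξ ∈ rootsOfUnity m.natAbs ℂ) :
    (ξ : ℂ) ^ m = 1 := by
  rw [mem_rootsOfUnity] at hξ
  have h1 : (ξ : ℂ) ^ m.natAbs = 1 := by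
    rw [← Units.val_pow_eq_pow_val, hξ, Units.val_one]
  rcases Int.natAbs_eq m with h | h
  · rw [h, zpow_natCast, h1]
  · rw [h, zpow_neg, zpow_natCast, h1, inv_one]

/-- Descent of the norm polynomial: a monic polynomial over the Laurent polynomials in `y` whose
roots are the conjugates of `branchPoly` under `T ↦ ζ * T`. -/
theorem exists_norm_poly {c : ℂ} (hc : c ≠ 0) (k : ℤ) (ℓ : ℕ) (η : ℂˣ) {m : ℤ} (hm : m ≠ 0) :
    ∃ p : ℂ[T;T⁻¹][X], p.Monic ∧ p.natDegree = m.natAbs ∧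
      (p.map (monoSubst η m)).eval (branchPoly c k ℓ) = 0 ∧
      Associated (p.coeff 0) ((T 1 - LaurentPolynomial.C (η : ℂ)) ^ ℓ) := by
  have hM : m.natAbs ≠ 0 := by simpa using hm
  have : NeZero m.natAbs := ⟨hM⟩
  let _ : Fintype (rootsOfUnity m.natAbs ℂ) := Fintype.ofFinite _
  set P : ℂ[T;T⁻¹][X] := ∏ ζ : rootsOfUnity m.natAbs ℂ,
    (Polynomial.X - Polynomial.C (monoSubst (ζ : ℂˣ) 1 (branchPoly c k ℓ))) with hP
  have hPm : P.Monic := monic_prod_of_monic _ _ fun ζ _ => monic_X_sub_C _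
  -- The substitution `T ↦ ξ T` permutes the factors of `P`, so its coefficients are invariant and
  -- descend to Laurent polynomials in `y`.
  have hinv : ∀ ξ ∈ rootsOfUnity m.natAbs ℂ, P.map (monoSubst ξ 1) = P := by
    intro ξ hξ
    rw [hP, Polynomial.map_prod]
    simp only [Polynomial.map_sub, Polynomial.map_X, Polynomial.map_C, monoSubst_mul_apply]
    exact Equiv.prod_comp (Equiv.mulLeft (⟨ξ, hξ⟩ : rootsOfUnity m.natAbs ℂ))
      (fun ζ => (Polynomial.X - Polynomial.C (monoSubst (ζ : ℂˣ) 1 (branchPoly c k ℓ))))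
  have hlift : P ∈ Polynomial.lifts (monoSubst η m) := by
    rw [Polynomial.lifts_iff_coeff_lifts]
    intro n
    refine mem_range_monoSubst η hm fun ξ hξ => ?_
    rw [← Polynomial.coeff_map, hinv ξ hξ]
  obtain ⟨p, hp1, hp2, hp3⟩ := Polynomial.lifts_and_natDegree_eq_and_monic hlift hPm
  refine ⟨p, hp3, ?_, ?_, ?_⟩
  · rw [hp2, hP, Polynomial.natDegree_prod_of_monic _ _ fun ζ _ => monic_X_sub_C _]
    simp only [Polynomial.natDegree_X_sub_C, Finset.sum_const, smul_eq_mul, mul_one,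
      Finset.card_univ]
    rw [← Nat.card_eq_fintype_card]
    exact (Complex.isPrimitiveRoot_exp _ hM).card_rootsOfUnity
  · rw [hp1, hP, Polynomial.eval_prod]
    refine Finset.prod_eq_zero (Finset.mem_univ (1 : rootsOfUnity m.natAbs ℂ)) ?_
    rw [Polynomial.eval_sub, Polynomial.eval_X, Polynomial.eval_C, monoSubst_branchPoly]
    simp [branchPoly]
  · have hψ0 : monoSubst η m (p.coeff 0) =
        ∏ ζ : rootsOfUnity m.natAbs ℂ, -monoSubst (ζ : ℂˣ) 1 (branchPoly c k ℓ) := by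
      rw [← Polynomial.coeff_map, hp1, hP, Polynomial.coeff_zero_eq_eval_zero,
        Polynomial.eval_prod]
      simp
    have hψ1 : monoSubst η m ((T 1 - LaurentPolynomial.C (η : ℂ)) ^ ℓ) =
        LaurentPolynomial.C ((η : ℂ) ^ ℓ) * (T m - 1) ^ ℓ := by
      rw [map_pow, map_sub, monoSubst_T, monoSubst_C, map_pow, ← mul_pow]
      simp [mul_sub]
    -- Upstairs both sides are, up to units, `(T ^ m - 1) ^ ℓ`; it remains to descend the
    -- association.
    have hass : Associated (monoSubst η m (p.coeff 0))
        (monoSubst η m ((T 1 - LaurentPolynomial.C (η : ℂ)) ^ ℓ)) := by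
      rw [hψ0, hψ1]
      refine (associated_prod_monoSubst c hc k ℓ m.natAbs).trans ?_
      refine ((associated_T_sub_one m).pow_pow).trans ?_
      exact (associated_unit_mul_left _ _ (isUnit_C (pow_ne_zero _ η.ne_zero))).symm
    have hfix : ∀ (b : ℂ[T;T⁻¹]) (ξ : ℂˣ), ξ ∈ rootsOfUnity m.natAbs ℂ →
        monoSubst ξ 1 (monoSubst η m b) = monoSubst η m b := by
      intro b ξ hξ
      have hξm := zpow_eq_one_of_mem_rootsOfUnity hξ
      induction b using AddMonoidAlgebra.induction_linear with
      | zero => simp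
      | add f g hf hg => rw [map_add, map_add, hf, hg]
      | single j z => rw [monoSubst_single, monoSubst_single, one_mul, zpow_mul, hξm, one_zpow,
          mul_one]
    -- A quotient of two invariant elements is invariant, hence again in the image of the
    -- substitution. So divisibility in `T` descends to divisibility in `y`.
    have hdvd : ∀ a b : ℂ[T;T⁻¹], monoSubst η m a ≠ 0 →
        monoSubst η m a ∣ monoSubst η m b → a ∣ b := by
      intro a b ha hab
      obtain ⟨v, hv⟩ := hab
      have hvr : v ∈ (monoSubst η m).range := by
        refine mem_range_monoSubst η hm fun ξ hξ => ?_
        have h1 := congrArg (monoSubst ξ 1) hv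
        rw [map_mul, hfix _ ξ hξ, hfix _ ξ hξ, hv] at h1
        exact (mul_left_cancel₀ ha h1).symm
      obtain ⟨v', rfl⟩ := hvr
      rw [← map_mul] at hv
      exact ⟨v', monoSubst_injective η hm hv⟩
    have hne : monoSubst η m ((T 1 - LaurentPolynomial.C (η : ℂ)) ^ ℓ) ≠ 0 := by
      rw [map_ne_zero_iff _ (monoSubst_injective η hm)]
      refine pow_ne_zero _ fun h => ?_
      have := congrArg (fun f : ℂ[T;T⁻¹] => f.coeff 1) h
      simp at this
    refine associated_of_dvd_dvd (hdvd _ _ (hass.symm.ne_zero_iff.1 hne) hass.dvd)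
      (hdvd _ _ hne hass.symm.dvd)

end Branch

/-! ### Existence and uniqueness of the local equation of a branch. -/

section LocalForm

open Polynomial LaurentPolynomial

theorem toLaurent_coeff_natCast (p : ℂ[X]) (j : ℕ) : (toLaurent p).coeff (j : ℤ) = p.coeff j := by
  rw [LaurentPolynomial.coeff_toLaurent]
  exact Finsupp.mapDomain_apply Nat.cast_injective _ _

theorem toLaurent_coeff_of_neg (p : ℂ[X]) {j : ℤ} (hj : j < 0) : (toLaurent p).coeff j = 0 := by
  rw [LaurentPolynomial.coeff_toLaurent]
  refine Finsupp.mapDomain_of_notMem_range _ _ ?_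
  rintro ⟨n, rfl⟩
  exact absurd hj (by simp)

theorem evalAt_yHom {K : Type*} [Field K] [Algebra ℂ K] (x y : K) (hx : x ≠ 0) (hy : y ≠ 0)
    (q : ℂ[T;T⁻¹]) : evalAt x y (yHom q) = yEval y hy q := by
  have := evalAt_theta 1 x y hx hy (Polynomial.C q)
  rwa [theta_C, Polynomial.eval₂_C] at this

theorem yEval_branchPoly (c : ℂ) (k : ℤ) (ℓ : ℕ) :
    yEval (RatFunc.X : RatFunc ℂ) RatFunc.X_ne_zero (branchPoly c k ℓ) =
      RatFunc.C c * RatFunc.X ^ k * (RatFunc.X - 1) ^ ℓ := by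
  have hT : ∀ j, yEval (RatFunc.X : RatFunc ℂ) RatFunc.X_ne_zero (T j) = RatFunc.X ^ j := by
    intro j
    rw [T, yEval_single, map_one, one_mul]
  have hC : yEval (RatFunc.X : RatFunc ℂ) RatFunc.X_ne_zero (LaurentPolynomial.C c) =
      RatFunc.C c := by
    rw [yEval, LaurentPolynomial.eval₂_C]
    rfl
  simp only [branchPoly, map_mul, map_pow, map_sub, map_one, hT, hC, zpow_one]

theorem exists_hasLocalForm {ε : ℤ} (hε : ε = 1 ∨ ε = -1) (ℓ : ℕ) {η : ℂ}
    {p : ℂ[T;T⁻¹][X]} (hp : p.coeff 0 = (T 1 - LaurentPolynomial.C η) ^ ℓ) :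
    ∃ θ, HasLocalForm ε ℓ η θ (theta ε p) := by
  have hp' : p.coeff 0 = toLaurent ((Polynomial.X - Polynomial.C η) ^ ℓ) := by
    rw [hp, map_pow, map_sub, toLaurent_X, toLaurent_C]
  have h0 : ∀ j : ℤ, (theta ε p).coeff (0, j) = (p.coeff 0).coeff j := by
    simp [theta_coeff hε]
  refine ⟨_, fun i j hij => ?_, fun j => ?_, fun j hj => ?_, rfl⟩
  · rw [theta_coeff hε, if_neg (by omega)]
  · rw [h0, hp', toLaurent_coeff_natCast]
  · rw [h0, hp', toLaurent_coeff_of_neg _ hj]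

/-- Existence of a local equation of a parametrized branch, which generates the ideal of the
curve. -/
theorem exists_local_generator {ε : ℤ} (hε : ε = 1 ∨ ε = -1) {ℓ : ℕ} (hℓ : 0 < ℓ)
    {x y : RatFunc ℂ} (hx : x ≠ 0) (hy : y ≠ 0) {c : ℂ} (hc : c ≠ 0) (k : ℤ) (η : ℂˣ) {m : ℤ}
    (hm : m ≠ 0) (hxe : x ^ ε = RatFunc.C c * RatFunc.X ^ k * (RatFunc.X - 1) ^ ℓ)
    (hye : y = RatFunc.C (η : ℂ) * RatFunc.X ^ m) :
    ∃ (g : Laurent) (θ : ℂ), HasLocalForm ε ℓ η θ g ∧ Irreducible g ∧ evalAt x y g = 0 ∧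
      ∀ f, evalAt x y f = 0 → g ∣ f := by
  obtain ⟨p, hpm, hpd, hp0, v, hv⟩ := exists_norm_poly hc k ℓ η hm
  rw [← yEval_branchPoly] at hxe
  have hyψ : ∀ a, yEval y hy a = yEval RatFunc.X RatFunc.X_ne_zero (monoSubst η m a) :=
    fun a => (yEval_monoSubst _ _ _ _ η m hye a).symm
  have hinj : Function.Injective (yEval y hy) := by
    intro a b hab
    rw [hyψ, hyψ] at hab
    exact monoSubst_injective η hm (yEval_X_injective hab)
  have hpx : evalAt x y (theta ε p) = 0 := by
    rw [evalAt_theta ε x y hx hy, hxe,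
      show yEval y hy = (yEval RatFunc.X RatFunc.X_ne_zero).comp (monoSubst η m) from
        RingHom.ext hyψ, ← Polynomial.hom_eval₂, Polynomial.eval₂_eq_eval_map, hp0, map_zero]
  have hM : m.natAbs ≠ 0 := by simpa using hm
  have : NeZero m.natAbs := ⟨hM⟩
  let _ : Fintype (rootsOfUnity m.natAbs ℂ) := Fintype.ofFinite _
  have htr : ∀ ζ : ℂˣ, Transcendental ℂ (RatFunc.C (ζ : ℂ) * RatFunc.X) := by
    intro ζ
    refine transcendental_of_intDegree_ne_zero ?_
    rw [RatFunc.intDegree_mul (by simp) RatFunc.X_ne_zero, RatFunc.intDegree_C,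
      RatFunc.intDegree_X]
    norm_num
  have hσX : ∀ (ζ : ℂˣ) (a : ℂ[T;T⁻¹]), substHom _ (htr ζ)
      (yEval RatFunc.X RatFunc.X_ne_zero a) =
        yEval RatFunc.X RatFunc.X_ne_zero (monoSubst ζ 1 a) := by
    intro ζ a
    have h1 : substHom _ (htr ζ) RatFunc.X ≠ 0 := by
      rw [substHom_X]
      exact mul_ne_zero (by simp) RatFunc.X_ne_zero
    rw [map_yEval _ _ _ h1, yEval_monoSubst _ _ _ h1]
    rw [substHom_X, zpow_one]
    rfl
  -- The automorphisms `T ↦ ζ T` with `ζ ^ |m| = 1` fix `y = η T ^ m` and send `x` to `|m| = deg p`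
  -- different functions.
  have hgen : ∀ f, evalAt x y f = 0 → theta ε p ∣ f := by
    refine theta_dvd_of_evalAt_eq_zero hε hx hy hinj hpm
      (fun ζ : rootsOfUnity m.natAbs ℂ => substHom _ (htr ζ)) ?_ ?_ ?_ hpx
    · intro ζ
      have hζ := zpow_eq_one_of_mem_rootsOfUnity ζ.2
      rw [hye, map_mul, map_zpow₀, substHom_X, mul_zpow, ← map_zpow₀, hζ, map_one, one_mul]
      congr 1
      exact (substHom _ (htr ζ)).commutes _
    · intro ζ ξ h
      have h1 := congrArg (· ^ ε) h
      simp only [← map_zpow₀, hxe, hσX] at h1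
      exact Subtype.ext (monoSubst_branchPoly_injective hc k hℓ (yEval_X_injective h1))
    · rw [hpd, ← Nat.card_eq_fintype_card,
        (Complex.isPrimitiveRoot_exp _ hM).card_rootsOfUnity]
  -- Multiplication by the unit `v` gives up monicity in exchange for a constant term equal to `(y -
  -- η) ^ ℓ` on the nose.
  have hcoeff : (Polynomial.C (v : ℂ[T;T⁻¹]) * p).coeff 0 =
      (T 1 - LaurentPolynomial.C (η : ℂ)) ^ ℓ := by
    rw [Polynomial.coeff_C_mul, mul_comm, hv]
  obtain ⟨θ, hθ⟩ := exists_hasLocalForm hε ℓ hcoeff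
  have hassoc : Associated (theta ε (Polynomial.C (v : ℂ[T;T⁻¹]) * p)) (theta ε p) := by
    rw [map_mul, theta_C]
    exact associated_unit_mul_left _ _ (v.isUnit.map _)
  have hg0 : evalAt x y (theta ε (Polynomial.C (v : ℂ[T;T⁻¹]) * p)) = 0 := by
    rw [← evalHom_apply x y hx hy, map_mul, map_mul, evalHom_apply x y hx hy (theta ε p), hpx,
      mul_zero]
  refine ⟨_, θ, hθ, ?_, hg0, fun f hf => hassoc.dvd.trans (hgen f hf)⟩
  refine irreducible_of_generates_kernel hx hy ?_ hg0 fun f hf => hassoc.dvd.trans (hgen f hf)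
  refine hassoc.symm.ne_zero_iff.1 ?_
  rw [Ne, map_eq_zero_iff _ (theta_injective hε)]
  exact hpm.ne_zero

/-- Identifies the last clause of `HasLocalForm` with the value at `η` of the coefficient `ϑ` of `x
^ ε`. -/
theorem hasLocalForm_coeff_one {ε : ℤ} (hε : ε = 1 ∨ ε = -1) {η : ℂ} (hη : η ≠ 0)
    (p : ℂ[T;T⁻¹][X]) :
    ((theta ε p).coeff.sum fun m c => if m.1 = ε then c * η ^ m.2 else 0) =
      yEval η hη (p.coeff 1) := by
  have hadd : ∀ f g : Laurent, ((f + g).coeff.sum fun m c => if m.1 = ε then c * η ^ m.2 else 0) =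
      (f.coeff.sum fun m c => if m.1 = ε then c * η ^ m.2 else 0) +
        (g.coeff.sum fun m c => if m.1 = ε then c * η ^ m.2 else 0) := by
    intro f g
    rw [AddMonoidAlgebra.coeff_add]
    refine Finsupp.sum_add_index' (fun m => by simp) fun m a b => ?_
    split_ifs <;> ring
  induction p using Polynomial.induction_on' with
  | add p q hp hq => rw [map_add, hadd, hp, hq, Polynomial.coeff_add, map_add]
  | monomial n a =>
    induction a using AddMonoidAlgebra.induction_linear with
    | zero => simp
    | add f g hf hg =>
      rw [map_add, map_add, hadd, hf, hg, Polynomial.coeff_add, map_add]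
    | single j c =>
      rw [theta_monomial, AddMonoidAlgebra.coeff_single, Finsupp.sum_single_index (by simp),
        Polynomial.coeff_monomial]
      have : ε * n = ε ↔ n = 1 := by rcases hε with rfl | rfl <;> simp
      by_cases hn : n = 1
      · rw [if_pos (this.2 hn), if_pos hn, yEval_single]
        rfl
      · rw [if_neg (fun h => hn (this.1 h)), if_neg hn, map_zero]

/-- The value of the cofactor at `1` is the derivative of `T ^ m` there. For negative `m` the factor
`T ^ m` is split off first. -/
theorem zpow_sub_one_factor (m : ℤ) :
    ∃ s : ℂ[T;T⁻¹], T m - 1 = (T 1 - 1) * s ∧ unitEval 1 s = m := by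
  have hnat : ∀ n : ℕ, ∃ s : ℂ[T;T⁻¹], T (n : ℤ) - 1 = (T 1 - 1) * s ∧ unitEval 1 s = n := by
    intro n
    induction n with
    | zero => exact ⟨0, by simp, by simp⟩
    | succ n ih =>
      obtain ⟨s, hs, hs1⟩ := ih
      refine ⟨s + T n, ?_, ?_⟩
      · rw [mul_add, ← hs, sub_mul, ← T_add]
        push_cast
        rw [add_comm (1 : ℤ)]
        ring
      · rw [map_add, hs1, unitEval_T]
        simp
  obtain ⟨s, hs, hs1⟩ := hnat m.natAbs
  rcases Int.natAbs_eq m with h | h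
  · refine ⟨s, by rw [h, hs], ?_⟩
    rw [hs1]
    conv_rhs => rw [h]
    simp
  · refine ⟨-(T m * s), ?_, ?_⟩
    · have h1 : T m - 1 = -(T m * (T (m.natAbs : ℤ) - 1) : ℂ[T;T⁻¹]) := by
        rw [mul_sub, ← T_add, show m + m.natAbs = 0 by omega, T_zero]
        ring
      rw [h1, hs]
      ring
    · rw [map_neg, map_mul, hs1, unitEval_T]
      conv_rhs => rw [h]
      simp

/-- The constants in a local equation are determined by the parametrization. -/
theorem HasLocalForm.eq_of_evalAt_eq_zero {ε : ℤ} (hε : ε = 1 ∨ ε = -1) {ℓ : ℕ} (hℓ : 0 < ℓ)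
    {x y : RatFunc ℂ} (hx : x ≠ 0) (hy : y ≠ 0) {c : ℂ} (hc : c ≠ 0) {k : ℤ} {η : ℂˣ} {m : ℤ}
    (hxe : x ^ ε = RatFunc.C c * RatFunc.X ^ k * (RatFunc.X - 1) ^ ℓ)
    (hye : y = RatFunc.C (η : ℂ) * RatFunc.X ^ m) {g : Laurent} {η' θ : ℂ}
    (hg : HasLocalForm ε ℓ η' θ g) (hg0 : evalAt x y g = 0) :
    η' = η ∧ θ = -((η : ℂ) * m) ^ ℓ / c := by
  obtain ⟨h1, h2, h3, h4⟩ := hg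
  obtain ⟨p, rfl⟩ := exists_theta_eq hε h1
  have hp0 : p.coeff 0 = (T 1 - LaurentPolynomial.C η') ^ ℓ := by
    have : p.coeff 0 = toLaurent ((Polynomial.X - Polynomial.C η') ^ ℓ) := by
      refine LaurentPolynomial.ext fun j => ?_
      rcases lt_or_ge j 0 with hj | hj
      · rw [toLaurent_coeff_of_neg _ hj]
        simpa [theta_coeff hε] using h3 j hj
      · lift j to ℕ using hj
        rw [toLaurent_coeff_natCast, ← h2]
        simp [theta_coeff hε]
    rw [this, map_pow, map_sub, toLaurent_X, toLaurent_C]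
  rw [← yEval_branchPoly] at hxe
  have hyψ : ∀ a, yEval y hy a = yEval RatFunc.X RatFunc.X_ne_zero (monoSubst η m a) :=
    fun a => (yEval_monoSubst _ _ _ _ η m hye a).symm
  rw [evalAt_theta ε x y hx hy, hxe,
    show yEval y hy = (yEval RatFunc.X RatFunc.X_ne_zero).comp (monoSubst η m) from
      RingHom.ext hyψ, ← Polynomial.hom_eval₂, map_eq_zero_iff _ yEval_X_injective] at hg0
  -- Only the terms of order at most one in `w = x ^ ε` matter: `w` vanishes to order `ℓ` at `T =
  -- 1`, so after division by `(T - 1) ^ ℓ` the terms in `w ^ 2` still vanish there.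
  have hdecomp : p = Polynomial.C (p.coeff 0) + Polynomial.X * Polynomial.C (p.coeff 1) +
      Polynomial.X ^ 2 * p.divX.divX := by
    conv_lhs => rw [← Polynomial.X_mul_divX_add p, ← Polynomial.X_mul_divX_add p.divX]
    rw [Polynomial.coeff_divX]
    ring
  rw [hdecomp] at hg0
  simp only [Polynomial.eval₂_add, Polynomial.eval₂_mul, Polynomial.eval₂_X, Polynomial.eval₂_C,
    Polynomial.eval₂_pow, hp0] at hg0
  set r := Polynomial.eval₂ (monoSubst η m) (branchPoly c k ℓ) p.divX.divX
  rw [map_pow, map_sub, monoSubst_C, monoSubst_T, zpow_one, mul_one] at hg0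
  have hev1 : unitEval 1 (branchPoly c k ℓ) = 0 := by
    simp [branchPoly, unitEval_T, hℓ.ne']
  -- At `T = 1` the relation reduces to `(η - η') ^ ℓ = 0`.
  have hη : η' = η := by
    have h5 := congrArg (unitEval 1) hg0
    simp only [map_add, map_mul, map_pow, map_sub, unitEval_C, unitEval_T, hev1] at h5
    simp [hℓ.ne'] at h5
    exact (sub_eq_zero.1 h5).symm
  refine ⟨hη, ?_⟩
  subst hη
  obtain ⟨s, hs, hs1⟩ := zpow_sub_one_factor m
  have h6 : LaurentPolynomial.C (η : ℂ) * T m - LaurentPolynomial.C (η : ℂ) =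
      (T 1 - 1) * (LaurentPolynomial.C (η : ℂ) * s) := by
    linear_combination LaurentPolynomial.C (η : ℂ) * hs
  -- The factor `(T - 1) ^ ℓ` is cancelled. Evaluation of the cofactor at `T = 1` then leaves `(η m)
  -- ^ ℓ + c θ = 0`.
  have h7 : (T 1 - 1 : ℂ[T;T⁻¹]) ^ ℓ * ((LaurentPolynomial.C (η : ℂ) * s) ^ ℓ +
      LaurentPolynomial.C c * T k * monoSubst η m (p.coeff 1) +
        LaurentPolynomial.C c * T k * branchPoly c k ℓ * r) = 0 := by
    rw [← hg0, h6, mul_pow (T 1 - 1 : ℂ[T;T⁻¹])]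
    simp only [branchPoly]
    ring
  have hT1 : (T 1 - 1 : ℂ[T;T⁻¹]) ^ ℓ ≠ 0 := by
    refine pow_ne_zero _ fun h => ?_
    have := congrArg (fun f : ℂ[T;T⁻¹] => f.coeff 1) h
    simp [LaurentPolynomial.T, AddMonoidAlgebra.one_def, -LaurentPolynomial.single_eq_C_mul_T]
      at this
  have h8 := congrArg (unitEval 1) ((mul_eq_zero.1 h7).resolve_left hT1)
  have h9 : unitEval 1 (monoSubst η m (p.coeff 1)) = θ := by
    rw [← h4, hasLocalForm_coeff_one hε η.ne_zero, unitEval]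
    exact yEval_monoSubst _ _ _ η.ne_zero η m (by simp) _
  simp only [map_add, map_mul, map_pow, unitEval_C, unitEval_T, hev1, h9, hs1, map_zero,
    Units.val_one, one_zpow] at h8
  field_simp
  linear_combination h8

end LocalForm

/-! ### Toric changes for a primitive direction -/

section ToricChange

variable {u : ℤ × ℤ}

/-- Orthogonality to the primitive vector `u` makes `my` an integer multiple of `rot u`. The
determinant of the basis is this multiple times `dot mx u`; both are therefore units, and positivity
decides the second. -/
theorem ToricChange.exists_sign (hu : IsPrimitive u) (Φ : ToricChange u) :
    ∃ s : ℤ, (s = 1 ∨ s = -1) ∧ Φ.my = s • rot u ∧ dot Φ.mx u = 1 := by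
  have hg : (1 : ℤ) = u.1 * Int.gcdA u.1 u.2 + u.2 * Int.gcdB u.1 u.2 := by
    rw [← Int.gcd_eq_gcd_ab, hu]
    rfl
  set r := Int.gcdA u.1 u.2
  set s := Int.gcdB u.1 u.2
  have hh := Φ.horizontal
  simp only [dot] at hh
  set t := r * Φ.my.2 - s * Φ.my.1 with ht
  have hmy : Φ.my = t • rot u := by
    ext
    · simp only [Prod.smul_fst, rot, smul_eq_mul, ht]
      linear_combination Φ.my.1 * hg + r * hh
    · simp only [Prod.smul_snd, rot, smul_eq_mul, ht]
      linear_combination Φ.my.2 * hg + s * hh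
  have hdet : det2 Φ.mx Φ.my = t * dot Φ.mx u := by
    rw [hmy]
    simp only [det2, rot, dot, Prod.smul_fst, Prod.smul_snd, smul_eq_mul]
    ring
  have hb := Φ.basis
  rw [hdet] at hb
  have hpos := Φ.left_to_right
  have h1 : dot Φ.mx u = 1 := by
    rcases hb with h | h
    · exact Int.eq_one_of_mul_eq_one_left hpos.le h
    · exact Int.eq_one_of_mul_eq_one_left (a := -t) hpos.le (by linarith)
  rw [h1, mul_one] at hb
  exact ⟨t, hb, hmy, h1⟩

theorem exists_toricChange (hu : IsPrimitive u) : Nonempty (ToricChange u) := by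
  have hg : (1 : ℤ) = u.1 * Int.gcdA u.1 u.2 + u.2 * Int.gcdB u.1 u.2 := by
    rw [← Int.gcd_eq_gcd_ab, hu]
    rfl
  refine ⟨⟨(Int.gcdA u.1 u.2, Int.gcdB u.1 u.2), rot u, Or.inl ?_, ?_, ?_⟩⟩
  · simp only [det2, rot]
    linear_combination -hg
  · simp only [dot, rot]
    ring
  · simp only [dot]
    linarith

/-- A character orthogonal to the independent vectors `h` and `u` is zero, but `my` belongs to a
basis. This gives the nonzero exponent `m` in `y = η T ^ m`. -/
theorem ToricChange.dot_my_ne_zero (Φ : ToricChange u) {h : ℤ × ℤ} (hdet : det2 h u ≠ 0) :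
    dot Φ.my h ≠ 0 := by
  intro h0
  have hh := Φ.horizontal
  have hd := Φ.det_mul_self
  simp only [dot, det2] at h0 hh hd hdet
  have h1 : Φ.my.1 * (h.1 * u.2 - h.2 * u.1) = 0 := by
    linear_combination u.2 * h0 - h.2 * hh
  have h2 : Φ.my.2 * (h.1 * u.2 - h.2 * u.1) = 0 := by
    linear_combination h.1 * hh - u.1 * h0
  have h3 := (mul_eq_zero.1 h1).resolve_right hdet
  have h4 := (mul_eq_zero.1 h2).resolve_right hdet
  rw [h3, h4] at hd
  simp at hd

end ToricChange

/-! ### Parametrized branches -/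

section Branch

/-- The rational function `a * T ^ h * (T - 1) ^ (-n)`. -/
def branchFun (a : ℂ) (h n : ℤ) : RatFunc ℂ :=
  RatFunc.C a * RatFunc.X ^ h * (RatFunc.X - 1) ^ (-n)

theorem ratFunc_X_sub_one_ne_zero : (RatFunc.X - 1 : RatFunc ℂ) ≠ 0 := by
  intro h
  have h1 : (RatFunc.X : RatFunc ℂ) = 1 := sub_eq_zero.1 h
  have := congrArg RatFunc.intDegree h1
  simp at this

theorem branchFun_ne_zero {a : ℂ} (ha : a ≠ 0) (h n : ℤ) : branchFun a h n ≠ 0 :=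
  mul_ne_zero (mul_ne_zero (by simpa using ha) (zpow_ne_zero _ RatFunc.X_ne_zero))
    (zpow_ne_zero _ ratFunc_X_sub_one_ne_zero)

theorem branchFun_mul (a b : ℂ) (h n h' n' : ℤ) :
    branchFun (a * b) (h + h') (n + n') = branchFun a h n * branchFun b h' n' := by
  rw [branchFun, neg_add, zpow_add₀ RatFunc.X_ne_zero, zpow_add₀ ratFunc_X_sub_one_ne_zero, map_mul]
  simp only [branchFun]
  ring

theorem branchFun_zpow (a : ℂ) (h n k : ℤ) :
    branchFun a h n ^ k = branchFun (a ^ k) (h * k) (n * k) := by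
  simp only [branchFun, mul_zpow, map_zpow₀, ← zpow_mul, neg_mul]

theorem monom_branchFun (a b : ℂ) (h n m : ℤ × ℤ) :
    monom (branchFun a h.1 n.1) (branchFun b h.2 n.2) m =
      branchFun (monom a b m) (dot m h) (dot m n) := by
  rw [monom, branchFun_zpow, branchFun_zpow, monom, ← branchFun_mul, dot, dot]
  congr 1 <;> ring

/-- An irreducible equation of the curve parametrized by the monomials
`a * T ^ h.1 * (T - 1) ^ (-n.1)` and `b * T ^ h.2 * (T - 1) ^ (-n.2)`. -/
def IsBranchEquation (a b : ℂ) (h n : ℤ × ℤ) (F : Laurent) : Prop :=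
  Irreducible F ∧ evalAt (branchFun a h.1 n.1) (branchFun b h.2 n.2) F = 0

variable {u : ℤ × ℤ} {a b : ℂ} {h : ℤ × ℤ} {ε : ℤ} {ℓ : ℕ}

theorem dot_smul_right (m n : ℤ × ℤ) (k : ℤ) : dot m (k • n) = k * dot m n := by
  simp only [dot, Prod.smul_fst, Prod.smul_snd, smul_eq_mul]
  ring

/-- Because `dot mx u = 1`, the exponent of `T - 1` in `x` is `ε ℓ`, and raising to the power `ε`
turns it into `ℓ`. Together with `branchFun_y` this is the normal form used by
`exists_local_generator`. -/
theorem branchFun_x_zpow (hu : IsPrimitive u) (Φ : ToricChange u) (hε : ε = 1 ∨ ε = -1) :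
    branchFun (monom a b Φ.mx) (dot Φ.mx h) (dot Φ.mx ((-ε * ℓ) • u)) ^ ε =
      RatFunc.C (monom a b Φ.mx ^ ε) * RatFunc.X ^ (dot Φ.mx h * ε) * (RatFunc.X - 1) ^ ℓ := by
  obtain ⟨s, -, -, h1⟩ := Φ.exists_sign hu
  rw [branchFun_zpow, branchFun, dot_smul_right, h1]
  have : -(-ε * ℓ * 1 * ε) = (ℓ : ℤ) := by rcases hε with rfl | rfl <;> ring
  rw [this, zpow_natCast]

theorem branchFun_y (Φ : ToricChange u) (k : ℤ) :
    branchFun (monom a b Φ.my) (dot Φ.my h) (dot Φ.my (k • u)) =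
      RatFunc.C (monom a b Φ.my) * RatFunc.X ^ dot Φ.my h := by
  rw [branchFun, dot_smul_right, Φ.horizontal]
  simp

/-- The irreducible generator of the ideal divides every irreducible equation of the branch, so all
of these agree up to units. Statements about an arbitrary defining equation thus reduce to one. -/
theorem exists_branch_generator (hu : IsPrimitive u) (hε : ε = 1 ∨ ε = -1) (hℓ : 0 < ℓ)
    (ha : a ≠ 0) (hb : b ≠ 0) (hdet : det2 h u ≠ 0) (Φ : ToricChange u) :
    ∃ (g : Laurent) (θ : ℂ), HasLocalForm ε ℓ (monom a b Φ.my) θ g ∧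
      IsBranchEquation a b h ((-ε * ℓ) • u) (Φ.subst g) ∧
      ∀ F, IsBranchEquation a b h ((-ε * ℓ) • u) F → Associated (Φ.subst g) F := by
  set n := (-ε * (ℓ : ℤ)) • u with hn
  have hX := branchFun_ne_zero ha h.1 n.1
  have hY := branchFun_ne_zero hb h.2 n.2
  obtain ⟨g, θ, hg, hirr, hg0, hgen⟩ := exists_local_generator hε hℓ
    (branchFun_ne_zero (monom_ne_zero ha hb Φ.mx) (dot Φ.mx h) (dot Φ.mx n))
    (branchFun_ne_zero (monom_ne_zero ha hb Φ.my) (dot Φ.my h) (dot Φ.my n))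
    (zpow_ne_zero ε (monom_ne_zero ha hb Φ.mx)) (dot Φ.mx h * ε)
    (Units.mk0 _ (monom_ne_zero ha hb Φ.my)) (Φ.dot_my_ne_zero hdet)
    (branchFun_x_zpow hu Φ hε) (branchFun_y Φ _)
  have hev : ∀ g', evalAt (branchFun a h.1 n.1) (branchFun b h.2 n.2) (Φ.subst g') =
      evalAt (branchFun (monom a b Φ.mx) (dot Φ.mx h) (dot Φ.mx n))
        (branchFun (monom a b Φ.my) (dot Φ.my h) (dot Φ.my n)) g' := by
    intro g'
    rw [Φ.evalAt_subst hX hY, monom_branchFun, monom_branchFun]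
  refine ⟨g, θ, hg, ⟨(Φ.irreducible_subst_iff g).2 hirr, ?_⟩, fun F hF => ?_⟩
  · rw [hev, hg0]
  · obtain ⟨F', rfl⟩ := Φ.subst_bijective.2 F
    have h1 := hF.2
    rw [hev] at h1
    exact ((Φ.irreducible_subst_iff g).2 hirr).associated_of_dvd hF.1
      ((hgen F' h1).elim fun c hc => ⟨Φ.subst c, by rw [hc, map_mul]⟩)

theorem exists_isBranchEquation (hu : IsPrimitive u) (hε : ε = 1 ∨ ε = -1) (hℓ : 0 < ℓ)
    (ha : a ≠ 0) (hb : b ≠ 0) (hdet : det2 h u ≠ 0) :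
    ∃ F, IsBranchEquation a b h ((-ε * ℓ) • u) F := by
  obtain ⟨Φ⟩ := exists_toricChange hu
  obtain ⟨g, -, -, hg, -⟩ := exists_branch_generator hu hε hℓ ha hb hdet Φ
  exact ⟨_, hg⟩

theorem IsBranchEquation.localForm_unique (hu : IsPrimitive u) (hε : ε = 1 ∨ ε = -1) (hℓ : 0 < ℓ)
    (ha : a ≠ 0) (hb : b ≠ 0) (Φ : ToricChange u) {F g : Laurent} {η θ : ℂ}
    (hF : IsBranchEquation a b h ((-ε * ℓ) • u) F) (hg : Associated (Φ.subst g) F)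
    (hloc : HasLocalForm ε ℓ η θ g) :
    η = monom a b Φ.my ∧
      θ = -(monom a b Φ.my * dot Φ.my h) ^ ℓ / monom a b Φ.mx ^ ε := by
  set n := (-ε * (ℓ : ℤ)) • u with hn
  have hX := branchFun_ne_zero ha h.1 n.1
  have hY := branchFun_ne_zero hb h.2 n.2
  have h0 : evalAt (branchFun a h.1 n.1) (branchFun b h.2 n.2) (Φ.subst g) = 0 := by
    obtain ⟨v, hv⟩ := hg.symm
    rw [← hv, ← evalHom_apply _ _ hX hY, map_mul, evalHom_apply, hF.2, zero_mul]
  rw [Φ.evalAt_subst hX hY, monom_branchFun, monom_branchFun] at h0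
  exact hloc.eq_of_evalAt_eq_zero hε hℓ
    (branchFun_ne_zero (monom_ne_zero ha hb Φ.mx) (dot Φ.mx h) (dot Φ.mx n))
    (branchFun_ne_zero (monom_ne_zero ha hb Φ.my) (dot Φ.my h) (dot Φ.my n))
    (zpow_ne_zero ε (monom_ne_zero ha hb Φ.mx))
    (η := Units.mk0 _ (monom_ne_zero ha hb Φ.my))
    (branchFun_x_zpow hu Φ hε) (branchFun_y Φ _) h0

/-- The generator is in local form with some `θ`; uniqueness supplies its value. -/
theorem IsBranchEquation.exists_localForm (hu : IsPrimitive u) (hε : ε = 1 ∨ ε = -1) (hℓ : 0 < ℓ)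
    (ha : a ≠ 0) (hb : b ≠ 0) (hdet : det2 h u ≠ 0) (Φ : ToricChange u) {F : Laurent}
    (hF : IsBranchEquation a b h ((-ε * ℓ) • u) F) :
    ∃ g, Associated (Φ.subst g) F ∧ HasLocalForm ε ℓ (monom a b Φ.my)
      (-(monom a b Φ.my * dot Φ.my h) ^ ℓ / monom a b Φ.mx ^ ε) g := by
  obtain ⟨g, θ, hg, -, hass⟩ := exists_branch_generator hu hε hℓ ha hb hdet Φ
  have h1 := (hF.localForm_unique hu hε hℓ ha hb Φ (hass F hF) hg).2
  exact ⟨g, hass F hF, h1 ▸ hg⟩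

/-- The parameters of the two branches meeting at the toric divisor of an edge. -/
structure BranchPair (u : ℤ × ℤ) where
  a₁ : ℂ
  b₁ : ℂ
  h₁ : ℤ × ℤ
  a₂ : ℂ
  b₂ : ℂ
  h₂ : ℤ × ℤ
  ha₁ : a₁ ≠ 0
  hb₁ : b₁ ≠ 0
  ha₂ : a₂ ≠ 0
  hb₂ : b₂ ≠ 0
  hdet₁ : det2 h₁ u ≠ 0
  hdet₂ : det2 h₂ u ≠ 0
  matching : monom a₁ b₁ (rot u) = monom a₂ b₂ (rot u)

/-- `F₁` and `F₂` are equations of the two branches. -/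
def BranchPair.Equations (S : BranchPair u) (ℓ : ℕ) (F₁ F₂ : Laurent) : Prop :=
  IsBranchEquation S.a₁ S.b₁ S.h₁ (ℓ • u) F₁ ∧ IsBranchEquation S.a₂ S.b₂ S.h₂ (-(ℓ • u)) F₂

/-- The coordinate of the common point of the two branches. -/
def BranchPair.eta (S : BranchPair u) (Φ : ToricChange u) : ℂ := monom S.a₁ S.b₁ Φ.my

/-- The leading coefficient at the first branch. -/
def BranchPair.theta₁ (S : BranchPair u) (ℓ : ℕ) (Φ : ToricChange u) : ℂ :=
  -(S.eta Φ * dot Φ.my S.h₁) ^ ℓ * monom S.a₁ S.b₁ Φ.mx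

/-- The leading coefficient at the second branch. -/
def BranchPair.theta₂ (S : BranchPair u) (ℓ : ℕ) (Φ : ToricChange u) : ℂ :=
  -(S.eta Φ * dot Φ.my S.h₂) ^ ℓ / monom S.a₂ S.b₂ Φ.mx

variable (S : BranchPair u)

theorem BranchPair.eta_ne_zero (Φ : ToricChange u) : S.eta Φ ≠ 0 :=
  monom_ne_zero S.ha₁ S.hb₁ _

theorem BranchPair.theta₁_ne_zero (ℓ : ℕ) (Φ : ToricChange u) : S.theta₁ ℓ Φ ≠ 0 :=
  mul_ne_zero (neg_ne_zero.2 (pow_ne_zero _ (mul_ne_zero (S.eta_ne_zero Φ)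
    (Int.cast_ne_zero.2 (Φ.dot_my_ne_zero S.hdet₁))))) (monom_ne_zero S.ha₁ S.hb₁ _)

theorem BranchPair.theta₂_ne_zero (ℓ : ℕ) (Φ : ToricChange u) : S.theta₂ ℓ Φ ≠ 0 :=
  div_ne_zero (neg_ne_zero.2 (pow_ne_zero _ (mul_ne_zero (S.eta_ne_zero Φ)
    (Int.cast_ne_zero.2 (Φ.dot_my_ne_zero S.hdet₂))))) (monom_ne_zero S.ha₂ S.hb₂ _)

theorem BranchPair.eta_eq (hu : IsPrimitive u) (Φ : ToricChange u) :
    S.eta Φ = monom S.a₂ S.b₂ Φ.my := by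
  obtain ⟨s, -, hs, -⟩ := Φ.exists_sign hu
  rw [BranchPair.eta, hs, monom_smul, monom_smul, S.matching]

/-- Replaces the existential definition of the local equations by formulas: existence and uniqueness
hold on each side separately, and the matching condition makes the two values of `η` agree. -/
theorem BranchPair.localEquations_iff (hu : IsPrimitive u) (hℓ : 0 < ℓ) {F₁ F₂ : Laurent}
    (hS : S.Equations ℓ F₁ F₂) (Φ : ToricChange u) (η θ₁ θ₂ : ℂ) :
    LocalEquations Φ ℓ η θ₁ θ₂ F₁ F₂ ↔
      η = S.eta Φ ∧ θ₁ = S.theta₁ ℓ Φ ∧ θ₂ = S.theta₂ ℓ Φ := by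
  obtain ⟨h1, h2⟩ := hS
  rw [show ℓ • u = (-(-1) * (ℓ : ℤ)) • u by simp] at h1
  rw [show -(ℓ • u) = (-1 * (ℓ : ℤ)) • u by simp] at h2
  have e1 : -(monom S.a₁ S.b₁ Φ.my * dot Φ.my S.h₁) ^ ℓ / monom S.a₁ S.b₁ Φ.mx ^ (-1 : ℤ) =
      S.theta₁ ℓ Φ := by
    simp [BranchPair.theta₁, BranchPair.eta]
  have e2 : -(monom S.a₂ S.b₂ Φ.my * dot Φ.my S.h₂) ^ ℓ / monom S.a₂ S.b₂ Φ.mx ^ (1 : ℤ) =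
      S.theta₂ ℓ Φ := by
    simp [BranchPair.theta₂, S.eta_eq hu]
  constructor
  · rintro ⟨g₁, g₂, hg₁, hg₂, l₁, l₂⟩
    obtain ⟨r1, r2⟩ := h1.localForm_unique hu (Or.inr rfl) hℓ S.ha₁ S.hb₁ Φ hg₁ l₁
    obtain ⟨r3, r4⟩ := h2.localForm_unique hu (Or.inl rfl) hℓ S.ha₂ S.hb₂ Φ hg₂ l₂
    exact ⟨r1, r2.trans e1, r4.trans e2⟩
  · rintro ⟨rfl, rfl, rfl⟩
    obtain ⟨g₁, hg₁, l₁⟩ := h1.exists_localForm hu (Or.inr rfl) hℓ S.ha₁ S.hb₁ S.hdet₁ Φ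
    obtain ⟨g₂, hg₂, l₂⟩ := h2.exists_localForm hu (Or.inl rfl) hℓ S.ha₂ S.hb₂ S.hdet₂ Φ
    rw [e1] at l₁
    rw [e2, ← S.eta_eq hu] at l₂
    exact ⟨g₁, g₂, hg₁, hg₂, l₁, l₂⟩

theorem BranchPair.exists_equations (hu : IsPrimitive u) (hℓ : 0 < ℓ) :
    ∃ F₁ F₂, S.Equations ℓ F₁ F₂ := by
  obtain ⟨F₁, h1⟩ := exists_isBranchEquation (ε := -1) hu (Or.inr rfl) hℓ S.ha₁ S.hb₁ S.hdet₁
  obtain ⟨F₂, h2⟩ := exists_isBranchEquation (ε := 1) hu (Or.inl rfl) hℓ S.ha₂ S.hb₂ S.hdet₂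
  refine ⟨F₁, F₂, ?_, ?_⟩
  · simpa using h1
  · simpa using h2

end Branch

/-! ### Orders and values of rational functions -/

section Order

open Polynomial

theorem ordAt_infty (f : RatFunc ℂ) : ordAt f OnePoint.infty = -f.intDegree := rfl

theorem ordAt_coe (f : RatFunc ℂ) (a : ℂ) : ordAt f (a : OnePoint ℂ) =
    (f.num.rootMultiplicity a : ℤ) - (f.denom.rootMultiplicity a : ℤ) := rfl

theorem valAt_infty (f : RatFunc ℂ) :
    valAt f OnePoint.infty = f.num.leadingCoeff / f.denom.leadingCoeff := rfl

theorem valAt_coe (f : RatFunc ℂ) (a : ℂ) :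
    valAt f (a : OnePoint ℂ) = f.eval (RingHom.id ℂ) a := rfl

theorem num_mul_eq {N D : ℂ[X]} (hD : D ≠ 0) {f : RatFunc ℂ}
    (hf : f = algebraMap ℂ[X] (RatFunc ℂ) N / algebraMap ℂ[X] (RatFunc ℂ) D) :
    f.num * D = N * f.denom := by
  have h1 := RatFunc.num_div_denom f
  have hd : algebraMap ℂ[X] (RatFunc ℂ) f.denom ≠ 0 := RatFunc.algebraMap_ne_zero f.denom_ne_zero
  have hD' : algebraMap ℂ[X] (RatFunc ℂ) D ≠ 0 := RatFunc.algebraMap_ne_zero hD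
  apply RatFunc.algebraMap_injective ℂ
  rw [map_mul, map_mul]
  rw [← h1, div_eq_div_iff hd hD'] at hf
  exact hf

theorem ordAt_coe_of_div {N D : ℂ[X]} (hN : N ≠ 0) (hD : D ≠ 0) {f : RatFunc ℂ}
    (hf : f = algebraMap ℂ[X] (RatFunc ℂ) N / algebraMap ℂ[X] (RatFunc ℂ) D) (a : ℂ) :
    ordAt f (a : OnePoint ℂ) = (N.rootMultiplicity a : ℤ) - (D.rootMultiplicity a : ℤ) := by
  have hf0 : f ≠ 0 := by
    rw [hf]
    exact div_ne_zero (RatFunc.algebraMap_ne_zero hN) (RatFunc.algebraMap_ne_zero hD)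
  have h := congrArg (rootMultiplicity a) (num_mul_eq hD hf)
  rw [rootMultiplicity_mul (mul_ne_zero (RatFunc.num_ne_zero hf0) hD),
    rootMultiplicity_mul (mul_ne_zero hN f.denom_ne_zero)] at h
  rw [ordAt_coe]
  omega

theorem ordAt_mul {f g : RatFunc ℂ} (hf : f ≠ 0) (hg : g ≠ 0) (p : OnePoint ℂ) :
    ordAt (f * g) p = ordAt f p + ordAt g p := by
  induction p using OnePoint.rec with
  | infty =>
    rw [ordAt_infty, ordAt_infty, ordAt_infty, RatFunc.intDegree_mul hf hg]
    ring
  | coe a =>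
    have h1 : f * g = algebraMap ℂ[X] (RatFunc ℂ) (f.num * g.num) /
        algebraMap ℂ[X] (RatFunc ℂ) (f.denom * g.denom) := by
      rw [map_mul, map_mul, mul_div_mul_comm, RatFunc.num_div_denom, RatFunc.num_div_denom]
    have hn := mul_ne_zero (RatFunc.num_ne_zero hf) (RatFunc.num_ne_zero hg)
    have hd := mul_ne_zero f.denom_ne_zero g.denom_ne_zero
    rw [ordAt_coe_of_div hn hd h1, rootMultiplicity_mul hn, rootMultiplicity_mul hd,
      ordAt_coe, ordAt_coe]
    push_cast
    ring

theorem ordAt_C (c : ℂ) (p : OnePoint ℂ) : ordAt (RatFunc.C c) p = 0 := by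
  induction p using OnePoint.rec with
  | infty => rw [ordAt_infty, RatFunc.intDegree_C, neg_zero]
  | coe a => simp [ordAt_coe]

theorem ordAt_one (p : OnePoint ℂ) : ordAt 1 p = 0 := by
  rw [← map_one (RatFunc.C : ℂ →+* RatFunc ℂ), ordAt_C]

theorem ordAt_inv {f : RatFunc ℂ} (hf : f ≠ 0) (p : OnePoint ℂ) : ordAt f⁻¹ p = -ordAt f p := by
  have h := ordAt_mul hf (inv_ne_zero hf) p
  rw [mul_inv_cancel₀ hf, ordAt_one] at h
  linarith

theorem ordAt_pow {f : RatFunc ℂ} (hf : f ≠ 0) (n : ℕ) (p : OnePoint ℂ) :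
    ordAt (f ^ n) p = n * ordAt f p := by
  induction n with
  | zero => simp [ordAt_one]
  | succ n ih =>
    rw [pow_succ, ordAt_mul (pow_ne_zero _ hf) hf, ih]
    push_cast
    ring

theorem ordAt_zpow {f : RatFunc ℂ} (hf : f ≠ 0) (n : ℤ) (p : OnePoint ℂ) :
    ordAt (f ^ n) p = n * ordAt f p := by
  obtain ⟨n, rfl | rfl⟩ := n.eq_nat_or_neg
  · rw [zpow_natCast, ordAt_pow hf]
  · rw [zpow_neg, zpow_natCast, ordAt_inv (pow_ne_zero _ hf), ordAt_pow hf]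
    ring

theorem ordAt_div {f g : RatFunc ℂ} (hf : f ≠ 0) (hg : g ≠ 0) (p : OnePoint ℂ) :
    ordAt (f / g) p = ordAt f p - ordAt g p := by
  rw [div_eq_mul_inv, ordAt_mul hf (inv_ne_zero hg), ordAt_inv hg, sub_eq_add_neg]

theorem denom_eval_ne_zero {f : RatFunc ℂ} {a : ℂ} (h : 0 ≤ ordAt f (a : OnePoint ℂ)) :
    f.denom.eval a ≠ 0 := by
  intro h0
  have h1 : f.num.eval a ≠ 0 := by
    intro h2
    obtain ⟨s, t, hst⟩ := f.isCoprime_num_denom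
    have := congrArg (eval a) hst
    simp [h0, h2] at this
  have h2 : f.num.rootMultiplicity a = 0 := rootMultiplicity_eq_zero h1
  have h3 : 0 < f.denom.rootMultiplicity a :=
    (rootMultiplicity_pos f.denom_ne_zero).2 h0
  rw [ordAt_coe, h2] at h
  omega

/-- Without poles in the plane the denominator has no root and is constant; order zero at infinity
then makes the numerator constant. -/
theorem eq_C_of_ordAt_eq_zero {f : RatFunc ℂ} (hf : f ≠ 0) (h : ∀ p, ordAt f p = 0) :
    ∃ c : ℂ, c ≠ 0 ∧ f = RatFunc.C c := by
  have hd : f.denom.degree = 0 := by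
    by_contra h0
    obtain ⟨a, ha⟩ := IsAlgClosed.exists_root _ h0
    exact denom_eval_ne_zero (h a).ge ha
  have hn : f.num.natDegree = 0 := by
    have h1 := h OnePoint.infty
    rw [ordAt_infty, RatFunc.intDegree, natDegree_eq_of_degree_eq_some (n := 0) hd] at h1
    omega
  have hd' := natDegree_eq_of_degree_eq_some (n := 0) hd
  have h2 : f.denom = 1 := (f.monic_denom.natDegree_eq_zero).1 hd'
  have h3 := eq_C_of_natDegree_eq_zero hn
  have h4 : f = RatFunc.C (f.num.coeff 0) := by
    conv_lhs => rw [← RatFunc.num_div_denom f, h2, h3]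
    simp
  refine ⟨f.num.coeff 0, fun h5 => hf ?_, h4⟩
  rw [h4, h5, map_zero]

theorem valAt_one (p : OnePoint ℂ) : valAt 1 p = 1 := by
  induction p using OnePoint.rec with
  | infty => simp [valAt_infty]
  | coe a => simp [valAt_coe]

theorem valAt_C (c : ℂ) (p : OnePoint ℂ) : valAt (RatFunc.C c) p = c := by
  induction p using OnePoint.rec with
  | infty => simp [valAt_infty]
  | coe a => simp [valAt_coe]

theorem valAt_mul {f g : RatFunc ℂ} {p : OnePoint ℂ} (hf : ordAt f p = 0) (hg : ordAt g p = 0) :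
    valAt (f * g) p = valAt f p * valAt g p := by
  induction p using OnePoint.rec with
  | infty =>
    have h := congrArg leadingCoeff (RatFunc.num_denom_mul f g)
    simp only [leadingCoeff_mul] at h
    rw [valAt_infty, valAt_infty, valAt_infty, div_mul_div_comm, div_eq_div_iff
      (leadingCoeff_ne_zero.2 (RatFunc.denom_ne_zero _))
      (mul_ne_zero (leadingCoeff_ne_zero.2 f.denom_ne_zero)
        (leadingCoeff_ne_zero.2 g.denom_ne_zero))]
    linear_combination h
  | coe a =>
    rw [valAt_coe, valAt_coe, valAt_coe]
    have h1 := denom_eval_ne_zero hf.ge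
    have h2 := denom_eval_ne_zero hg.ge
    refine RatFunc.eval_mul (RingHom.id ℂ) a ?_ ?_
    · rwa [eval₂_id]
    · rwa [eval₂_id]

theorem valAt_zpow {f : RatFunc ℂ} (hf0 : f ≠ 0) {p : OnePoint ℂ} (hf : ordAt f p = 0)
    (h1 : valAt f p = 1) (n : ℤ) : valAt (f ^ n) p = 1 := by
  have hnat : ∀ n : ℕ, valAt (f ^ n) p = 1 := by
    intro n
    induction n with
    | zero => rw [pow_zero, valAt_one]
    | succ n ih => rw [pow_succ, valAt_mul (by rw [ordAt_pow hf0, hf, mul_zero]) hf, ih, h1, mul_one]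
  obtain ⟨n, rfl | rfl⟩ := n.eq_nat_or_neg
  · rw [zpow_natCast, hnat]
  · have h2 : ordAt (f ^ n) p = 0 := by rw [ordAt_pow hf0, hf, mul_zero]
    have h3 := valAt_mul h2 (show ordAt (f ^ n)⁻¹ p = 0 by
      rw [ordAt_inv (pow_ne_zero _ hf0), h2, neg_zero])
    rw [mul_inv_cancel₀ (pow_ne_zero _ hf0), valAt_one, hnat, one_mul] at h3
    rw [zpow_neg, zpow_natCast, ← h3]

/-- The linear form vanishing at a point of the projective line. -/
def linForm : OnePoint ℂ → ℂ[X]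
  | none => 1
  | some a => X - C a

theorem linForm_infty : linForm OnePoint.infty = 1 := rfl

theorem linForm_coe (a : ℂ) : linForm (a : OnePoint ℂ) = X - C a := rfl

theorem linForm_ne_zero (p : OnePoint ℂ) : linForm p ≠ 0 := by
  induction p using OnePoint.rec with
  | infty => exact one_ne_zero
  | coe a => exact X_sub_C_ne_zero a

open Classical in
theorem ordAt_linForm (p q : OnePoint ℂ) : ordAt (algebraMap ℂ[X] (RatFunc ℂ) (linForm p)) q =
    (if q = p then 1 else 0) - (if q = OnePoint.infty then 1 else 0) := by
  induction p using OnePoint.rec with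
  | infty => rw [linForm_infty, map_one, ordAt_one, sub_self]
  | coe a =>
    rw [linForm_coe]
    induction q using OnePoint.rec with
    | infty =>
      rw [ordAt_infty, RatFunc.intDegree_polynomial, natDegree_X_sub_C]
      simp
    | coe b =>
      rw [ordAt_coe, RatFunc.num_algebraMap, RatFunc.denom_algebraMap, rootMultiplicity_X_sub_C]
      simp

open Classical in
theorem ordAt_linForm_div (p p' q : OnePoint ℂ) {κ : ℂ} (hκ : κ ≠ 0) :
    ordAt (algebraMap ℂ[X] (RatFunc ℂ) (C κ * linForm p) /
      algebraMap ℂ[X] (RatFunc ℂ) (linForm p')) q =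
    (if q = p then 1 else 0) - (if q = p' then 1 else 0) := by
  have h1 := RatFunc.algebraMap_ne_zero (linForm_ne_zero p)
  have h2 := RatFunc.algebraMap_ne_zero (linForm_ne_zero p')
  have h3 : RatFunc.C κ ≠ 0 := by simpa using hκ
  rw [map_mul, RatFunc.algebraMap_C, ordAt_div (mul_ne_zero h3 h1) h2, ordAt_mul h3 h1, ordAt_C,
    ordAt_linForm, ordAt_linForm]
  ring

/-- Three binary linear forms are dependent, with nonzero coefficients when their zeros differ. The
coordinate is `κ l₁ / l₂`. If `p₀ = ∞`, its value there is a ratio of leading coefficients, so `κ =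
1` is what makes this value `1`. -/
theorem linForm_relation {p₀ p₁ p₂ : OnePoint ℂ} (h01 : p₀ ≠ p₁) (h02 : p₀ ≠ p₂) (h12 : p₁ ≠ p₂) :
    ∃ κ κ' : ℂ, κ ≠ 0 ∧ κ' ≠ 0 ∧ C κ * linForm p₁ - linForm p₂ = C κ' * linForm p₀ ∧
      (p₀ = OnePoint.infty → κ = 1) := by
  induction p₀ using OnePoint.rec with
  | infty =>
    induction p₁ using OnePoint.rec with
    | infty => exact absurd rfl h01
    | coe b =>
      induction p₂ using OnePoint.rec with
      | infty => exact absurd rfl h02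
      | coe c =>
        have hbc : c - b ≠ 0 := sub_ne_zero.2 fun h => h12 (by rw [h])
        refine ⟨1, c - b, one_ne_zero, hbc, ?_, fun _ => rfl⟩
        simp only [linForm_infty, linForm_coe, map_sub, map_one]
        ring
  | coe a =>
    induction p₁ using OnePoint.rec with
    | infty =>
      induction p₂ using OnePoint.rec with
      | infty => exact absurd rfl h12
      | coe c =>
        have hac : a - c ≠ 0 := sub_ne_zero.2 fun h => h02 (by rw [h])
        refine ⟨a - c, -1, hac, by norm_num, ?_, fun h => absurd h (OnePoint.coe_ne_infty a)⟩
        simp only [linForm_infty, linForm_coe, map_sub, map_one, map_neg]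
        ring
    | coe b =>
      have hab : a - b ≠ 0 := sub_ne_zero.2 fun h => h01 (by rw [h])
      induction p₂ using OnePoint.rec with
      | infty =>
        refine ⟨(a - b)⁻¹, (a - b)⁻¹, inv_ne_zero hab, inv_ne_zero hab, ?_,
          fun h => absurd h (OnePoint.coe_ne_infty a)⟩
        have h1 : (1 : ℂ[X]) = C (a - b)⁻¹ * (C a - C b) := by
          rw [← map_sub, ← map_mul, inv_mul_cancel₀ hab, map_one]
        simp only [linForm_infty, linForm_coe]
        linear_combination -h1
      | coe c =>
        have hac : a - c ≠ 0 := sub_ne_zero.2 fun h => h02 (by rw [h])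
        have hbc : b - c ≠ 0 := sub_ne_zero.2 fun h => h12 (by rw [h])
        refine ⟨(a - c) / (a - b), (b - c) / (a - b), div_ne_zero hac hab, div_ne_zero hbc hab, ?_,
          fun h => absurd h (OnePoint.coe_ne_infty a)⟩
        have h1 : (a - c) / (a - b) - 1 = (b - c) / (a - b) := by
          field_simp
          ring
        have h2 : -((a - c) / (a - b) * b) + c = -((b - c) / (a - b) * a) := by
          field_simp
          ring
        have h1' := congrArg (C : ℂ →+* ℂ[X]) h1
        have h2' := congrArg (C : ℂ →+* ℂ[X]) h2
        simp only [map_sub, map_one, map_add, map_neg, map_mul] at h1' h2'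
        simp only [linForm_coe]
        linear_combination X * h1' + h2'

open Classical in
/-- A coordinate on the projective line with value `1`, `0` and `∞` at three given points. -/
theorem exists_coordinate {p₀ p₁ p₂ : OnePoint ℂ} (h01 : p₀ ≠ p₁) (h02 : p₀ ≠ p₂)
    (h12 : p₁ ≠ p₂) :
    ∃ t : RatFunc ℂ, Transcendental ℂ t ∧ t ≠ 0 ∧ t - 1 ≠ 0 ∧
      (∀ q, ordAt t q = (if q = p₁ then 1 else 0) - (if q = p₂ then 1 else 0)) ∧
      (∀ q, ordAt (t - 1) q = (if q = p₀ then 1 else 0) - (if q = p₂ then 1 else 0)) ∧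
      valAt t p₀ = 1 := by
  obtain ⟨κ, κ', hκ, hκ', hrel, hinf⟩ := linForm_relation h01 h02 h12
  have hl : ∀ p, algebraMap ℂ[X] (RatFunc ℂ) (linForm p) ≠ 0 :=
    fun p => RatFunc.algebraMap_ne_zero (linForm_ne_zero p)
  have hCκ : ∀ {κ : ℂ} (p : OnePoint ℂ), κ ≠ 0 →
      algebraMap ℂ[X] (RatFunc ℂ) (C κ * linForm p) ≠ 0 := fun p h =>
    RatFunc.algebraMap_ne_zero (mul_ne_zero (by simpa using h) (linForm_ne_zero p))
  set t := algebraMap ℂ[X] (RatFunc ℂ) (C κ * linForm p₁) /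
    algebraMap ℂ[X] (RatFunc ℂ) (linForm p₂) with ht
  have ht1 : t - 1 = algebraMap ℂ[X] (RatFunc ℂ) (C κ' * linForm p₀) /
      algebraMap ℂ[X] (RatFunc ℂ) (linForm p₂) := by
    rw [ht, ← hrel, map_sub, sub_div, div_self (hl p₂)]
  have hord := fun q => ordAt_linForm_div p₁ p₂ q hκ
  refine ⟨t, ?_, div_ne_zero (hCκ p₁ hκ) (hl p₂), ?_, hord, fun q => ?_, ?_⟩
  · refine RatFunc.transcendental_of_ne_C _ ?_
    rintro ⟨c, hc⟩
    have h1 := hord p₁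
    rw [← ht, hc, ordAt_C, if_pos rfl, if_neg h12] at h1
    norm_num at h1
  · rw [ht1]
    exact div_ne_zero (hCκ p₀ hκ') (hl p₂)
  · rw [ht1, ordAt_linForm_div _ _ _ hκ']
  -- At a finite `p₀` the relation says `κ l₁ = l₂`; at infinity the linear forms have leading
  -- coefficient `1` and `κ = 1`.
  · have hnum := num_mul_eq (linForm_ne_zero p₂) ht
    induction p₀ using OnePoint.rec with
    | infty =>
      have h1 := congrArg leadingCoeff hnum
      simp only [leadingCoeff_mul, hinf rfl, leadingCoeff_C, one_mul] at h1
      have hm : ∀ p, (linForm p).leadingCoeff = 1 := by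
        intro p
        induction p using OnePoint.rec with
        | infty => simp [linForm_infty]
        | coe a => simp [linForm_coe]
      rw [hm, hm, mul_one, one_mul] at h1
      rw [valAt_infty, h1, div_self (leadingCoeff_ne_zero.2 t.denom_ne_zero)]
    | coe a =>
      have h0 : ordAt t (a : OnePoint ℂ) = 0 := by
        rw [hord, if_neg h01, if_neg h02, sub_zero]
      have h1 := congrArg (eval a) hnum
      have h2 := congrArg (eval a) hrel
      simp only [linForm_coe, eval_sub, eval_mul, eval_C, eval_X, sub_self, mul_zero] at h1 h2
      have h3 : eval a (linForm p₂) ≠ 0 := by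
        induction p₂ using OnePoint.rec with
        | infty => simp [linForm_infty]
        | coe b =>
          simp only [linForm_coe, eval_sub, eval_X, eval_C]
          exact sub_ne_zero.2 fun h => h02 (by rw [h])
      have h4 : t.num.eval a = t.denom.eval a := by
        refine mul_right_cancel₀ h3 ?_
        rw [h1]
        linear_combination t.denom.eval a * h2
      rw [valAt_coe, RatFunc.eval, eval₂_id, eval₂_id, h4,
        div_self (denom_eval_ne_zero h0.ge)]

-- A function whose zeros and poles lie in three points is determined by its orders up to a
-- constant. In the coordinate with values `1, 0, ∞` at these points it is therefore a `branchFun`.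
-- The map `τ` substitutes this coordinate for `T`.
open Classical in
theorem exists_branch_coordinate {p₀ p₁ p₂ : OnePoint ℂ} (h01 : p₀ ≠ p₁) (h02 : p₀ ≠ p₂)
    (h12 : p₁ ≠ p₂) :
    ∃ τ : RatFunc ℂ →ₐ[ℂ] RatFunc ℂ,
      (∀ (f : RatFunc ℂ) (h n : ℤ), f ≠ 0 → ordAt f p₀ = -n → ordAt f p₁ = h →
        ordAt f p₂ = n - h → (∀ q, q ≠ p₀ → q ≠ p₁ → q ≠ p₂ → ordAt f q = 0) →
        ∃ c : ℂ, c ≠ 0 ∧ f = τ (branchFun c h n)) ∧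
      ∀ (c : ℂ) (h : ℤ), valAt (τ (branchFun c h 0)) p₀ = c := by
  obtain ⟨t, htr, ht0, ht1, hord, hord1, hval⟩ := exists_coordinate h01 h02 h12
  have hτ : ∀ (c : ℂ) (h n : ℤ), substHom t htr (branchFun c h n) =
      RatFunc.C c * t ^ h * (t - 1) ^ (-n) := by
    intro c h n
    simp only [branchFun, map_mul, map_zpow₀, map_sub, map_one, substHom_X]
    congr 2
    exact (substHom t htr).commutes c
  refine ⟨substHom t htr, fun f h n hf hp₀ hp₁ hp₂ hq => ?_, fun c h => ?_⟩
  · have hz1 := zpow_ne_zero h ht0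
    have hz2 := zpow_ne_zero (-n) ht1
    have hz := mul_ne_zero hz1 hz2
    obtain ⟨c, hc, hfc⟩ := eq_C_of_ordAt_eq_zero (div_ne_zero hf hz) fun q => by
      rw [ordAt_div hf hz, ordAt_mul hz1 hz2, ordAt_zpow ht0, ordAt_zpow ht1, hord, hord1]
      by_cases e0 : q = p₀
      · subst e0
        rw [hp₀, if_neg h01, if_neg h02, if_pos rfl]
        ring
      · by_cases e1 : q = p₁
        · subst e1
          rw [hp₁, if_neg h12, if_pos rfl, if_neg e0]
          ring
        · by_cases e2 : q = p₂
          · subst e2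
            rw [hp₂, if_pos rfl, if_neg e0, if_neg e1]
            ring
          · rw [hq q e0 e1 e2, if_neg e0, if_neg e1, if_neg e2]
            ring
    refine ⟨c, hc, ?_⟩
    rw [hτ, mul_assoc, ← hfc, div_mul_cancel₀ _ hz]
  · have h0 : ordAt t p₀ = 0 := by rw [hord, if_neg h01, if_neg h02, sub_zero]
    rw [hτ, neg_zero, zpow_zero, mul_one, valAt_mul (ordAt_C _ _)
      (by rw [ordAt_zpow ht0, h0, mul_zero]), valAt_C, valAt_zpow ht0 h0 hval, mul_one]

end Order

/-! ### Limit curves of an enhancement -/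

section Enhancement

variable {V E L : Type*} [Fintype V] [Fintype E] [Fintype L] [DecidableEq V]
variable {Γ : PlaneTropicalCurve V E L}

/-- By balancing, all determinants of two different directions at the vertex agree up to sign, so
nondegeneracy holds for the chosen pair as well. -/
theorem PlaneTropicalCurve.Trivalent.exists_flags (hΓ : Γ.Trivalent) (f : Flag E L) :
    ∃ g g' : Flag E L, Γ.vertex g = Γ.vertex f ∧ Γ.vertex g' = Γ.vertex f ∧ f ≠ g ∧ f ≠ g' ∧
      g ≠ g' ∧ (∀ k, Γ.vertex k = Γ.vertex f → k = f ∨ k = g ∨ k = g') ∧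
      Γ.vec f + (Γ.vec g + Γ.vec g') = 0 ∧ det2 (-Γ.vec g) (Γ.vec f) ≠ 0 := by
  classical
  set S : Finset (Flag E L) := Finset.univ.filter fun k => Γ.vertex k = Γ.vertex f with hS
  have hmem : ∀ k, k ∈ S ↔ Γ.vertex k = Γ.vertex f := fun k => by simp [hS]
  have hcard : S.card = 3 := by
    rw [← (hΓ (Γ.vertex f)).1, Nat.card_eq_fintype_card, Fintype.card_subtype]
  have hf : f ∈ S := (hmem f).2 rfl
  have hcard2 : (S.erase f).card = 2 := by rw [Finset.card_erase_of_mem hf, hcard]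
  obtain ⟨g, g', hgg, hS2⟩ := Finset.card_eq_two.1 hcard2
  have hg : g ∈ S.erase f := by rw [hS2]; simp
  have hg' : g' ∈ S.erase f := by rw [hS2]; simp
  rw [Finset.mem_erase, hmem] at hg hg'
  have hall : ∀ k, Γ.vertex k = Γ.vertex f → k = f ∨ k = g ∨ k = g' := by
    intro k hk
    by_cases hkf : k = f
    · exact Or.inl hkf
    · have : k ∈ S.erase f := Finset.mem_erase.2 ⟨hkf, (hmem k).2 hk⟩
      rw [hS2] at this
      simpa using Or.inr this
  have hsum : Γ.vec f + (Γ.vec g + Γ.vec g') = 0 := by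
    rw [← Finset.sum_pair hgg, ← hS2, Finset.add_sum_erase _ _ hf]
    have := Γ.balanced (Γ.vertex f)
    convert this
  refine ⟨g, g', hg.2, hg'.2, hg.1.symm, hg'.1.symm, hgg, hall, hsum, fun hdet => ?_⟩
  obtain ⟨a, b, ha, hb, hab⟩ := (hΓ (Γ.vertex f)).2
  have h1 : (Γ.vec f).1 + ((Γ.vec g).1 + (Γ.vec g').1) = 0 := congrArg Prod.fst hsum
  have h2 : (Γ.vec f).2 + ((Γ.vec g).2 + (Γ.vec g').2) = 0 := congrArg Prod.snd hsum
  have e1 : (Γ.vec g').1 = -(Γ.vec f).1 - (Γ.vec g).1 := by linarith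
  have e2 : (Γ.vec g').2 = -(Γ.vec f).2 - (Γ.vec g).2 := by linarith
  simp only [det2, Prod.fst_neg, Prod.snd_neg] at hdet hab
  apply hab
  -- Each of the nine determinants vanishes identically or is plus or minus the one in `hdet`.
  rcases hall a ha with rfl | rfl | rfl <;> rcases hall b hb with rfl | rfl | rfl <;>
    (try simp only [e1, e2]) <;>
    first | ring1 | linear_combination hdet | linear_combination -hdet

theorem evalAt_branch_iff (τ : RatFunc ℂ →ₐ[ℂ] RatFunc ℂ) (x y : RatFunc ℂ) (F : Laurent) :
    evalAt (τ x) (τ y) F = 0 ↔ evalAt x y F = 0 := by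
  rw [evalAt_map]
  exact map_eq_zero_iff _ τ.toRingHom.injective

/-- The limit curve at a flag is, up to a change of the parameter, given by monomials in `T` and
`T - 1`, where `T = 1` at the point over the toric divisor of the flag. -/
theorem Enhancement.exists_branch (hΓ : Γ.Trivalent) (Φ : Enhancement Γ) (f : Flag E L) :
    ∃ (a b : ℂ) (h : ℤ × ℤ), a ≠ 0 ∧ b ≠ 0 ∧ det2 h (Γ.vec f) ≠ 0 ∧
      (∀ F, IsDefiningEquation F (Φ.φ (Γ.vertex f)) ↔ IsBranchEquation a b h (Γ.vec f) F) ∧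
      ∀ m, dot m (Γ.vec f) = 0 → (Φ.φ (Γ.vertex f)).charVal m (Φ.pt f) = monom a b m := by
  obtain ⟨g, g', hg, hg', hfg, hfg', hgg, hall, hsum, hdet⟩ := hΓ.exists_flags f
  have hne : ∀ k k', Γ.vertex k = Γ.vertex f → Γ.vertex k' = Γ.vertex f → k ≠ k' →
      Φ.pt k ≠ Φ.pt k' := fun k k' hk hk' hkk h => hkk (Φ.pt_injective k k' (hk.trans hk'.symm) h)
  obtain ⟨τ, hτ, hτval⟩ := exists_branch_coordinate (hne f g rfl hg hfg) (hne f g' rfl hg' hfg')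
    (hne g g' hg hg' hgg)
  have of := Φ.ord_pt f
  have og := Φ.ord_pt g
  have og' := Φ.ord_pt g'
  rw [hg] at og
  rw [hg'] at og'
  have oq : ∀ q, q ≠ Φ.pt f → q ≠ Φ.pt g → q ≠ Φ.pt g' →
      (Φ.φ (Γ.vertex f)).ordVec q = 0 := by
    intro q h0 h1 h2
    refine Φ.ord_other _ q fun k hk => ?_
    rcases hall k hk with rfl | rfl | rfl
    exacts [h0.symm, h1.symm, h2.symm]
  have h1 : (Γ.vec f).1 + ((Γ.vec g).1 + (Γ.vec g').1) = 0 := congrArg Prod.fst hsum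
  have h2 : (Γ.vec f).2 + ((Γ.vec g).2 + (Γ.vec g').2) = 0 := congrArg Prod.snd hsum
  -- The exponent of `T` is the order `-vec g` at the point of `g`. At the third point, `T = ∞`, the
  -- required order `vec f + vec g` equals `-vec g'` by balancing.
  obtain ⟨a, ha, hXa⟩ := hτ (Φ.φ (Γ.vertex f)).X (-Γ.vec g).1 (Γ.vec f).1
    (Φ.φ (Γ.vertex f)).X_ne_zero (congrArg Prod.fst of) (congrArg Prod.fst og)
    ((congrArg Prod.fst og').trans (by simp only [Prod.fst_neg]; linarith))
    (fun q e0 e1 e2 => congrArg Prod.fst (oq q e0 e1 e2))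
  obtain ⟨b, hb, hYb⟩ := hτ (Φ.φ (Γ.vertex f)).Y (-Γ.vec g).2 (Γ.vec f).2
    (Φ.φ (Γ.vertex f)).Y_ne_zero (congrArg Prod.snd of) (congrArg Prod.snd og)
    ((congrArg Prod.snd og').trans (by simp only [Prod.snd_neg]; linarith))
    (fun q e0 e1 e2 => congrArg Prod.snd (oq q e0 e1 e2))
  refine ⟨a, b, -Γ.vec g, ha, hb, hdet, fun F => ?_, fun m hm => ?_⟩
  · rw [IsDefiningEquation, IsBranchEquation, hXa, hYb, evalAt_branch_iff]
  · rw [TorusMap.charVal, hXa, hYb]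
    have h3 := map_monom (τ : RatFunc ℂ →+* RatFunc ℂ) (branchFun a (-Γ.vec g).1 (Γ.vec f).1)
      (branchFun b (-Γ.vec g).2 (Γ.vec f).2) m
    have h4 := monom_branchFun a b (-Γ.vec g) (Γ.vec f) m
    rw [h4, hm] at h3
    have h5 : monom (τ (branchFun a (-Γ.vec g).1 (Γ.vec f).1))
      (τ (branchFun b (-Γ.vec g).2 (Γ.vec f).2)) m = τ (branchFun (monom a b m)
        (dot m (-Γ.vec g)) 0) := h3.symm
    rw [h5, hτval]

theorem dot_rot (u : ℤ × ℤ) (k : ℤ) : dot (rot u) (k • u) = 0 := by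
  simp only [dot, rot, Prod.smul_fst, Prod.smul_snd, smul_eq_mul]
  ring

theorem det2_smul_right (h u : ℤ × ℤ) (k : ℤ) : det2 h (k • u) = k * det2 h u := by
  simp only [det2, Prod.smul_fst, Prod.smul_snd, smul_eq_mul]
  ring

/-- The branches of the two limit curves at the toric divisor of a bounded edge. -/
theorem Enhancement.exists_branchPair (hΓ : Γ.Trivalent) (Φ : Enhancement Γ) (e : E) :
    ∃ S : BranchPair (Γ.dir e),
      (∀ F₁ F₂, (IsDefiningEquation F₁ (Φ.φ (Γ.tail e)) ∧ IsDefiningEquation F₂ (Φ.φ (Γ.head e))) ↔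
        S.Equations (Γ.wt e) F₁ F₂) ∧
      (Φ.φ (Γ.tail e)).charVal (rot (Γ.dir e)) (Φ.pt (Sum.inl e)) =
        monom S.a₁ S.b₁ (rot (Γ.dir e)) := by
  obtain ⟨a₁, b₁, h₁, ha₁, hb₁, hd₁, hF₁, hv₁⟩ := Φ.exists_branch hΓ (Sum.inl e)
  obtain ⟨a₂, b₂, h₂, ha₂, hb₂, hd₂, hF₂, hv₂⟩ := Φ.exists_branch hΓ (Sum.inr (Sum.inl e))
  have e1 : Γ.vec (Sum.inl e) = (Γ.wt e : ℤ) • Γ.dir e := (natCast_zsmul _ _).symm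
  have e2 : Γ.vec (Sum.inr (Sum.inl e)) = (-(Γ.wt e : ℤ)) • Γ.dir e := by
    rw [neg_smul, natCast_zsmul]
    rfl
  have v1 := hv₁ (rot (Γ.dir e)) (by rw [e1, dot_rot])
  have v2 := hv₂ (rot (Γ.dir e)) (by rw [e2, dot_rot])
  refine ⟨⟨a₁, b₁, h₁, a₂, b₂, h₂, ha₁, hb₁, ha₂, hb₂, ?_, ?_, ?_⟩, fun F₁ F₂ => ?_, v1⟩
  · rw [e1, det2_smul_right] at hd₁
    exact right_ne_zero_of_mul hd₁
  · rw [e2, det2_smul_right] at hd₂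
    exact right_ne_zero_of_mul hd₂
  · rw [← v1, ← v2]
    exact Φ.matching e
  · exact and_congr (hF₁ F₁) (hF₂ F₂)

end Enhancement

/-! ### Dickson polynomials -/

section Dickson

open Polynomial

/-- The power sums `x ^ n + y ^ n` satisfy the Dickson recursion with parameter `x y = α`. This
identity is what makes the modification curves parametrizable. -/
theorem aeval_dickson_add {A : Type*} [CommRing A] [Algebra ℂ A] (α : ℂ) (x y : A)
    (h : x * y = algebraMap ℂ A α) (n : ℕ) : aeval (x + y) (dickson 1 α n) = x ^ n + y ^ n := by
  induction n using Nat.strong_induction_on with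
  | _ n ih =>
    match n with
    | 0 =>
      -- The initial value of `dickson k α` is `3 - k`, which is `2` for the first kind.
      rw [dickson_zero, map_sub, map_ofNat, map_natCast, pow_zero, pow_zero, Nat.cast_one]
      norm_num
    | 1 => simp
    | n + 2 =>
      rw [dickson_add_two, map_sub, map_mul, map_mul, aeval_X, aeval_C, ih n (by omega),
        ih (n + 1) (by omega), ← h]
      ring

theorem dickson_natDegree_le (α : ℂ) (n : ℕ) : (dickson 1 α n).natDegree ≤ n := by
  induction n using Nat.strong_induction_on with
  | _ n ih =>
    match n with
    | 0 =>
      rw [dickson_zero]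
      refine (natDegree_sub_le _ _).trans ?_
      simp
    | 1 => simp
    | n + 2 =>
      rw [dickson_add_two]
      refine (natDegree_sub_le _ _).trans (max_le ?_ ?_)
      · exact natDegree_mul_le.trans (by have := ih (n + 1) (by omega); rw [natDegree_X]; omega)
      · exact (natDegree_C_mul_le _ _).trans ((ih n (by omega)).trans (by omega))

theorem dickson_coeff_self (α : ℂ) {n : ℕ} (hn : 0 < n) : (dickson 1 α n).coeff n = 1 := by
  induction n using Nat.strong_induction_on with
  | _ n ih =>
    match n with
    | 0 => exact absurd hn (lt_irrefl 0)
    | 1 => simp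
    | n + 2 =>
      rw [dickson_add_two, coeff_sub, coeff_X_mul, coeff_C_mul, ih (n + 1) (by omega) (by omega),
        coeff_eq_zero_of_natDegree_lt (lt_of_le_of_lt (dickson_natDegree_le α n) (by omega))]
      simp

theorem dickson_coeff_succ (α : ℂ) (n : ℕ) : (dickson 1 α (n + 1)).coeff n = 0 := by
  induction n with
  | zero => simp
  | succ n ih =>
    rw [dickson_add_two, coeff_sub, coeff_X_mul, coeff_C_mul, ih,
      coeff_eq_zero_of_natDegree_lt (lt_of_le_of_lt (dickson_natDegree_le α n) (by omega))]
    simp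

theorem dickson_coeff_add_two (α : ℂ) (n : ℕ) :
    (dickson 1 α (n + 2)).coeff n = -((n + 2 : ℕ) : ℂ) * α := by
  induction n with
  | zero =>
    rw [dickson_two]
    simp
    ring
  | succ n ih =>
    rw [dickson_add_two, coeff_sub, coeff_X_mul, coeff_C_mul, ih,
      dickson_coeff_self α (Nat.succ_pos n)]
    push_cast
    ring

/-- For `n ≥ 2` the coefficient of `X ^ (n - 2)` is `-n α`. For `n = 1` the polynomial is `X` for
every parameter, and the equality of powers decides. -/
theorem dickson_injective {α β : ℂ} {n : ℕ} (hn : 0 < n) (hpow : α ^ n = β ^ n)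
    (h : dickson 1 α n = dickson 1 β n) : α = β := by
  match n with
  | 0 => exact absurd hn (lt_irrefl 0)
  | 1 => simpa using hpow
  | n + 2 =>
    have h1 := congrArg (fun p : ℂ[X] => p.coeff n) h
    simp only [dickson_coeff_add_two] at h1
    exact mul_left_cancel₀ (neg_ne_zero.2 (Nat.cast_ne_zero.2 (by omega))) h1

theorem degree_sub_X_pow_lt {P : ℂ[X]} {n : ℕ} (hd : P.natDegree ≤ n + 1)
    (h1 : P.coeff (n + 1) = 1) (h0 : P.coeff n = 0) : (P - X ^ (n + 1)).degree < (n : WithBot ℕ) := by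
  rw [degree_lt_iff_coeff_zero]
  intro m hm
  rw [coeff_sub, coeff_X_pow]
  rcases Nat.lt_or_ge (n + 1) m with h | h
  · rw [coeff_eq_zero_of_natDegree_lt (lt_of_le_of_lt hd h), if_neg (by omega), sub_zero]
  · rcases Nat.lt_or_ge n m with h' | h'
    · rw [show m = n + 1 by omega, h1, if_pos rfl, sub_self]
    · rw [show m = n by omega, h0, if_neg (by omega), sub_zero]

/-- Dickson polynomials are weighted homogeneous, with weight `1` for the variable and weight `2`
for the parameter. -/
theorem dickson_scale (α b : ℂ) (n : ℕ) :
    (dickson 1 (b ^ 2 * α) n).comp (C b * X) = C (b ^ n) * dickson 1 α n := by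
  induction n using Nat.strong_induction_on with
  | _ n ih =>
    match n with
    | 0 =>
      rw [dickson_zero, dickson_zero]
      simp
    | 1 => simp
    | n + 2 =>
      rw [dickson_add_two, dickson_add_two, sub_comp, mul_comp, mul_comp, ih n (by omega),
        ih (n + 1) (by omega), X_comp, C_comp]
      simp only [map_mul, map_pow]
      ring

end Dickson

/-! ### The curves of modification data -/

section Curves

open Polynomial LaurentPolynomial

/-- The Laurent polynomial `θ₁ * x⁻¹ + θ₂ * x + P(y)`. -/
def curve (θ₁ θ₂ : ℂ) (P : ℂ[X]) : Laurent :=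
  AddMonoidAlgebra.single (-1, 0) θ₁ + AddMonoidAlgebra.single (1, 0) θ₂ + yHom (toLaurent P)

theorem yHom_coeff (q : ℂ[T;T⁻¹]) (i j : ℤ) :
    (yHom q).coeff (i, j) = if i = 0 then q.coeff j else 0 := by
  rw [← theta_C 1, theta_coeff (Or.inl rfl), Polynomial.coeff_C]
  by_cases hi : i = 0
  · simp [hi]
  · rw [if_neg hi]
    split_ifs with h1 h2
    · omega
    · rfl
    · rfl

theorem curve_coeff (θ₁ θ₂ : ℂ) (P : ℂ[X]) (i j : ℤ) :
    (curve θ₁ θ₂ P).coeff (i, j) = (if i = -1 ∧ j = 0 then θ₁ else 0) +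
      (if i = 1 ∧ j = 0 then θ₂ else 0) + if i = 0 then (toLaurent P).coeff j else 0 := by
  rw [curve, AddMonoidAlgebra.coeff_add, AddMonoidAlgebra.coeff_add, Finsupp.add_apply,
    Finsupp.add_apply, yHom_coeff, AddMonoidAlgebra.coeff_single, AddMonoidAlgebra.coeff_single,
    Finsupp.single_apply, Finsupp.single_apply]
  simp only [Prod.mk.injEq, eq_comm]

theorem curve_coeff_left (θ₁ θ₂ : ℂ) (P : ℂ[X]) : (curve θ₁ θ₂ P).coeff (-1, 0) = θ₁ := by
  simp [curve_coeff]

theorem curve_coeff_right (θ₁ θ₂ : ℂ) (P : ℂ[X]) : (curve θ₁ θ₂ P).coeff (1, 0) = θ₂ := by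
  simp [curve_coeff]

theorem curve_coeff_zero (θ₁ θ₂ : ℂ) (P : ℂ[X]) (j : ℕ) :
    (curve θ₁ θ₂ P).coeff (0, (j : ℤ)) = P.coeff j := by
  rw [curve_coeff, if_neg (by simp), if_neg (by simp), if_pos rfl, toLaurent_coeff_natCast]
  simp

theorem evalAt_curve {K : Type*} [Field K] [Algebra ℂ K] {x y : K} (hx : x ≠ 0) (hy : y ≠ 0)
    (θ₁ θ₂ : ℂ) (P : ℂ[X]) : evalAt x y (curve θ₁ θ₂ P) =
      algebraMap ℂ K θ₁ * x⁻¹ + algebraMap ℂ K θ₂ * x + aeval y P := by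
  rw [← evalHom_apply x y hx hy, curve, map_add, map_add, evalHom_single, evalHom_single,
    evalHom_apply, evalAt_yHom x y hx hy, yEval_toLaurent]
  simp [monom]

theorem exists_eq_curve {f : Laurent} {ℓ : ℕ}
    (hf : ∀ i j : ℤ, f.coeff (i, j) ≠ 0 → (i = -1 ∧ j = 0) ∨ (i = 1 ∧ j = 0) ∨
      (i = 0 ∧ 0 ≤ j ∧ j ≤ ℓ)) :
    ∃ P : ℂ[X], P.natDegree ≤ ℓ ∧ f = curve (f.coeff (-1, 0)) (f.coeff (1, 0)) P := by
  set P : ℂ[X] := ∑ j ∈ Finset.range (ℓ + 1), Polynomial.monomial j (f.coeff (0, (j : ℤ))) with hP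
  have hPc : ∀ j : ℕ, P.coeff j = f.coeff (0, (j : ℤ)) := by
    intro j
    rw [hP, Polynomial.finsetSum_coeff]
    simp only [Polynomial.coeff_monomial, Finset.sum_ite_eq', Finset.mem_range]
    split_ifs with h
    · rfl
    · by_contra h1
      rcases hf 0 j (Ne.symm h1) with h2 | h2 | h2 <;> omega
  refine ⟨P, ?_, ?_⟩
  · rw [Polynomial.natDegree_le_iff_coeff_eq_zero]
    intro j hj
    rw [hPc]
    by_contra h1
    rcases hf 0 j h1 with h2 | h2 | h2 <;> omega
  · ext ⟨i, j⟩
    rw [curve_coeff]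
    by_cases h0 : f.coeff (i, j) = 0
    · rw [h0]
      by_cases h1 : i = -1 ∧ j = 0
      · obtain ⟨rfl, rfl⟩ := h1
        simp [h0]
      · by_cases h2 : i = 1 ∧ j = 0
        · obtain ⟨rfl, rfl⟩ := h2
          simp [h0]
        · rw [if_neg h1, if_neg h2]
          by_cases h3 : i = 0
          · subst h3
            rcases lt_or_ge j 0 with hj | hj
            · simp only [toLaurent_coeff_of_neg _ hj, if_pos, add_zero]
            · lift j to ℕ using hj
              simp only [toLaurent_coeff_natCast, hPc, h0, if_pos, add_zero]
          · simp [h3]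
    · rcases hf i j h0 with ⟨rfl, rfl⟩ | ⟨rfl, rfl⟩ | ⟨rfl, h3, h4⟩
      · simp
      · simp
      · lift j to ℕ using h3
        simp only [toLaurent_coeff_natCast, hPc]
        simp

theorem restrict_coeff (S : Set (ℝ × ℝ)) [DecidablePred (· ∈ S)] (f : Laurent) (m : ℤ × ℤ) :
    (restrict S f).coeff m = if toReal m ∈ S then f.coeff m else 0 := by
  rw [restrict, AddMonoidAlgebra.coeff_ofCoeff, Finsupp.filter_apply]
  congr

theorem binomialEq_coeff (ε : ℤ) (ℓ : ℕ) (θ : ℂ) (i j : ℤ) :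
    (binomialEq ε ℓ θ).coeff (i, j) =
      (if i = 0 ∧ j = ℓ then 1 else 0) + if i = ε ∧ j = 0 then θ else 0 := by
  rw [binomialEq, AddMonoidAlgebra.coeff_add, Finsupp.add_apply, AddMonoidAlgebra.coeff_single,
    AddMonoidAlgebra.coeff_single, Finsupp.single_apply, Finsupp.single_apply]
  simp only [Prod.mk.injEq, eq_comm]

end Curves

/-! ### Newton polygons -/

section Newton

open Polynomial LaurentPolynomial

theorem convexHull_subset_halfSpace {s : Set (ℝ × ℝ)} {a b c : ℝ}
    (h : ∀ p ∈ s, a * p.1 + b * p.2 ≤ c) : ∀ p ∈ convexHull ℝ s, a * p.1 + b * p.2 ≤ c := by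
  have hconv : Convex ℝ {p : ℝ × ℝ | a * p.1 + b * p.2 ≤ c} := by
    intro p hp q hq s t hs ht hst
    simp only [Set.mem_ofPred_eq, Prod.fst_add, Prod.snd_add, Prod.smul_fst, Prod.smul_snd,
      smul_eq_mul] at hp hq ⊢
    calc a * (s * p.1 + t * q.1) + b * (s * p.2 + t * q.2)
        = s * (a * p.1 + b * p.2) + t * (a * q.1 + b * q.2) := by ring
      _ ≤ s * c + t * c := add_le_add (mul_le_mul_of_nonneg_left hp hs)
          (mul_le_mul_of_nonneg_left hq ht)
      _ = c := by rw [← add_mul, hst, one_mul]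
  exact fun p hp => convexHull_min h hconv hp

theorem segment_subset_line {p q : ℝ × ℝ} {a b c : ℝ} (hp : a * p.1 + b * p.2 = c)
    (hq : a * q.1 + b * q.2 = c) : ∀ r ∈ segment ℝ p q, a * r.1 + b * r.2 = c := by
  rintro _ ⟨s, t, -, -, hst, rfl⟩
  simp only [Prod.fst_add, Prod.snd_add, Prod.smul_fst, Prod.smul_snd, smul_eq_mul]
  linear_combination s * hp + t * hq + c * hst

theorem toReal_mem_newtonPolygon {f : Laurent} {m : ℤ × ℤ} (hm : f.coeff m ≠ 0) :
    toReal m ∈ newtonPolygon f :=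
  subset_convexHull ℝ _ ⟨m, Finset.mem_coe.2 (Finsupp.mem_support_iff.2 hm), rfl⟩

theorem newtonPolygon_eq {f : Laurent} {B : Set (ℝ × ℝ)}
    (h1 : ∀ b ∈ B, ∃ m, f.coeff m ≠ 0 ∧ toReal m = b)
    (h2 : ∀ m, f.coeff m ≠ 0 → toReal m ∈ convexHull ℝ B) :
    newtonPolygon f = convexHull ℝ B := by
  refine Set.Subset.antisymm (convexHull_min ?_ (convex_convexHull ℝ B)) (convexHull_mono ?_)
  · rintro _ ⟨m, hm, rfl⟩
    exact h2 m (Finsupp.mem_support_iff.1 (Finset.mem_coe.1 hm))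
  · intro b hb
    obtain ⟨m, hm, rfl⟩ := h1 b hb
    exact ⟨m, Finset.mem_coe.2 (Finsupp.mem_support_iff.2 hm), rfl⟩

theorem lattice_points_of_le {ℓ : ℕ} (hℓ : 0 < ℓ) {i j : ℤ} (h0 : 0 ≤ (j : ℝ))
    (h1 : (ℓ : ℝ) * i + j ≤ ℓ) (h2 : -(ℓ : ℝ) * i + j ≤ ℓ) :
    (i = -1 ∧ j = 0) ∨ (i = 1 ∧ j = 0) ∨ (i = 0 ∧ 0 ≤ j ∧ j ≤ ℓ) := by
  have h0' : 0 ≤ j := by exact_mod_cast h0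
  have h1' : (ℓ : ℤ) * i + j ≤ ℓ := by exact_mod_cast h1
  have h2' : -(ℓ : ℤ) * i + j ≤ ℓ := by exact_mod_cast h2
  have hl : (0 : ℤ) < ℓ := by exact_mod_cast hℓ
  have hi1 : i ≤ 1 := by
    by_contra h
    nlinarith
  have hi2 : -1 ≤ i := by
    by_contra h
    nlinarith
  obtain rfl | rfl | rfl : i = -1 ∨ i = 0 ∨ i = 1 := by omega
  · left
    constructor <;> linarith
  · right; right
    refine ⟨rfl, h0', by linarith⟩
  · right; left
    constructor <;> linarith

/-- All triangles in question lie in the one with vertices `(±1, 0)` and `(0, ℓ)`, whose lattice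
points are the two lower corners and the middle column. Hence every curve considered has the shape
`curve θ₁ θ₂ P`. -/
theorem lattice_points_of_mem_convexHull {ℓ : ℕ} (hℓ : 0 < ℓ) {B : Set (ℝ × ℝ)}
    (hB : ∀ b ∈ B, b = (-1, 0) ∨ b = (1, 0) ∨ b = (0, 0) ∨ b = (0, (ℓ : ℝ))) {m : ℤ × ℤ}
    (hm : toReal m ∈ convexHull ℝ B) :
    (m.1 = -1 ∧ m.2 = 0) ∨ (m.1 = 1 ∧ m.2 = 0) ∨ (m.1 = 0 ∧ 0 ≤ m.2 ∧ m.2 ≤ ℓ) := by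
  have hl : (0 : ℝ) ≤ ℓ := Nat.cast_nonneg ℓ
  have h0 := convexHull_subset_halfSpace (a := 0) (b := -1) (c := 0) (fun p hp => by
    rcases hB p hp with rfl | rfl | rfl | rfl <;> simp) _ hm
  have h1 := convexHull_subset_halfSpace (a := ℓ) (b := 1) (c := ℓ) (fun p hp => by
    rcases hB p hp with rfl | rfl | rfl | rfl <;> simp) _ hm
  have h2 := convexHull_subset_halfSpace (a := -ℓ) (b := 1) (c := ℓ) (fun p hp => by
    rcases hB p hp with rfl | rfl | rfl | rfl <;> simp) _ hm
  simp only [toReal] at h0 h1 h2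
  exact lattice_points_of_le hℓ (by linarith) (by linarith) (by linarith)

theorem column_mem_convexHull {ℓ : ℕ} (hℓ : 0 < ℓ) {B : Set (ℝ × ℝ)}
    (h0 : ((0 : ℝ), (0 : ℝ)) ∈ convexHull ℝ B) (hl : ((0 : ℝ), (ℓ : ℝ)) ∈ convexHull ℝ B) {j : ℕ}
    (hj : j ≤ ℓ) : toReal (0, (j : ℤ)) ∈ convexHull ℝ B := by
  have hl0 : (ℓ : ℝ) ≠ 0 := Nat.cast_ne_zero.2 hℓ.ne'
  have hjl : (j : ℝ) ≤ ℓ := Nat.cast_le.2 hj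
  have := (convex_convexHull ℝ B) h0 hl (a := 1 - (j : ℝ) / ℓ) (b := (j : ℝ) / ℓ)
    (sub_nonneg.2 (div_le_one_of_le₀ hjl (Nat.cast_nonneg _))) (by positivity) (by ring)
  convert this using 1
  ext
  · simp [toReal]
  · simp [toReal, hl0]

theorem newtonPolygon_curve {θ₁ θ₂ : ℂ} {P : ℂ[X]} {ℓ : ℕ} (hℓ : 0 < ℓ) (hP : P.natDegree ≤ ℓ)
    {B : Set (ℝ × ℝ)} (h1 : ∀ b ∈ B, ∃ m, (curve θ₁ θ₂ P).coeff m ≠ 0 ∧ toReal m = b)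
    (hθ₁ : θ₁ ≠ 0 → ((-1 : ℝ), (0 : ℝ)) ∈ convexHull ℝ B)
    (hθ₂ : θ₂ ≠ 0 → ((1 : ℝ), (0 : ℝ)) ∈ convexHull ℝ B)
    (h0 : ((0 : ℝ), (0 : ℝ)) ∈ convexHull ℝ B) (hl : ((0 : ℝ), (ℓ : ℝ)) ∈ convexHull ℝ B) :
    newtonPolygon (curve θ₁ θ₂ P) = convexHull ℝ B := by
  refine newtonPolygon_eq h1 ?_
  rintro ⟨i, j⟩ hm
  by_cases e1 : i = -1 ∧ j = 0
  · obtain ⟨rfl, rfl⟩ := e1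
    rw [curve_coeff_left] at hm
    simpa [toReal] using hθ₁ hm
  by_cases e2 : i = 1 ∧ j = 0
  · obtain ⟨rfl, rfl⟩ := e2
    rw [curve_coeff_right] at hm
    simpa [toReal] using hθ₂ hm
  rw [curve_coeff, if_neg e1, if_neg e2, zero_add, zero_add] at hm
  by_cases e3 : i = 0
  · subst e3
    rw [if_pos rfl] at hm
    rcases lt_or_ge j 0 with hj | hj
    · exact absurd (toLaurent_coeff_of_neg _ hj) hm
    · lift j to ℕ using hj
      rw [toLaurent_coeff_natCast] at hm
      exact column_mem_convexHull hℓ h0 hl ((le_natDegree_of_ne_zero hm).trans hP)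
  · exact absurd (if_neg e3) hm

theorem newtonPolygon_curve_both {θ₁ θ₂ : ℂ} (hθ₁ : θ₁ ≠ 0) (hθ₂ : θ₂ ≠ 0) {P : ℂ[X]} {ℓ : ℕ}
    (hℓ : 0 < ℓ) (hP : P.natDegree ≤ ℓ) (hc : P.coeff ℓ ≠ 0) :
    newtonPolygon (curve θ₁ θ₂ P) =
      convexHull ℝ {((-1 : ℝ), (0 : ℝ)), (1, 0), (0, (ℓ : ℝ))} := by
  have m1 : ((-1 : ℝ), (0 : ℝ)) ∈ convexHull ℝ
      {((-1 : ℝ), (0 : ℝ)), (1, 0), (0, (ℓ : ℝ))} := subset_convexHull ℝ _ (by simp)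
  have m2 : ((1 : ℝ), (0 : ℝ)) ∈ convexHull ℝ
      {((-1 : ℝ), (0 : ℝ)), (1, 0), (0, (ℓ : ℝ))} := subset_convexHull ℝ _ (by simp)
  refine newtonPolygon_curve hℓ hP ?_ (fun _ => m1) (fun _ => m2) ?_
    (subset_convexHull ℝ _ (by simp))
  · rintro b (rfl | rfl | rfl)
    · exact ⟨(-1, 0), by rwa [curve_coeff_left], by simp [toReal]⟩
    · exact ⟨(1, 0), by rwa [curve_coeff_right], by simp [toReal]⟩
    · exact ⟨(0, (ℓ : ℤ)), by rwa [curve_coeff_zero], by simp [toReal]⟩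
  · have := (convex_convexHull ℝ _) m1 m2 (a := 1 / 2) (b := 1 / 2) (by norm_num) (by norm_num)
      (by norm_num)
    convert this using 1
    ext <;> norm_num

theorem newtonPolygon_curve_left {θ₁ : ℂ} (hθ₁ : θ₁ ≠ 0) {P : ℂ[X]} {ℓ : ℕ}
    (hℓ : 0 < ℓ) (hP : P.natDegree ≤ ℓ) (hc : P.coeff ℓ ≠ 0) (h0 : P.coeff 0 ≠ 0) :
    newtonPolygon (curve θ₁ 0 P) =
      convexHull ℝ {((-1 : ℝ), (0 : ℝ)), (0, 0), (0, (ℓ : ℝ))} := by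
  refine newtonPolygon_curve hℓ hP ?_ (fun _ => subset_convexHull ℝ _ (by simp))
    (fun h => absurd rfl h) (subset_convexHull ℝ _ (by simp)) (subset_convexHull ℝ _ (by simp))
  rintro b (rfl | rfl | rfl)
  · exact ⟨(-1, 0), by rwa [curve_coeff_left], by simp [toReal]⟩
  · exact ⟨(0, ((0 : ℕ) : ℤ)), by rwa [curve_coeff_zero], by simp [toReal]⟩
  · exact ⟨(0, (ℓ : ℤ)), by rwa [curve_coeff_zero], by simp [toReal]⟩

theorem newtonPolygon_curve_right {θ₂ : ℂ} (hθ₂ : θ₂ ≠ 0) {P : ℂ[X]} {ℓ : ℕ}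
    (hℓ : 0 < ℓ) (hP : P.natDegree ≤ ℓ) (hc : P.coeff ℓ ≠ 0) (h0 : P.coeff 0 ≠ 0) :
    newtonPolygon (curve 0 θ₂ P) =
      convexHull ℝ {((0 : ℝ), (0 : ℝ)), (1, 0), (0, (ℓ : ℝ))} := by
  refine newtonPolygon_curve hℓ hP ?_ (fun h => absurd rfl h)
    (fun _ => subset_convexHull ℝ _ (by simp)) (subset_convexHull ℝ _ (by simp))
    (subset_convexHull ℝ _ (by simp))
  rintro b (rfl | rfl | rfl)
  · exact ⟨(0, ((0 : ℕ) : ℤ)), by rwa [curve_coeff_zero], by simp [toReal]⟩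
  · exact ⟨(1, 0), by rwa [curve_coeff_right], by simp [toReal]⟩
  · exact ⟨(0, (ℓ : ℤ)), by rwa [curve_coeff_zero], by simp [toReal]⟩

/-- A linear form exposes the vertex. If its coefficient vanished, the support and hence the Newton
polygon would lie in a half plane that misses the vertex. -/
theorem exists_vertex_coeff_ne_zero {f : Laurent} {a b c : ℝ} {B : Set (ℝ × ℝ)} {v : ℤ × ℤ}
    (hf : newtonPolygon f = convexHull ℝ B) (hv : toReal v ∈ B)
    (hv' : c < a * (v.1 : ℝ) + b * v.2)
    (h : ∀ m : ℤ × ℤ, toReal m ∈ convexHull ℝ B → m ≠ v → a * (m.1 : ℝ) + b * m.2 ≤ c) :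
    f.coeff v ≠ 0 := by
  intro h0
  have h1 : toReal v ∈ newtonPolygon f := hf ▸ subset_convexHull ℝ B hv
  have h2 := convexHull_subset_halfSpace (a := a) (b := b) (c := c) (fun p hp => by
    obtain ⟨m, hm, rfl⟩ := hp
    have hm' := Finsupp.mem_support_iff.1 (Finset.mem_coe.1 hm)
    exact h m (hf ▸ toReal_mem_newtonPolygon hm') fun e => hm' (e ▸ h0)) _ h1
  simp only [toReal] at h2
  linarith

/-! ### Restrictions to edges -/

theorem leftEdge_line {ℓ : ℕ} {m : ℤ × ℤ} (hm : toReal m ∈ leftEdge ℓ) :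
    -(ℓ : ℤ) * m.1 + m.2 = ℓ := by
  have := segment_subset_line (a := -(ℓ : ℝ)) (b := 1) (c := ℓ) (by simp) (by simp) _ hm
  simp only [toReal, one_mul] at this
  exact_mod_cast this

theorem rightEdge_line {ℓ : ℕ} {m : ℤ × ℤ} (hm : toReal m ∈ rightEdge ℓ) :
    (ℓ : ℤ) * m.1 + m.2 = ℓ := by
  have := segment_subset_line (a := (ℓ : ℝ)) (b := 1) (c := ℓ) (by simp) (by simp) _ hm
  simp only [toReal, one_mul] at this
  exact_mod_cast this

theorem restrict_edge_curve {θ₁ θ₂ θ : ℂ} {P : ℂ[X]} {ℓ : ℕ}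
    (hc : P.coeff ℓ = 1) {ε : ℤ} (hε : ε = 1 ∨ ε = -1)
    (hθ : (curve θ₁ θ₂ P).coeff (ε, 0) = θ) {S : Set (ℝ × ℝ)} (hS : toReal (ε, 0) ∈ S)
    (hS' : toReal (-ε, 0) ∉ S) (hS1 : toReal (0, (ℓ : ℤ)) ∈ S)
    (hS2 : ∀ j : ℤ, toReal (0, j) ∈ S → j = ℓ) :
    restrict S (curve θ₁ θ₂ P) = binomialEq ε ℓ θ := by
  classical
  ext ⟨i, j⟩
  rw [restrict_coeff, binomialEq_coeff]
  by_cases h0 : i = 0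
  · subst h0
    have he : ¬(0 = ε ∧ j = 0) := by rcases hε with rfl | rfl <;> simp
    by_cases hj : j = ℓ
    · subst hj
      rw [if_pos hS1, if_neg he, if_pos ⟨rfl, rfl⟩, curve_coeff_zero, hc, add_zero]
    · rw [if_neg (fun h => hj (hS2 j h)), if_neg (fun h => hj h.2), if_neg he, add_zero]
  · rw [if_neg (fun h : i = 0 ∧ j = ℓ => h0 h.1), zero_add]
    by_cases h1 : i = ε ∧ j = 0
    · obtain ⟨rfl, rfl⟩ := h1
      rw [if_pos hS, if_pos ⟨rfl, rfl⟩, hθ]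
    · rw [if_neg h1]
      by_cases h2 : i = -ε ∧ j = 0
      · obtain ⟨rfl, rfl⟩ := h2
        rw [if_neg hS']
      · have : (curve θ₁ θ₂ P).coeff (i, j) = 0 := by
          rw [curve_coeff, if_neg h0]
          rcases hε with rfl | rfl
          · rw [if_neg h1, if_neg h2]
            simp
          · rw [if_neg h1, if_neg (by simpa using h2)]
            simp
        rw [this, ite_self]

theorem restrict_leftEdge_curve {θ₁ θ₂ : ℂ} {P : ℂ[X]} {ℓ : ℕ} (hℓ : 0 < ℓ)
    (hc : P.coeff ℓ = 1) : restrict (leftEdge ℓ) (curve θ₁ θ₂ P) = binomialEq (-1) ℓ θ₁ := by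
  refine restrict_edge_curve hc (Or.inr rfl) (curve_coeff_left _ _ _) ?_ ?_ ?_ ?_
  · simpa [toReal, leftEdge] using left_mem_segment ℝ ((-1 : ℝ), (0 : ℝ)) (0, (ℓ : ℝ))
  · intro h
    have := leftEdge_line h
    omega
  · simpa [toReal, leftEdge] using right_mem_segment ℝ ((-1 : ℝ), (0 : ℝ)) (0, (ℓ : ℝ))
  · intro j h
    have := leftEdge_line h
    simpa using this

theorem restrict_rightEdge_curve {θ₁ θ₂ : ℂ} {P : ℂ[X]} {ℓ : ℕ} (hℓ : 0 < ℓ) (hc : P.coeff ℓ = 1) :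
    restrict (rightEdge ℓ) (curve θ₁ θ₂ P) = binomialEq 1 ℓ θ₂ := by
  refine restrict_edge_curve hc (Or.inl rfl) (curve_coeff_right _ _ _) ?_ ?_ ?_ ?_
  · simpa [toReal, rightEdge] using left_mem_segment ℝ ((1 : ℝ), (0 : ℝ)) (0, (ℓ : ℝ))
  · intro h
    have := rightEdge_line h
    omega
  · simpa [toReal, rightEdge] using right_mem_segment ℝ ((1 : ℝ), (0 : ℝ)) (0, (ℓ : ℝ))
  · intro j h
    have := rightEdge_line h
    simpa using this

theorem coeff_of_restrict_leftEdge {f : Laurent} {ℓ : ℕ} {θ : ℂ}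
    (h : restrict (leftEdge ℓ) f = binomialEq (-1) ℓ θ) : f.coeff (-1, 0) = θ := by
  classical
  have h1 := congrArg (fun g : Laurent => g.coeff (-1, 0)) h
  simp only [restrict_coeff, binomialEq_coeff] at h1
  rw [if_pos (by simpa [toReal, leftEdge] using left_mem_segment ℝ ((-1 : ℝ), (0 : ℝ)) (0, (ℓ : ℝ)))] at h1
  simpa using h1

theorem coeff_of_restrict_rightEdge {f : Laurent} {ℓ : ℕ} {θ : ℂ}
    (h : restrict (rightEdge ℓ) f = binomialEq 1 ℓ θ) : f.coeff (1, 0) = θ := by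
  classical
  have h1 := congrArg (fun g : Laurent => g.coeff (1, 0)) h
  simp only [restrict_coeff, binomialEq_coeff] at h1
  rw [if_pos (by simpa [toReal, rightEdge] using left_mem_segment ℝ ((1 : ℝ), (0 : ℝ)) (0, (ℓ : ℝ)))] at h1
  simpa using h1

theorem evalAt_restrict_bottom {θ₁ θ₂ : ℂ} {P : ℂ[X]} {x : ℂ} (hx : x ≠ 0) :
    evalAt x 1 (restrict (segment ℝ (-1, 0) (0, 0)) (curve θ₁ θ₂ P)) = θ₁ * x⁻¹ + P.coeff 0 := by
  classical
  have h : restrict (segment ℝ (-1, 0) (0, 0)) (curve θ₁ θ₂ P) =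
      curve θ₁ 0 (Polynomial.C (P.coeff 0)) := by
    have hline : ∀ m : ℤ × ℤ, toReal m ∈ segment ℝ ((-1 : ℝ), (0 : ℝ)) (0, 0) → m.2 = 0 := by
      intro m hm
      have := segment_subset_line (a := 0) (b := 1) (c := 0) (by simp) (by simp) _ hm
      simpa [toReal] using this
    have hle : ∀ m : ℤ × ℤ, toReal m ∈ segment ℝ ((-1 : ℝ), (0 : ℝ)) (0, 0) → m.1 ≤ 0 := by
      intro m hm
      rw [← convexHull_pair] at hm
      have := convexHull_subset_halfSpace (a := 1) (b := 0) (c := 0)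
        (by rintro p (rfl | rfl) <;> simp) _ hm
      simpa [toReal] using this
    ext ⟨i, j⟩
    rw [restrict_coeff]
    split_ifs with hm
    · have hj : j = 0 := hline _ hm
      have hi : i ≤ 0 := hle _ hm
      subst hj
      have h1 : ¬ (i = 1 ∧ (0 : ℤ) = 0) := by omega
      rw [curve_coeff, curve_coeff, if_neg h1, if_neg h1]
      congr 2
      have e1 := toLaurent_coeff_natCast P 0
      have e2 := toLaurent_coeff_natCast (Polynomial.C (P.coeff 0)) 0
      rw [Nat.cast_zero] at e1 e2
      rw [e1, e2, Polynomial.coeff_C_zero]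
    · rw [curve_coeff]
      have h1 : ¬ (i = -1 ∧ j = 0) := by
        rintro ⟨rfl, rfl⟩
        exact hm (by simpa [toReal] using left_mem_segment ℝ ((-1 : ℝ), (0 : ℝ)) (0, 0))
      have h2 : ¬ (i = 0 ∧ j = 0) := by
        rintro ⟨rfl, rfl⟩
        exact hm (by simpa [toReal] using right_mem_segment ℝ ((-1 : ℝ), (0 : ℝ)) (0, 0))
      rw [if_neg h1, ite_self, Polynomial.toLaurent_C, LaurentPolynomial.C_apply]
      by_cases hi : i = 0
      · rw [if_pos hi, if_neg (fun h => h2 ⟨hi, h⟩)]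
        simp
      · simp [hi]
  rw [h, evalAt_curve hx one_ne_zero]
  simp

end Newton

/-! ### Rational curves and Dickson polynomials -/

section Rational

open Polynomial

variable {K : Type*} [Field K] [Algebra ℂ K]

/-- Multiplied by `t ^ ℓ`, the relation becomes a polynomial identity in the transcendental `t`. Its
constant term receives `θ₁ / c` from the first summand and `d ^ ℓ` from the leading term of `P`, and
nothing else. -/
theorem constant_term_of_relation {t : K} (ht : Transcendental ℂ t) {P : ℂ[X]} {ℓ : ℕ} (hℓ : 0 < ℓ)
    (hd : P.natDegree ≤ ℓ) (h1 : P.coeff ℓ = 1) {θ₁ θ₂ c a b d : ℂ} (hc : c ≠ 0)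
    (h : algebraMap ℂ K θ₁ * (algebraMap ℂ K c * t ^ ℓ)⁻¹ +
      algebraMap ℂ K θ₂ * (algebraMap ℂ K c * t ^ ℓ) +
      aeval (algebraMap ℂ K a * t + algebraMap ℂ K b + algebraMap ℂ K d * t⁻¹) P = 0) :
    d ^ ℓ = -θ₁ / c := by
  have ht0 : t ≠ 0 := by
    rintro rfl
    exact ht (isAlgebraic_zero)
  have hcK : algebraMap ℂ K c ≠ 0 := by simpa using hc
  set F : ℂ[X] := C (θ₁ / c) + C (θ₂ * c) * X ^ (2 * ℓ) +
    ∑ j ∈ Finset.range (ℓ + 1), C (P.coeff j) * ((C a * X ^ 2 + C b * X + C d) ^ j * X ^ (ℓ - j))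
    with hF
  have hF0 : aeval t F = 0 := by
    rw [aeval_eq_sum_range' (Nat.lt_succ_of_le hd)] at h
    have h2 := congrArg (fun z => z * t ^ ℓ) h
    simp only [zero_mul, add_mul, Finset.sum_mul] at h2
    rw [← h2, hF]
    simp only [map_add, map_mul, map_sum, map_pow, aeval_X, aeval_C, map_div₀]
    congr 1
    · congr 1
      · field_simp
      · ring
    · refine Finset.sum_congr rfl fun j hj => ?_
      rw [Algebra.smul_def, mul_assoc]
      congr 1
      have hj' : j ≤ ℓ := Nat.lt_succ_iff.1 (Finset.mem_range.1 hj)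
      obtain ⟨k, rfl⟩ := Nat.exists_eq_add_of_le hj'
      rw [Nat.add_sub_cancel_left, pow_add, ← mul_assoc, ← mul_pow]
      congr 2
      field_simp
  have hF1 : F = 0 := by
    by_contra hne
    exact ht ⟨F, hne, hF0⟩
  have h3 := congrArg (Polynomial.eval 0) hF1
  rw [hF, Finset.sum_range_succ] at h3
  have h4 : Polynomial.eval 0 (∑ j ∈ Finset.range ℓ,
      C (P.coeff j) * ((C a * X ^ 2 + C b * X + C d) ^ j * X ^ (ℓ - j))) = 0 := by
    rw [eval_finsetSum]
    refine Finset.sum_eq_zero fun j hj => ?_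
    have : ℓ - j ≠ 0 := by have := Finset.mem_range.1 hj; omega
    simp [this]
  simp only [eval_add, h4] at h3
  simp [h1, hℓ.ne'] at h3
  rw [neg_div]
  linear_combination h3

/-- The expansions at `t = 0` and `t = ∞` determine `d ^ (n + 1)` and `a ^ (n + 1)`. Then the
Dickson polynomial at `y - b = a t + d t⁻¹` equals `P` at `y`. As `y` is transcendental, `P` is a
translate by `b`, and the missing coefficient below the top one forces `b = 0`. -/
theorem eq_dickson_of_relation {t : K} (ht : Transcendental ℂ t) {P : ℂ[X]} {n : ℕ}
    (hd : P.natDegree ≤ n + 1) (h1 : P.coeff (n + 1) = 1) (h0 : P.coeff n = 0) {θ₁ θ₂ c a b d : ℂ}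
    (hc : c ≠ 0) (hytr : Transcendental ℂ
      (algebraMap ℂ K a * t + algebraMap ℂ K b + algebraMap ℂ K d * t⁻¹))
    (h : algebraMap ℂ K θ₁ * (algebraMap ℂ K c * t ^ (n + 1))⁻¹ +
      algebraMap ℂ K θ₂ * (algebraMap ℂ K c * t ^ (n + 1)) +
      aeval (algebraMap ℂ K a * t + algebraMap ℂ K b + algebraMap ℂ K d * t⁻¹) P = 0) :
    (a * d) ^ (n + 1) = θ₁ * θ₂ ∧ P = dickson 1 (a * d) (n + 1) := by
  have ht0 : t ≠ 0 := by
    rintro rfl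
    exact ht (isAlgebraic_zero)
  have hcK : algebraMap ℂ K c ≠ 0 := by simpa using hc
  have hdd := constant_term_of_relation (ℓ := n + 1) ht (Nat.succ_pos n) hd h1 hc h
  -- The relation is symmetric under `t ↔ t⁻¹`, `x ↔ x⁻¹`, which exchanges `θ₁` with `θ₂` and `a`
  -- with `d`.
  have haa := constant_term_of_relation (ℓ := n + 1) (t := t⁻¹) (θ₁ := θ₂) (θ₂ := θ₁) (c := c⁻¹) (a := d) (d := a)
    (b := b) (by rwa [Transcendental, IsAlgebraic.inv_iff])
    (Nat.succ_pos n) hd h1 (inv_ne_zero hc) (by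
      rw [← h]
      simp only [map_inv₀, inv_inv, inv_pow]
      rw [mul_inv, inv_inv, inv_inv, mul_inv,
        show algebraMap ℂ K d * t⁻¹ + algebraMap ℂ K b + algebraMap ℂ K a * t =
          algebraMap ℂ K a * t + algebraMap ℂ K b + algebraMap ℂ K d * t⁻¹ by ring]
      ring)
  have hα : (a * d) ^ (n + 1) = θ₁ * θ₂ := by
    rw [mul_pow, hdd, haa]
    field_simp
  refine ⟨hα, ?_⟩
  set D := dickson 1 (a * d) (n + 1) with hD
  set y := algebraMap ℂ K a * t + algebraMap ℂ K b + algebraMap ℂ K d * t⁻¹ with hy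
  have hy1 : y - algebraMap ℂ K b = algebraMap ℂ K a * t + algebraMap ℂ K d * t⁻¹ := by
    rw [hy]
    ring
  have hval : aeval y (P - D.comp (X - C b)) = 0 := by
    rw [map_sub, aeval_comp, map_sub, aeval_X, aeval_C, hy1, aeval_dickson_add (a * d) _ _ (by
      rw [map_mul]
      field_simp), mul_pow, mul_pow, ← map_pow, ← map_pow, hdd, haa]
    have h5 : aeval y P = -(algebraMap ℂ K θ₁ * (algebraMap ℂ K c * t ^ (n + 1))⁻¹ +
      algebraMap ℂ K θ₂ * (algebraMap ℂ K c * t ^ (n + 1))) := by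
      linear_combination h
    rw [h5]
    simp only [map_div₀, map_neg, map_inv₀, inv_pow]
    field_simp
    ring
  have hPD : P = D.comp (X - C b) := by
    by_contra hne
    exact hytr ⟨_, sub_ne_zero.2 hne, hval⟩
  have hb : b = 0 := by
    have hDd := degree_sub_X_pow_lt (dickson_natDegree_le (a * d) (n + 1))
      (dickson_coeff_self (a * d) (Nat.succ_pos n)) (dickson_coeff_succ (a * d) n)
    rw [← hD] at hDd
    -- Below its leading term the Dickson polynomial has degree less than `n`, so the coefficient of
    -- `X ^ n` in the translate comes only from `(X - b) ^ (n + 1)` and is `-(n + 1) b`.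
    have hE : ((D - X ^ (n + 1)).comp (X - C b)).coeff n = 0 := by
      by_cases hz : D - X ^ (n + 1) = 0
      · rw [hz, zero_comp, coeff_zero]
      · refine coeff_eq_zero_of_natDegree_lt ?_
        rw [natDegree_comp, natDegree_X_sub_C, mul_one]
        exact (natDegree_lt_iff_degree_lt hz).2 hDd
    rw [sub_comp, coeff_sub, ← hPD, h0, X_pow_comp, sub_eq_add_neg X (C b), ← C_neg, coeff_X_add_C_pow] at hE
    simpa [Nat.choose_succ_self_right, Nat.cast_add_one_ne_zero] using hE
  rw [hPD, hb, C_0, sub_zero, comp_X]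

/-- The numerator `Q` of `P(N / D)` is congruent to `N ^ ℓ` modulo `D`, because `P` is monic; so `Q`
is coprime to `D` whenever `N` is. -/
theorem exists_aeval_div_mul_pow {P : ℂ[X]} {ℓ : ℕ} (hd : P.natDegree ≤ ℓ)
    (h1 : P.coeff ℓ = 1) {N D : ℂ[X]} (hD : D ≠ 0) : ∃ Q R : ℂ[X], Q = N ^ ℓ + D * R ∧
      Q.natDegree ≤ ℓ * max N.natDegree D.natDegree ∧
      aeval (algebraMap ℂ[X] (RatFunc ℂ) N / algebraMap ℂ[X] (RatFunc ℂ) D) P *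
        algebraMap ℂ[X] (RatFunc ℂ) D ^ ℓ = algebraMap ℂ[X] (RatFunc ℂ) Q := by
  have hD' : algebraMap ℂ[X] (RatFunc ℂ) D ≠ 0 := RatFunc.algebraMap_ne_zero hD
  refine ⟨∑ j ∈ Finset.range (ℓ + 1), C (P.coeff j) * (N ^ j * D ^ (ℓ - j)),
    ∑ j ∈ Finset.range ℓ, C (P.coeff j) * (N ^ j * D ^ (ℓ - j - 1)), ?_, ?_, ?_⟩
  · rw [Finset.sum_range_succ, h1, Finset.mul_sum, Nat.sub_self, pow_zero, mul_one, C_1, one_mul,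
      add_comm]
    congr 1
    refine Finset.sum_congr rfl fun j hj => ?_
    obtain ⟨k, hk⟩ : ∃ k, ℓ - j = k + 1 := ⟨ℓ - j - 1, by have := Finset.mem_range.1 hj; omega⟩
    rw [hk, Nat.add_sub_cancel]
    ring
  · refine natDegree_sum_le_of_forall_le _ _ fun j hj => ?_
    refine (natDegree_C_mul_le _ _).trans (natDegree_mul_le.trans ?_)
    have hj' : j ≤ ℓ := Nat.lt_succ_iff.1 (Finset.mem_range.1 hj)
    calc (N ^ j).natDegree + (D ^ (ℓ - j)).natDegree
        ≤ j * max N.natDegree D.natDegree + (ℓ - j) * max N.natDegree D.natDegree :=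
          add_le_add (natDegree_pow_le.trans (Nat.mul_le_mul_left _ (le_max_left _ _)))
            (natDegree_pow_le.trans (Nat.mul_le_mul_left _ (le_max_right _ _)))
      _ = ℓ * max N.natDegree D.natDegree := by rw [← add_mul, Nat.add_sub_cancel' hj']
  · rw [aeval_eq_sum_range' (Nat.lt_succ_of_le hd), map_sum, Finset.sum_mul]
    refine Finset.sum_congr rfl fun j hj => ?_
    have hj' : j ≤ ℓ := Nat.lt_succ_iff.1 (Finset.mem_range.1 hj)
    obtain ⟨k, rfl⟩ := Nat.exists_eq_add_of_le hj'
    rw [Nat.add_sub_cancel_left, Algebra.smul_def, map_mul, map_mul, map_pow, map_pow, div_pow,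
      pow_add, RatFunc.algebraMap_C, RatFunc.algebraMap_eq_C]
    field_simp

/-- The equation is quadratic in `x` over `ℂ(y)`, and `x` generates the function field over `ℂ(y)`.
As this degree is the degree of the rational function `y`, it shows that `y` is nonconstant of
degree at most two. -/
theorem finrank_adjoin_le_two {x y : RatFunc ℂ} (hgen : IntermediateField.adjoin ℂ {x, y} = ⊤)
    {θ₁ θ₂ : ℂ} (hθ₂ : θ₂ ≠ 0) {P : ℂ[X]}
    (h : algebraMap ℂ (RatFunc ℂ) θ₁ + algebraMap ℂ (RatFunc ℂ) θ₂ * x ^ 2 + aeval y P * x = 0) :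
    Module.finrank (IntermediateField.adjoin ℂ {y}) (RatFunc ℂ) ≤ 2 ∧
      0 < Module.finrank (IntermediateField.adjoin ℂ {y}) (RatFunc ℂ) := by
  set F := IntermediateField.adjoin ℂ {y} with hF
  set yF : F := ⟨y, IntermediateField.mem_adjoin_simple_self ℂ y⟩ with hyF
  set q : F[X] := C (algebraMap ℂ F θ₁) + C (algebraMap ℂ F θ₂) * X ^ 2 + C (aeval yF P) * X with hq
  have hq2 : q.coeff 2 ≠ 0 := by
    rw [hq]
    simp [hθ₂]
  have hqd : q.natDegree ≤ 2 := by
    rw [hq]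
    compute_degree
  have hq0 : aeval x q = 0 := by
    have h1 : algebraMap F (RatFunc ℂ) (aeval yF P) = aeval y P := by
      rw [← aeval_algebraMap_apply]
      rfl
    rw [← h, hq]
    simp only [map_add, map_mul, aeval_C, aeval_X, map_pow, h1]
    rfl
  have hq_ne : q ≠ 0 := by
    intro h0
    rw [h0] at hq2
    exact hq2 (coeff_zero 2)
  have hint : IsIntegral F x := isAlgebraic_iff_isIntegral.1 ⟨q, hq_ne, hq0⟩
  have htop : IntermediateField.adjoin F {x} = ⊤ := by
    have h2 := IntermediateField.adjoin_simple_adjoin_simple ℂ y x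
    rw [Set.pair_comm, hgen] at h2
    exact IntermediateField.restrictScalars_eq_top_iff.1 h2
  have hfr := IntermediateField.adjoin.finrank hint
  rw [htop, IntermediateField.finrank_top'] at hfr
  rw [hfr]
  exact ⟨(natDegree_le_natDegree (minpoly.degree_le_of_ne_zero F x hq_ne hq0)).trans hqd, minpoly.natDegree_pos hint⟩

theorem exists_eq_C_mul_of_associated {p q : ℂ[X]} (h : Associated p q) :
    ∃ c : ℂ, c ≠ 0 ∧ q = C c * p := by
  obtain ⟨u, rfl⟩ := h
  obtain ⟨c, hc, hu⟩ := Polynomial.isUnit_iff.1 u.isUnit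
  exact ⟨c, hc.ne_zero, by rw [hu, mul_comm]⟩

/-- With `x = A / B` and `y = N / D`, the finite zeros and poles of `x` are the finite poles of `y`.
Algebraically, `A B` is coprime to the bracket and `D ^ ℓ` to `Q`, so `A B` and `D ^ ℓ` divide each
other. Coprime factors of an `ℓ`-th power are `ℓ`-th powers up to units. -/
theorem exists_pow_of_relation {A B N D Q R : ℂ[X]} {ℓ : ℕ} (hℓ : 0 < ℓ) (hAB : IsCoprime A B)
    (hND : IsCoprime N D) {θ₁ θ₂ : ℂ} (hθ₁ : θ₁ ≠ 0) (hθ₂ : θ₂ ≠ 0) (hQ : Q = N ^ ℓ + D * R)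
    (h : (C θ₁ * B ^ 2 + C θ₂ * A ^ 2) * D ^ ℓ + A * B * Q = 0) :
    ∃ (d₁ d₂ : ℂ[X]) (a b d : ℂ), a ≠ 0 ∧ b ≠ 0 ∧ d ≠ 0 ∧ IsCoprime d₁ d₂ ∧ A = C a * d₁ ^ ℓ ∧
      B = C b * d₂ ^ ℓ ∧ D = C d * (d₁ * d₂) := by
  have hu : ∀ {θ : ℂ}, θ ≠ 0 → IsUnit (C θ) := fun hθ => Polynomial.isUnit_C.2 (IsUnit.mk0 _ hθ)
  have hcA : IsCoprime A (C θ₁ * B ^ 2 + C θ₂ * A ^ 2) := by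
    rw [pow_two A, ← mul_assoc, mul_comm _ A]
    exact IsCoprime.add_mul_left_right
      ((isCoprime_mul_unit_left_right (hu hθ₁) _ _).2 hAB.pow_right) _
  have hcB : IsCoprime B (C θ₁ * B ^ 2 + C θ₂ * A ^ 2) := by
    rw [add_comm, pow_two B, ← mul_assoc, mul_comm _ B]
    exact IsCoprime.add_mul_left_right
      ((isCoprime_mul_unit_left_right (hu hθ₂) _ _).2 hAB.symm.pow_right) _
  have hcQ : IsCoprime (D ^ ℓ) Q := by
    rw [hQ]
    exact (IsCoprime.add_mul_left_right hND.symm.pow_right _).pow_left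
  have h1 : A * B ∣ D ^ ℓ := by
    refine (hcA.mul_left hcB).dvd_of_dvd_mul_left (Dvd.intro (-Q) ?_)
    linear_combination -h
  have h2 : D ^ ℓ ∣ A * B := by
    refine hcQ.dvd_of_dvd_mul_right (Dvd.intro (-(C θ₁ * B ^ 2 + C θ₂ * A ^ 2)) ?_)
    linear_combination -h
  have h3 : Associated (D ^ ℓ) (A * B) := associated_of_dvd_dvd h2 h1
  obtain ⟨d₁, hd₁⟩ := exists_associated_pow_of_associated_pow_mul hAB h3
  obtain ⟨d₂, hd₂⟩ := exists_associated_pow_of_associated_pow_mul hAB.symm (mul_comm A B ▸ h3)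
  have h4 : Associated ((d₁ * d₂) ^ ℓ) (D ^ ℓ) := by
    rw [mul_pow]
    exact (hd₁.mul_mul hd₂).trans h3.symm
  have h5 : Associated (d₁ * d₂) D := associated_of_dvd_dvd
    ((UniqueFactorizationMonoid.pow_dvd_pow_iff_dvd hℓ.ne').1 h4.dvd) ((UniqueFactorizationMonoid.pow_dvd_pow_iff_dvd hℓ.ne').1 h4.symm.dvd)
  obtain ⟨a, ha, hA⟩ := exists_eq_C_mul_of_associated hd₁
  obtain ⟨b, hb, hB⟩ := exists_eq_C_mul_of_associated hd₂
  obtain ⟨d, hd, hD⟩ := exists_eq_C_mul_of_associated h5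
  refine ⟨d₁, d₂, a, b, d, ha, hb, hd, ?_, hA, hB, hD⟩
  rw [hA, hB] at hAB
  exact (IsCoprime.pow_iff hℓ hℓ).1
    ((isCoprime_mul_unit_left_left (hu ha) _ _).1
      ((isCoprime_mul_unit_left_right (hu hb) _ _).1 hAB))

/-- Read as binary linear forms, `d₁` and `d₂` are independent, a constant being a form with zero at
infinity. Hence the products of two of them span the quadratic forms. -/
theorem exists_quadratic_combination {d₁ d₂ N : ℂ[X]} (h : IsCoprime d₁ d₂)
    (h₁ : d₁.natDegree ≤ 1) (h₂ : d₂.natDegree ≤ 1) (hne : d₁.natDegree = 0 → d₂.natDegree ≠ 0)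
    (hN : N.natDegree ≤ 2) :
    ∃ a b d : ℂ, N = C a * d₁ ^ 2 + C b * (d₁ * d₂) + C d * d₂ ^ 2 := by
  have e₁ := eq_X_add_C_of_natDegree_le_one h₁
  have e₂ := eq_X_add_C_of_natDegree_le_one h₂
  set p := d₁.coeff 1
  set q := d₁.coeff 0
  set r := d₂.coeff 1
  set s := d₂.coeff 0
  have hdet : p * s - q * r ≠ 0 := by
    intro h0
    have i1 : C r * d₁ = C p * d₂ := by
      rw [e₁, e₂, mul_add, mul_add, ← C_mul, ← C_mul, ← mul_assoc, ← mul_assoc, ← C_mul, ← C_mul,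
        mul_comm r p, mul_comm r q, sub_eq_zero.1 h0]
    by_cases hp : p = 0
    · have hd1 : d₁.natDegree = 0 := by rw [e₁, hp]; simp
      have hr : r ≠ 0 := fun hr => hne hd1 (by rw [e₂, hr]; simp)
      rw [hp, C_0, zero_mul] at i1
      have hd : d₁ = 0 := (mul_eq_zero.1 i1).resolve_left (C_ne_zero.2 hr)
      rw [hd, isCoprime_zero_left] at h
      exact hne hd1 (natDegree_eq_zero_of_isUnit h)
    · have hdvd : d₁ ∣ d₂ :=
        (Polynomial.isUnit_C.2 (IsUnit.mk0 _ hp)).dvd_mul_left.1 (Dvd.intro_left _ i1)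
      have hu := h.isUnit_of_dvd' dvd_rfl hdvd
      have hd1 := natDegree_eq_zero_of_isUnit hu
      rw [e₁] at hd1
      have := natDegree_linear (b := q) hp
      omega
  have eN : N = C (N.coeff 2) * X ^ 2 + C (N.coeff 1) * X + C (N.coeff 0) := by
    conv_lhs => rw [N.as_sum_range' 3 (by omega)]
    simp only [Finset.sum_range_succ, Finset.sum_range_zero, zero_add, ← C_mul_X_pow_eq_monomial,
      pow_zero, pow_one, mul_one]
    ring
  set δ := p * s - q * r with hδ
  -- Cramer's rule expresses the two basic linear forms `X` and `1` by `d₁` and `d₂`; substitution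
  -- into `N`, written as a quadratic form in `X` and `1`, gives the coefficients.
  have eX : X = C (s / δ) * d₁ - C (q / δ) * d₂ := by
    have : C (s / δ) * d₁ - C (q / δ) * d₂ = C (s / δ * p - q / δ * r) * X +
        C (s / δ * q - q / δ * s) := by
      rw [e₁, e₂]
      simp only [map_sub, map_mul]
      ring
    rw [this, show s / δ * p - q / δ * r = 1 by field_simp; linear_combination hδ,
      show s / δ * q - q / δ * s = 0 by ring]
    simp
  have e1 : 1 = C (p / δ) * d₂ - C (r / δ) * d₁ := by
    have : C (p / δ) * d₂ - C (r / δ) * d₁ = C (p / δ * r - r / δ * p) * X +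
        C (p / δ * s - r / δ * q) := by
      rw [e₁, e₂]
      simp only [map_sub, map_mul]
      ring
    rw [this, show p / δ * s - r / δ * q = 1 by field_simp; linear_combination hδ,
      show p / δ * r - r / δ * p = 0 by ring]
    simp
  clear_value p q r s δ
  refine ⟨N.coeff 2 * (s / δ) ^ 2 - N.coeff 1 * (s / δ) * (r / δ) + N.coeff 0 * (r / δ) ^ 2,
    -2 * N.coeff 2 * (s / δ) * (q / δ) + N.coeff 1 * (s / δ * (p / δ) + q / δ * (r / δ))
      - 2 * N.coeff 0 * (p / δ) * (r / δ),
    N.coeff 2 * (q / δ) ^ 2 - N.coeff 1 * (q / δ) * (p / δ) + N.coeff 0 * (p / δ) ^ 2, ?_⟩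
  have eN' : N = C (N.coeff 2) * (C (s / δ) * d₁ - C (q / δ) * d₂) ^ 2 +
      C (N.coeff 1) * (C (s / δ) * d₁ - C (q / δ) * d₂) * (C (p / δ) * d₂ - C (r / δ) * d₁) +
      C (N.coeff 0) * (C (p / δ) * d₂ - C (r / δ) * d₁) ^ 2 := by
    rw [← eX, ← e1]
    simpa using eN
  refine eN'.trans ?_
  have h2 : (2 : ℂ[X]) = C 2 := rfl
  simp only [map_sub, map_add, map_mul, map_pow, map_neg, ← h2]
  ring

/-- Equal degrees are at most one, since they sum to at most two. If the degrees differ, the terms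
in `A ^ 2` and `B ^ 2` cannot cancel at the top. Comparison of degrees gives `2 max (deg A, deg B) =
deg Q ≤ 2 ℓ`, which excludes the distribution `2 + 0`. -/
theorem natDegree_le_one_of_relation {d₁ d₂ D A B Q : ℂ[X]} {a b d θ₁ θ₂ : ℂ} {ℓ : ℕ} (hℓ : 0 < ℓ)
    (ha : a ≠ 0) (hb : b ≠ 0) (hd : d ≠ 0) (hθ₁ : θ₁ ≠ 0) (hθ₂ : θ₂ ≠ 0) (hA0 : A ≠ 0) (hB0 : B ≠ 0)
    (hD0 : D ≠ 0) (hA : A = C a * d₁ ^ ℓ) (hB : B = C b * d₂ ^ ℓ) (hD : D = C d * (d₁ * d₂))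
    (hDd : D.natDegree ≤ 2) (hQ : Q.natDegree ≤ ℓ * 2)
    (h : (C θ₁ * B ^ 2 + C θ₂ * A ^ 2) * D ^ ℓ + A * B * Q = 0) :
    d₁.natDegree ≤ 1 ∧ d₂.natDegree ≤ 1 := by
  have h1 : d₁ ≠ 0 := by
    rintro rfl
    simp [hD] at hD0
  have h2 : d₂ ≠ 0 := by
    rintro rfl
    simp [hD] at hD0
  have eA : A.natDegree = ℓ * d₁.natDegree := by
    rw [hA, natDegree_C_mul ha, natDegree_pow]
  have eB : B.natDegree = ℓ * d₂.natDegree := by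
    rw [hB, natDegree_C_mul hb, natDegree_pow]
  have eD : D.natDegree = d₁.natDegree + d₂.natDegree := by
    rw [hD, natDegree_C_mul hd, natDegree_mul h1 h2]
  by_cases heq : d₁.natDegree = d₂.natDegree
  · omega
  have hne : A.natDegree ≠ B.natDegree := by
    rw [eA, eB]
    exact fun h => heq (Nat.eq_of_mul_eq_mul_left hℓ h)
  have eB2 : (C θ₁ * B ^ 2).natDegree = 2 * B.natDegree := by
    rw [natDegree_C_mul hθ₁, natDegree_pow]
  have eA2 : (C θ₂ * A ^ 2).natDegree = 2 * A.natDegree := by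
    rw [natDegree_C_mul hθ₂, natDegree_pow]
  have eS : (C θ₁ * B ^ 2 + C θ₂ * A ^ 2).natDegree = 2 * max A.natDegree B.natDegree := by
    rcases lt_or_gt_of_ne hne with hlt | hlt
    · rw [natDegree_add_eq_left_of_natDegree_lt (by omega), eB2, max_eq_right hlt.le]
    · rw [natDegree_add_eq_right_of_natDegree_lt (by omega), eA2, max_eq_left hlt.le]
  have hS0 : C θ₁ * B ^ 2 + C θ₂ * A ^ 2 ≠ 0 := by
    intro h0
    rw [h0, natDegree_zero] at eS
    omega
  have hQ0 : Q ≠ 0 := by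
    rintro rfl
    rw [mul_zero, add_zero] at h
    exact (mul_ne_zero hS0 (pow_ne_zero _ hD0)) h
  have hdeg := congrArg natDegree (eq_neg_of_add_eq_zero_left h)
  rw [natDegree_neg, natDegree_mul hS0 (pow_ne_zero _ hD0), natDegree_mul (mul_ne_zero hA0 hB0) hQ0,
    natDegree_mul hA0 hB0, natDegree_pow, eD, mul_add, ← eA, ← eB, eS] at hdeg
  have hmax : max A.natDegree B.natDegree ≤ ℓ * 1 := by omega
  exact ⟨Nat.le_of_mul_le_mul_left (eA ▸ (le_max_left _ _).trans hmax) hℓ,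
    Nat.le_of_mul_le_mul_left (eB ▸ (le_max_right _ _).trans hmax) hℓ⟩

/-- Since `y` has degree at most two and its poles are the zero and the pole of `x`, the coordinate
`t = d₁ / d₂` gives `x = c t ^ (n + 1)` and `y = a t + b + d t⁻¹`. Then `eq_dickson_of_relation`
applies. -/
theorem Parametrizes.eq_dickson {φ : TorusMap} {θ₁ θ₂ : ℂ} (hθ₁ : θ₁ ≠ 0) (hθ₂ : θ₂ ≠ 0)
    {P : ℂ[X]} {n : ℕ} (hd : P.natDegree ≤ n + 1) (h1 : P.coeff (n + 1) = 1) (h0 : P.coeff n = 0)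
    (h : Parametrizes φ (curve θ₁ θ₂ P)) :
    ∃ α, α ^ (n + 1) = θ₁ * θ₂ ∧ P = dickson 1 α (n + 1) := by
  obtain ⟨⟨-, hev⟩, hgen⟩ := h
  obtain ⟨x, y, hx, hy⟩ := φ
  simp only at hev hgen
  rw [evalAt_curve hx hy] at hev
  have hrel : algebraMap ℂ (RatFunc ℂ) θ₁ + algebraMap ℂ (RatFunc ℂ) θ₂ * x ^ 2 +
      aeval y P * x = 0 := by
    have := congrArg (· * x) hev
    simp only [zero_mul] at this
    rw [← this]
    field_simp
  obtain ⟨hm2, hm0⟩ := finrank_adjoin_le_two hgen hθ₂ hrel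
  rw [RatFunc.finrank_eq_max_natDegree] at hm2 hm0
  have hytr : Transcendental ℂ y := by
    refine RatFunc.transcendental_of_ne_C _ ?_
    rintro ⟨c, rfl⟩
    simp at hm0
  set A := x.num with hAdef
  set B := x.denom with hBdef
  set N := y.num with hNdef
  set D := y.denom with hDdef
  have hA0 : A ≠ 0 := RatFunc.num_ne_zero hx
  have hB0 : B ≠ 0 := x.denom_ne_zero
  have hD0 : D ≠ 0 := y.denom_ne_zero
  have exAB : algebraMap ℂ[X] (RatFunc ℂ) A / algebraMap ℂ[X] (RatFunc ℂ) B = x :=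
    RatFunc.num_div_denom x
  have eyND : algebraMap ℂ[X] (RatFunc ℂ) N / algebraMap ℂ[X] (RatFunc ℂ) D = y :=
    RatFunc.num_div_denom y
  have hA' := RatFunc.algebraMap_ne_zero hA0
  have hB' := RatFunc.algebraMap_ne_zero hB0
  have hD' := RatFunc.algebraMap_ne_zero hD0
  obtain ⟨Q, R, hQ, hQd, hQe⟩ := exists_aeval_div_mul_pow hd h1 (N := N) hD0
  rw [eyND] at hQe
  have hpoly : (C θ₁ * B ^ 2 + C θ₂ * A ^ 2) * D ^ (n + 1) + A * B * Q = 0 := by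
    apply RatFunc.algebraMap_injective ℂ
    simp only [map_add, map_mul, map_pow, map_zero, ← hQe, RatFunc.algebraMap_C,
      ← RatFunc.algebraMap_eq_C]
    rw [← exAB] at hrel
    field_simp at hrel
    linear_combination algebraMap ℂ[X] (RatFunc ℂ) D ^ (n + 1) * hrel
  obtain ⟨d₁, d₂, a, b, d, ha, hb, hdne, hcop, eA, eB, eD⟩ := exists_pow_of_relation
    (A := A) (B := B) (N := N) (D := D) (ℓ := n + 1) (Nat.succ_pos n)
    (RatFunc.isCoprime_num_denom x) (RatFunc.isCoprime_num_denom y) hθ₁ hθ₂ hQ hpoly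
  obtain ⟨hd1, hd2⟩ := natDegree_le_one_of_relation (Nat.succ_pos n) ha hb hdne hθ₁ hθ₂ hA0 hB0 hD0
    eA eB eD (le_of_max_le_right hm2) (hQd.trans (Nat.mul_le_mul_left _ hm2)) hpoly
  have h10 : d₁ ≠ 0 := by
    rintro rfl
    simp [eD] at hD0
  have h20 : d₂ ≠ 0 := by
    rintro rfl
    simp [eD] at hD0
  -- If both were constant, `x` would be constant, and the equation of the curve would be a
  -- nontrivial algebraic relation for `y`.
  have hne : d₁.natDegree = 0 → d₂.natDegree ≠ 0 := by
    intro e1 e2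
    obtain ⟨c, rfl⟩ : ∃ c, x = RatFunc.C c := by
      rw [RatFunc.eq_C_iff, ← hAdef, ← hBdef, eA, eB]
      simp [natDegree_C_mul ha, natDegree_C_mul hb, natDegree_pow, e1, e2]
    refine hytr ⟨P + C (θ₁ * c⁻¹ + θ₂ * c), ?_, ?_⟩
    · intro hz
      have := congrArg (fun p : ℂ[X] => p.coeff (n + 1)) hz
      simp [h1] at this
    · rw [← hev, map_add, aeval_C]
      simp only [map_add, map_mul, map_inv₀, RatFunc.algebraMap_eq_C]
      ring
  obtain ⟨p, q, r, hN⟩ := exists_quadratic_combination hcop hd1 hd2 hne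
    ((le_of_max_le_left hm2) : N.natDegree ≤ 2)
  have h1' := RatFunc.algebraMap_ne_zero h10
  have h2' := RatFunc.algebraMap_ne_zero h20
  have hac : ∀ {c : ℂ}, c ≠ 0 → algebraMap ℂ (RatFunc ℂ) c ≠ 0 := fun hc => by simpa using hc
  set t : RatFunc ℂ := algebraMap ℂ[X] (RatFunc ℂ) d₁ / algebraMap ℂ[X] (RatFunc ℂ) d₂ with ht
  have ext : x = algebraMap ℂ (RatFunc ℂ) (a / b) * t ^ (n + 1) := by
    rw [← exAB, eA, eB, ht]
    simp only [map_mul, map_pow, RatFunc.algebraMap_C, ← RatFunc.algebraMap_eq_C, map_div₀, div_pow]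
    have := hac hb
    field_simp
  have eyt : y = algebraMap ℂ (RatFunc ℂ) (p / d) * t + algebraMap ℂ (RatFunc ℂ) (q / d) +
      algebraMap ℂ (RatFunc ℂ) (r / d) * t⁻¹ := by
    rw [← eyND, hN, eD, ht]
    simp only [map_mul, map_pow, map_add, RatFunc.algebraMap_C, ← RatFunc.algebraMap_eq_C, map_div₀]
    have := hac hdne
    field_simp
  have httr : Transcendental ℂ t := by
    intro halg
    refine hytr ?_
    rw [eyt]
    exact (((isAlgebraic_algebraMap _).mul halg).add (isAlgebraic_algebraMap _)).add
      ((isAlgebraic_algebraMap _).mul halg.inv)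
  rw [ext, eyt] at hev
  rw [eyt] at hytr
  exact ⟨_, eq_dickson_of_relation httr hd h1 h0 (div_ne_zero ha hb) hytr hev⟩

end Rational

/-! ### Parametrizations of modification curves -/

section Parametrizations

open Polynomial LaurentPolynomial

theorem theta_X (ε : ℤ) : theta ε Polynomial.X = AddMonoidAlgebra.single (ε, 0) 1 := by
  rw [Polynomial.X, ← LaurentPolynomial.T_zero, T, theta_monomial]
  simp

theorem irreducible_of_associated_theta {K : Type*} [Field K] [Algebra ℂ K] {ε : ℤ}
    (hε : ε = 1 ∨ ε = -1) {x y : K} (hx : x ≠ 0)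
    (hy : y ≠ 0) (htr : Transcendental ℂ y) {p : ℂ[T;T⁻¹][X]} (hp : p.Monic)
    {ι : Type*} [Fintype ι] (σ : ι → K →ₐ[ℂ] K) (hσy : ∀ i, σ i y = y)
    (hσx : Function.Injective fun i => σ i x) (hcard : p.natDegree ≤ Fintype.card ι) {f : Laurent}
    (hf : Associated (theta ε p) f) (hf0 : evalAt x y f = 0) : Irreducible f := by
  have hp0 : evalAt x y (theta ε p) = 0 := by
    obtain ⟨c, hc⟩ := hf.symm.dvd
    rw [hc, ← evalHom_apply x y hx hy, map_mul, evalHom_apply, hf0, zero_mul]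
  refine hf.irreducible (irreducible_of_generates_kernel hx hy ?_ hp0
    (theta_dvd_of_evalAt_eq_zero hε hx hy (yEval_injective hy htr) hp σ hσy hσx hcard hp0))
  rw [← map_zero (theta ε)]
  exact (theta_injective hε).ne hp.ne_zero

theorem yHom_toLaurent_C (c : ℂ) :
    yHom (toLaurent (Polynomial.C c)) = AddMonoidAlgebra.single (0, 0) c := by
  rw [Polynomial.toLaurent_C, ← mul_one (LaurentPolynomial.C c), ← LaurentPolynomial.T_zero,
    ← LaurentPolynomial.single_eq_C_mul_T, yHom_single]

/-- The Laurent polynomial `θ * x ^ ε + P(y)`. -/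
def sideCurve (ε : ℤ) (θ : ℂ) (P : ℂ[X]) : Laurent :=
  AddMonoidAlgebra.single (ε, 0) θ + yHom (toLaurent P)

theorem curve_zero_right (θ : ℂ) (P : ℂ[X]) : curve θ 0 P = sideCurve (-1) θ P := by
  simp [curve, sideCurve]

theorem curve_zero_left (θ : ℂ) (P : ℂ[X]) : curve 0 θ P = sideCurve 1 θ P := by
  simp [curve, sideCurve]

theorem evalAt_sideCurve {K : Type*} [Field K] [Algebra ℂ K] {x y : K} (hx : x ≠ 0) (hy : y ≠ 0)
    (ε : ℤ) (θ : ℂ) (P : ℂ[X]) :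
    evalAt x y (sideCurve ε θ P) = algebraMap ℂ K θ * x ^ ε + aeval y P := by
  rw [← evalHom_apply x y hx hy, sideCurve, map_add, evalHom_single, evalHom_apply,
    evalAt_yHom x y hx hy, yEval_toLaurent]
  simp [monom]

/-- The equation is linear in `x ^ ε` up to a unit, so the identity is all that is needed as a
family of automorphisms. -/
theorem irreducible_sideCurve {K : Type*} [Field K] [Algebra ℂ K] {ε : ℤ}
    (hε : ε = 1 ∨ ε = -1) {θ : ℂ} (hθ : θ ≠ 0) {P : ℂ[X]} {x y : K} (hx : x ≠ 0) (hy : y ≠ 0)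
    (htr : Transcendental ℂ y) (h0 : evalAt x y (sideCurve ε θ P) = 0) :
    Irreducible (sideCurve ε θ P) := by
  have hass : Associated (theta ε (Polynomial.X +
      Polynomial.C (toLaurent (Polynomial.C θ⁻¹ * P)))) (sideCurve ε θ P) := by
    have h1 : sideCurve ε θ P = AddMonoidAlgebra.single (0, 0) θ *
        theta ε (Polynomial.X + Polynomial.C (toLaurent (Polynomial.C θ⁻¹ * P))) := by
      rw [map_add, theta_X, theta_C, map_mul, map_mul, yHom_toLaurent_C, mul_add, ← mul_assoc,
        AddMonoidAlgebra.single_mul_single, AddMonoidAlgebra.single_mul_single,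
        mul_inv_cancel₀ hθ, sideCurve]
      congr 1
      · simp
      · exact (one_mul _).symm
    rw [h1]
    exact (associated_unit_mul_left _ _ (isUnit_single _ hθ)).symm
  refine irreducible_of_associated_theta hε hx hy htr (monic_X_add_C _)
    (fun _ : Unit => AlgHom.id ℂ K) (fun _ => rfl) (fun _ _ _ => rfl) ?_ hass h0
  rw [natDegree_X_add_C, Fintype.card_unit]

/-- Multiplication by `θ₂⁻¹ x` turns the equation into a monic quadratic in `x`, and `x`, `τ x` are
two different roots over the same `y`. -/
theorem irreducible_curve {K : Type*} [Field K] [Algebra ℂ K] {θ₁ θ₂ : ℂ} (hθ₂ : θ₂ ≠ 0) {P : ℂ[X]}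
    {x y : K} (hx : x ≠ 0) (hy : y ≠ 0) (htr : Transcendental ℂ y) (τ : K →ₐ[ℂ] K) (hτy : τ y = y)
    (hτx : τ x ≠ x) (h0 : evalAt x y (curve θ₁ θ₂ P) = 0) : Irreducible (curve θ₁ θ₂ P) := by
  set p : ℂ[T;T⁻¹][X] := Polynomial.X ^ 2 +
    (Polynomial.C (toLaurent (Polynomial.C θ₂⁻¹ * P)) * Polynomial.X +
      Polynomial.C (toLaurent (Polynomial.C (θ₂⁻¹ * θ₁)))) with hp
  have hdeg : (Polynomial.C (toLaurent (Polynomial.C θ₂⁻¹ * P)) * Polynomial.X +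
      Polynomial.C (toLaurent (Polynomial.C (θ₂⁻¹ * θ₁)))).degree < ((2 : ℕ) : WithBot ℕ) :=
    degree_linear_lt
  have hass : Associated (theta 1 p) (curve θ₁ θ₂ P) := by
    have h1 : curve θ₁ θ₂ P = AddMonoidAlgebra.single (-1, 0) θ₂ * theta 1 p := by
      rw [hp, map_add, map_add, map_mul, map_pow, theta_X, theta_C, theta_C, map_mul, map_mul,
        yHom_toLaurent_C, yHom_toLaurent_C, mul_add, mul_add, AddMonoidAlgebra.single_mul_single,
        pow_two, AddMonoidAlgebra.single_mul_single, AddMonoidAlgebra.single_mul_single,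
        mul_right_comm, ← mul_assoc, ← mul_assoc, AddMonoidAlgebra.single_mul_single,
        AddMonoidAlgebra.single_mul_single, mul_inv_cancel_left₀ hθ₂, mul_one, curve]
      have h2 : (AddMonoidAlgebra.single ((-1, 0) + ((0, 0) + (1, 0))) 1 : Laurent) = 1 := rfl
      rw [h2, one_mul]
      simp only [Prod.mk_add_mk]
      rw [mul_inv_cancel_left₀ hθ₂]
      norm_num
      abel
    rw [h1]
    exact (associated_unit_mul_left _ _ (isUnit_single _ hθ₂)).symm
  refine irreducible_of_associated_theta (Or.inl rfl) hx hy htr (monic_X_pow_add hdeg)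
    (fun b : Bool => cond b τ (AlgHom.id ℂ K)) ?_ ?_ ?_ hass h0
  · rintro (_ | _)
    · rfl
    · exact hτy
  · rintro (_ | _) (_ | _) h
    · rfl
    · exact absurd h.symm hτx
    · exact absurd h hτx
    · rfl
  · rw [Fintype.card_bool]
    exact natDegree_add_le_of_degree_le (natDegree_X_pow_le 2) (natDegree_le_of_degree_le hdeg.le)

/-- Both `s` and `s'` are roots of the quadratic `Z ^ 2 - (s + s') Z + α` over `E`, so their powers
reduce to linear expressions with common coefficients. This recovers `s` from `s ^ n` and `s + s'`.
-/
theorem exists_linear_combination_pow {K : Type*} [Field K] [Algebra ℂ K]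
    {E : IntermediateField ℂ K} {s s' : K} {α : ℂ} (hss : s * s' = algebraMap ℂ K α)
    (hE : s + s' ∈ E) (n : ℕ) :
    ∃ a ∈ E, ∃ b ∈ E, s ^ n = a * s + b ∧ s' ^ n = a * s' + b := by
  induction n with
  | zero => exact ⟨0, E.zero_mem, 1, E.one_mem, by simp, by simp⟩
  | succ n ih =>
    obtain ⟨a, ha, b, hb, h1, h2⟩ := ih
    refine ⟨a * (s + s') + b, E.add_mem (E.mul_mem ha hE) hb, -(a * algebraMap ℂ K α),
      E.neg_mem (E.mul_mem ha (E.algebraMap_mem α)), ?_, ?_⟩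
    · rw [pow_succ, h1, ← hss]
      ring
    · rw [pow_succ, h2, ← hss]
      ring

/-- The parametrization is `x = -θ₂⁻¹ s ^ n`, `y = s + α s⁻¹`: then `θ₂ x = -s ^ n` and, by the
choice of `α`, `θ₁ x⁻¹ = -(α s⁻¹) ^ n`. The involution `s ↔ α s⁻¹` fixes `y` and moves `x`, which
gives irreducibility. -/
theorem isRationalCurve_dickson {θ₁ θ₂ α : ℂ} (hθ₁ : θ₁ ≠ 0) (hθ₂ : θ₂ ≠ 0) {n : ℕ} (hn : 0 < n)
    (hα : α ^ n = θ₁ * θ₂) : IsRationalCurve (curve θ₁ θ₂ (dickson 1 α n)) := by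
  have hα0 : α ≠ 0 := by
    rintro rfl
    rw [zero_pow hn.ne'] at hα
    exact mul_ne_zero hθ₁ hθ₂ hα.symm
  set s : RatFunc ℂ := RatFunc.X with hs
  have hs0 : s ≠ 0 := RatFunc.X_ne_zero
  set s' : RatFunc ℂ := algebraMap ℂ (RatFunc ℂ) α * s⁻¹ with hs'
  have hss : s * s' = algebraMap ℂ (RatFunc ℂ) α := by
    rw [hs']
    field_simp
  have hs'0 : s' ≠ 0 := by
    intro h
    rw [h, mul_zero] at hss
    exact hα0 (by simpa using hss.symm)
  have hdeg : s'.intDegree ≠ 0 := by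
    rw [hs', RatFunc.algebraMap_eq_C, RatFunc.intDegree_mul (by simpa using hα0) (inv_ne_zero hs0),
      RatFunc.intDegree_C, RatFunc.intDegree_inv, RatFunc.intDegree_X]
    norm_num
  have htr' : Transcendental ℂ s' := transcendental_of_intDegree_ne_zero hdeg
  have htr : Transcendental ℂ (s + s') := by
    refine RatFunc.transcendental_of_ne_C _ ?_
    rintro ⟨c, hc⟩
    refine RatFunc.transcendental_X (K := ℂ) ⟨Polynomial.X ^ 2 - Polynomial.C c * Polynomial.X + Polynomial.C α, ?_, ?_⟩
    · intro h
      have := congrArg (fun p : ℂ[X] => p.coeff 2) h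
      simp at this
    · rw [← RatFunc.algebraMap_eq_C] at hc
      simp only [map_add, map_sub, map_pow, map_mul, aeval_X, Polynomial.aeval_C, ← hc, ← hss, ← hs]
      ring
  have hy0 : s + s' ≠ 0 := fun h => htr (h ▸ isAlgebraic_zero)
  have hpow : s' ^ n ≠ s ^ n := by
    intro h
    have h1 : s ^ (2 * n) = algebraMap ℂ (RatFunc ℂ) (α ^ n) := by
      rw [two_mul, pow_add, map_pow, ← hss, mul_pow, h]
    refine RatFunc.transcendental_X (K := ℂ) (IsAlgebraic.of_pow (n := 2 * n) (by omega) ?_)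
    rw [← hs, h1]
    exact isAlgebraic_algebraMap _
  set x : RatFunc ℂ := algebraMap ℂ (RatFunc ℂ) (-θ₂⁻¹) * s ^ n with hx
  have hx0 : x ≠ 0 := mul_ne_zero (by simpa using hθ₂) (pow_ne_zero _ hs0)
  have hev : evalAt x (s + s') (curve θ₁ θ₂ (dickson 1 α n)) = 0 := by
    rw [evalAt_curve hx0 hy0, aeval_dickson_add α s s' hss, hx]
    have h3 : s' ^ n = algebraMap ℂ (RatFunc ℂ) (θ₁ * θ₂) * (s ^ n)⁻¹ := by
      rw [eq_mul_inv_iff_mul_eq₀ (pow_ne_zero _ hs0), ← mul_pow, mul_comm s' s, hss, ← map_pow, hα]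
    rw [h3]
    have : algebraMap ℂ (RatFunc ℂ) θ₂ ≠ 0 := by simpa using hθ₂
    simp only [map_neg, map_inv₀, map_mul]
    field_simp
    ring
  have hτX := substHom_X s' htr'
  have hτs : substHom s' htr' s' = s := by
    conv_lhs => arg 2; rw [hs']
    rw [map_mul, map_inv₀, hτX, AlgHom.commutes, ← hss]
    field_simp
  refine ⟨⟨x, s + s', hx0, hy0⟩, ⟨irreducible_curve hθ₂ hx0 hy0 htr (substHom s' htr') ?_ ?_ hev,
    hev⟩, ?_⟩
  · rw [map_add, hτs, hs, hτX, add_comm]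
  · rw [hx, map_mul, map_pow, hs, hτX, AlgHom.commutes, ← hs]
    exact fun h => hpow (mul_left_cancel₀ (by simpa using hθ₂) h)
  · set E := IntermediateField.adjoin ℂ ({x, s + s'} : Set (RatFunc ℂ)) with hE
    have hxE : x ∈ E := IntermediateField.subset_adjoin _ _ (by simp)
    have hyE : s + s' ∈ E := IntermediateField.subset_adjoin _ _ (by simp)
    obtain ⟨a, ha, b, hb, h1, h2⟩ := exists_linear_combination_pow hss hyE n
    have ha0 : a ≠ 0 := by
      rintro rfl
      rw [zero_mul] at h1 h2
      exact hpow (h2.trans h1.symm)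
    have hsE : s ∈ E := by
      have e1 : s = (algebraMap ℂ (RatFunc ℂ) (-θ₂) * x - b) / a := by
        rw [eq_div_iff ha0, hx, ← mul_assoc, ← map_mul, neg_mul_neg, mul_inv_cancel₀ hθ₂, map_one,
          one_mul, h1]
        ring
      rw [e1]
      exact E.div_mem (E.sub_mem (E.mul_mem (E.algebraMap_mem _) hxE) hb) ha
    rw [eq_top_iff, ← RatFunc.adjoin_X (K := ℂ)]
    exact IntermediateField.adjoin_simple_le_iff.2 hsE

/-! ### Peripherally unibranch curves -/

theorem exists_ordAt_pos {f : RatFunc ℂ} (hf : ∀ c, f ≠ RatFunc.C c) : ∃ p, 0 < ordAt f p := by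
  have hf0 : f ≠ 0 := by simpa using hf 0
  by_cases hN : f.num.natDegree = 0
  · have hD : f.denom.natDegree ≠ 0 := fun hD => by
      obtain ⟨c, hc⟩ := (RatFunc.eq_C_iff f).2 ⟨hN, hD⟩
      exact hf c hc
    refine ⟨OnePoint.infty, ?_⟩
    rw [ordAt_infty, RatFunc.intDegree, hN]
    have := Nat.pos_of_ne_zero hD
    simpa using hD.bot_lt
  · have hdeg : f.num.degree ≠ 0 := fun h => hN (natDegree_eq_of_degree_eq_some h)
    obtain ⟨a, ha⟩ := IsAlgClosed.exists_root f.num hdeg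
    refine ⟨(a : OnePoint ℂ), ?_⟩
    have h1 : 0 < f.num.rootMultiplicity a :=
      (rootMultiplicity_pos (RatFunc.num_ne_zero hf0)).2 ha
    have h2 : f.denom.rootMultiplicity a = 0 := by
      refine rootMultiplicity_eq_zero fun h => ?_
      obtain ⟨u, v, huv⟩ := RatFunc.isCoprime_num_denom f
      have := congrArg (Polynomial.eval a) huv
      rw [eval_add, eval_mul, eval_mul, ha.eq_zero, h.eq_zero] at this
      simp at this
    rw [ordAt_coe, h2]
    simpa using h1

theorem ordAt_add_C {f : RatFunc ℂ} {p : OnePoint ℂ} (hf0 : f ≠ 0) (hf : 0 < ordAt f p) {c : ℂ}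
    (hc : c ≠ 0) : ordAt (f + RatFunc.C c) p = 0 := by
  have hD := f.denom_ne_zero
  have hD' := RatFunc.algebraMap_ne_zero hD
  have hfe : f + RatFunc.C c = algebraMap ℂ[X] (RatFunc ℂ) (f.num + Polynomial.C c * f.denom) /
      algebraMap ℂ[X] (RatFunc ℂ) f.denom := by
    rw [map_add, map_mul, RatFunc.algebraMap_C, add_div, RatFunc.num_div_denom,
      mul_div_cancel_right₀ _ hD']
  induction p using OnePoint.rec with
  | infty =>
    rw [ordAt_infty, RatFunc.intDegree] at hf
    have hlt : f.num.natDegree < (Polynomial.C c * f.denom).natDegree := by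
      rw [natDegree_C_mul hc]
      omega
    have hN : (f.num + Polynomial.C c * f.denom).natDegree = f.denom.natDegree := by
      rw [natDegree_add_eq_right_of_natDegree_lt hlt, natDegree_C_mul hc]
    have hN0 : f.num + Polynomial.C c * f.denom ≠ 0 := by
      intro h
      rw [natDegree_C_mul hc, ← hN, h, natDegree_zero] at hlt
      exact absurd hlt (Nat.not_lt_zero _)
    rw [hfe, ordAt_div (RatFunc.algebraMap_ne_zero hN0) hD', ordAt_infty, ordAt_infty,
      RatFunc.intDegree_polynomial, RatFunc.intDegree_polynomial, hN, sub_self]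
  | coe a =>
    have h1 := denom_eval_ne_zero hf.le
    have h2 : f.num.eval a = 0 := by
      rw [ordAt_coe] at hf
      have : 0 < f.num.rootMultiplicity a := by omega
      exact (rootMultiplicity_pos (RatFunc.num_ne_zero hf0)).1 this
    have h3 : (f.num + Polynomial.C c * f.denom).eval a ≠ 0 := by
      rw [eval_add, eval_mul, eval_C, h2, zero_add]
      exact mul_ne_zero hc h1
    rw [ordAt_coe_of_div (fun h => h3 (by rw [h, eval_zero])) hD hfe, rootMultiplicity_eq_zero h3,
      rootMultiplicity_eq_zero h1, sub_self]

theorem ordAt_multiset_prod (s : Multiset (RatFunc ℂ)) (hs : ∀ f ∈ s, f ≠ 0) (p : OnePoint ℂ) :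
    ordAt s.prod p = (s.map fun f => ordAt f p).sum := by
  induction s using Multiset.induction_on with
  | empty => simp [ordAt_one]
  | cons f s ih =>
    have hs' : ∀ g ∈ s, g ≠ 0 := fun g hg => hs g (Multiset.mem_cons_of_mem hg)
    rw [Multiset.prod_cons, Multiset.map_cons, Multiset.sum_cons, ← ih hs',
      ordAt_mul (hs f (Multiset.mem_cons_self f s)) (Multiset.prod_ne_zero fun h => hs' 0 h rfl)]

/-- Among the linear factors of `P(y)` the one of the root `r` vanishes at `p`, and none of the
others has a pole there. -/
theorem ordAt_aeval_pos {P : ℂ[X]} (hP : P.Monic) {y : RatFunc ℂ} (hy : ∀ c, y ≠ RatFunc.C c)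
    {r : ℂ} (hr : P.IsRoot r) {p : OnePoint ℂ} (hp : 0 < ordAt (y - RatFunc.C r) p) :
    0 < ordAt (aeval y P) p := by
  have hne : ∀ c, y - RatFunc.C c ≠ 0 := fun c => sub_ne_zero.2 (hy c)
  have hs := (IsAlgClosed.splits P).eq_prod_roots_of_monic hP
  have hev : aeval y P = (P.roots.map fun s => y - RatFunc.C s).prod := by
    conv_lhs => rw [hs]
    rw [map_multiset_prod, Multiset.map_map]
    simp [RatFunc.algebraMap_eq_C]
  have hord : ∀ s, 0 ≤ ordAt (y - RatFunc.C s) p := by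
    intro s
    by_cases hrs : r - s = 0
    · rw [← sub_eq_zero.1 hrs]
      exact hp.le
    · have := ordAt_add_C (hne r) hp hrs
      rw [map_sub, sub_add_sub_cancel] at this
      exact this.ge
  have hmem : r ∈ P.roots := (mem_roots hP.ne_zero).2 hr
  rw [hev, ordAt_multiset_prod _ (by
    intro f hf
    obtain ⟨s, -, rfl⟩ := Multiset.mem_map.1 hf
    exact hne s), Multiset.map_map, ← Multiset.cons_erase hmem, Multiset.map_cons,
    Multiset.sum_cons]
  refine add_pos_of_pos_of_nonneg hp (Multiset.sum_nonneg ?_)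
  intro k hk
  obtain ⟨s, -, rfl⟩ := Multiset.mem_map.1 hk
  exact hord s

/-- Every root `r` of `P` is the value of `y` at a point where `x ^ ε` vanishes. All these points
lie over one toric divisor, so unibranchness allows a single point, hence a single root. -/
theorem eq_pow_of_unibranch {ε : ℤ} (hε : ε = 1 ∨ ε = -1) {θ : ℂ} (hθ : θ ≠ 0) {P : ℂ[X]} {ℓ : ℕ}
    (hd : P.natDegree = ℓ) (hP : P.Monic) (hP0 : P.coeff 0 ≠ 0) (hℓ : 0 < ℓ)
    (h : IsUnibranchRationalCurve (sideCurve ε θ P)) :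
    ∃ ξ : ℂ, ξ ≠ 0 ∧ P = (Polynomial.X - Polynomial.C ξ) ^ ℓ := by
  obtain ⟨⟨x, y, hx, hy⟩, ⟨⟨-, hev⟩, hgen⟩, hub⟩ := h
  simp only at hev hgen
  rw [evalAt_sideCurve hx hy] at hev
  have hyC : ∀ c, y ≠ RatFunc.C c := by
    -- A constant `y` would make `x` algebraic over `ℂ`, and the two could not generate the function
    -- field.
    rintro c rfl
    have hxε : IsAlgebraic ℂ (x ^ ε) := by
      have h1 : x ^ ε = algebraMap ℂ (RatFunc ℂ) (-(θ⁻¹ * P.eval c)) := by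
        have hθ' : algebraMap ℂ (RatFunc ℂ) θ ≠ 0 := by simpa using hθ
        rw [← RatFunc.algebraMap_eq_C, aeval_algebraMap_apply, coe_aeval_eq_eval] at hev
        rw [map_neg, map_mul, map_inv₀]
        field_simp
        linear_combination hev
      rw [h1]
      exact isAlgebraic_algebraMap _
    have hxa : IsAlgebraic ℂ x := by
      rcases hε with rfl | rfl
      · simpa using hxε
      · simpa using hxε.inv
    have hyb : IsAlgebraic ℂ (RatFunc.C c : RatFunc ℂ) := isAlgebraic_algebraMap c
    have hall : ∀ z ∈ IntermediateField.adjoin ℂ ({x, RatFunc.C c} : Set (RatFunc ℂ)),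
        IsAlgebraic ℂ z := by
      have hle : IntermediateField.adjoin ℂ ({x, RatFunc.C c} : Set (RatFunc ℂ)) ≤
          algebraicClosure ℂ (RatFunc ℂ) := by
        rw [IntermediateField.adjoin_le_iff]
        rintro z (rfl | rfl)
        · exact mem_algebraicClosure_iff.2 hxa
        · exact mem_algebraicClosure_iff.2 hyb
      exact fun z hz => mem_algebraicClosure_iff.1 (hle hz)
    rw [hgen] at hall
    exact RatFunc.transcendental_X (hall RatFunc.X trivial)
  have hroot_ne : ∀ r, P.IsRoot r → r ≠ 0 := by
    rintro r hr rfl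
    exact hP0 (by rwa [coeff_zero_eq_eval_zero])
  have hpt : ∀ r, P.IsRoot r → ∃ p, 0 < ordAt (y - RatFunc.C r) p ∧
      ∃ k : ℕ, 0 < k ∧ (ordAt x p, ordAt y p) = (ε * k, 0) := by
    intro r hr
    obtain ⟨p, hp⟩ := exists_ordAt_pos (f := y - RatFunc.C r) (fun c hc => hyC (c + r) (by
      rw [map_add, ← hc, sub_add_cancel]))
    have hpy : ordAt y p = 0 := by
      have := ordAt_add_C (sub_ne_zero.2 (hyC r)) hp (hroot_ne r hr)
      rwa [sub_add_cancel] at this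
    have hpos := ordAt_aeval_pos hP hyC hr hp
    have hxe : x ^ ε = RatFunc.C (-θ⁻¹) * aeval y P := by
      have hθ' : algebraMap ℂ (RatFunc ℂ) θ ≠ 0 := by simpa using hθ
      rw [← RatFunc.algebraMap_eq_C, map_neg, map_inv₀]
      field_simp
      linear_combination hev
    have hP0' : aeval y P ≠ 0 := by
      intro h0
      rw [h0, mul_zero] at hxe
      exact zpow_ne_zero _ hx hxe
    have hxo : ε * ordAt x p = ordAt (aeval y P) p := by
      rw [← ordAt_zpow hx, hxe, ordAt_mul (by simpa using hθ) hP0', ordAt_C, zero_add]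
    refine ⟨p, hp, (ordAt (aeval y P) p).toNat, by omega, ?_⟩
    rw [hpy, Int.toNat_of_nonneg hpos.le, ← hxo, ← mul_assoc]
    rcases hε with rfl | rfl <;> simp
  have huniq : ∀ r r', P.IsRoot r → P.IsRoot r' → r = r' := by
    intro r r' hr hr'
    obtain ⟨p, hp, k, hk, e⟩ := hpt r hr
    obtain ⟨p', hp', k', hk', e'⟩ := hpt r' hr'
    have hε0 : ε ≠ 0 := by rcases hε with rfl | rfl <;> norm_num
    have hpp : p = p' := by
      refine hub p p' ?_ ?_ ⟨k', k, hk', hk, ?_⟩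
      · simp only [TorusMap.ordVec]
        rw [e]
        simp [hε0, hk.ne']
      · simp only [TorusMap.ordVec]
        rw [e']
        simp [hε0, hk'.ne']
      · simp only [TorusMap.ordVec]
        rw [e, e']
        ext
        · simp
          ring
        · simp
    subst hpp
    by_contra hne
    have := ordAt_add_C (sub_ne_zero.2 (hyC r)) hp (sub_ne_zero.2 hne)
    rw [map_sub, sub_add_sub_cancel] at this
    omega
  obtain ⟨ξ, hξ⟩ := IsAlgClosed.exists_root P
    (fun h => hℓ.ne' (hd.symm.trans (natDegree_eq_of_degree_eq_some h)))
  refine ⟨ξ, hroot_ne ξ hξ, ?_⟩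
  have hsp := IsAlgClosed.splits P
  have hrep : P.roots = Multiset.replicate ℓ ξ := by
    rw [Multiset.eq_replicate]
    exact ⟨by rw [← hsp.natDegree_eq_card_roots, hd],
      fun r hr => huniq r ξ (isRoot_of_mem_roots hr) hξ⟩
  conv_lhs => rw [hsp.eq_prod_roots_of_monic hP]
  rw [hrep, Multiset.map_replicate, Multiset.prod_replicate]

-- The parametrization is `y = T`, `x ^ ε = -θ⁻¹ (T - ξ) ^ ℓ`. The boundary points are `∞`, `ξ` and
-- `0`, and their order vectors point in three different directions.
open Classical in
theorem isUnibranch_sideCurve {ε : ℤ} (hε : ε = 1 ∨ ε = -1) {θ ξ : ℂ} (hθ : θ ≠ 0) (hξ : ξ ≠ 0)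
    {ℓ : ℕ} (hℓ : 0 < ℓ) :
    IsUnibranchRationalCurve (sideCurve ε θ ((Polynomial.X - Polynomial.C ξ) ^ ℓ)) := by
  set s : RatFunc ℂ := RatFunc.X with hs
  have hs0 : s ≠ 0 := RatFunc.X_ne_zero
  have hlin : ∀ a : ℂ, s - RatFunc.C a = algebraMap ℂ[X] (RatFunc ℂ) (linForm (a : OnePoint ℂ)) := by
    intro a
    rw [linForm_coe, map_sub, RatFunc.algebraMap_X, RatFunc.algebraMap_C]
  have hsξ0 : s - RatFunc.C ξ ≠ 0 := by
    rw [hlin]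
    exact RatFunc.algebraMap_ne_zero (linForm_ne_zero _)
  have hcC : RatFunc.C (-θ⁻¹) ≠ (0 : RatFunc ℂ) := by simpa using hθ
  set w : RatFunc ℂ := RatFunc.C (-θ⁻¹) * (s - RatFunc.C ξ) ^ ℓ with hw
  have hw0 : w ≠ 0 := mul_ne_zero hcC (pow_ne_zero _ hsξ0)
  have hx0 : w ^ ε ≠ 0 := zpow_ne_zero _ hw0
  have hxx : (w ^ ε) ^ ε = w := by
    rw [← zpow_mul]
    rcases hε with rfl | rfl <;> simp
  have hev : evalAt (w ^ ε) s (sideCurve ε θ ((Polynomial.X - Polynomial.C ξ) ^ ℓ)) = 0 := by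
    rw [evalAt_sideCurve hx0 hs0, hxx, hw, map_pow, map_sub, aeval_X, Polynomial.aeval_C,
      RatFunc.algebraMap_eq_C, ← mul_assoc, ← map_mul, mul_neg, mul_inv_cancel₀ hθ]
    simp
  have hos : ∀ p, ordAt s p = (if p = ((0 : ℂ) : OnePoint ℂ) then 1 else 0) -
      (if p = OnePoint.infty then 1 else 0) := by
    intro p
    have := hlin 0
    rw [map_zero, sub_zero] at this
    rw [this, ordAt_linForm]
  have how : ∀ p, ordAt (w ^ ε) p = ε * (ℓ * ((if p = ((ξ : ℂ) : OnePoint ℂ) then 1 else 0) -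
      (if p = OnePoint.infty then 1 else 0))) := by
    intro p
    rw [ordAt_zpow hw0, hw, ordAt_mul hcC (pow_ne_zero _ hsξ0), ordAt_C, ordAt_pow hsξ0, hlin,
      ordAt_linForm, zero_add]
  refine ⟨⟨w ^ ε, s, hx0, hs0⟩, ⟨⟨irreducible_sideCurve hε hθ hx0 hs0 RatFunc.transcendental_X hev,
    hev⟩, ?_⟩, ?_⟩
  · rw [eq_top_iff, ← RatFunc.adjoin_X (K := ℂ)]
    exact IntermediateField.adjoin_simple_le_iff.2 (IntermediateField.subset_adjoin _ _ (by simp [hs]))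
  · have hℓ' : (0 : ℤ) < ℓ := by exact_mod_cast hℓ
    have hcase : ∀ p, (ordAt (w ^ ε) p, ordAt s p) ≠ (0 : ℤ × ℤ) →
        (p = OnePoint.infty ∧ (ordAt (w ^ ε) p, ordAt s p) = (-(ε * ℓ), -1)) ∨
        (p = (ξ : OnePoint ℂ) ∧ (ordAt (w ^ ε) p, ordAt s p) = (ε * ℓ, 0)) ∨
        (p = ((0 : ℂ) : OnePoint ℂ) ∧ (ordAt (w ^ ε) p, ordAt s p) = (0, 1)) := by
      intro p hp
      by_cases h1 : p = OnePoint.infty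
      · left
        refine ⟨h1, ?_⟩
        rw [hos, how, h1]
        simp
      by_cases h2 : p = (ξ : OnePoint ℂ)
      · right; left
        refine ⟨h2, ?_⟩
        rw [hos, how, h2]
        simp [hξ]
      by_cases h3 : p = ((0 : ℂ) : OnePoint ℂ)
      · right; right
        refine ⟨h3, ?_⟩
        rw [hos, how, h3]
        simp [hξ.symm]
      · exfalso
        apply hp
        rw [hos, how]
        simp [h1, h2, h3]
    intro p q hp hq hpq
    simp only [TorusMap.ordVec] at hp hq hpq
    obtain ⟨c, d, hc, hd, hcd⟩ := hpq
    have hc' : (0 : ℤ) < c := by exact_mod_cast hc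
    have hd' : (0 : ℤ) < d := by exact_mod_cast hd
    have hε0 : ε * ℓ ≠ 0 := by
      rcases hε with rfl | rfl
      · omega
      · omega
    rcases hcase p hp with ⟨rfl, ep⟩ | ⟨rfl, ep⟩ | ⟨rfl, ep⟩ <;>
    rcases hcase q hq with ⟨rfl, eq⟩ | ⟨rfl, eq⟩ | ⟨rfl, eq⟩ <;>
    first
    | rfl
    | (exfalso
       rw [ep, eq] at hcd
       have e1 := congrArg Prod.fst hcd
       have e2 := congrArg Prod.snd hcd
       simp [hε0, hc.ne', hd.ne'] at e1 e2
       try omega)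

end Parametrizations

/-! ### Comparison of toric changes -/

section Changes

variable {u : ℤ × ℤ}

theorem exists_smul_rot (hu : IsPrimitive u) {m : ℤ × ℤ} (hm : dot m u = 0) :
    ∃ k : ℤ, m = k • rot u := by
  have hg : (1 : ℤ) = u.1 * Int.gcdA u.1 u.2 + u.2 * Int.gcdB u.1 u.2 := by
    rw [← Int.gcd_eq_gcd_ab, hu]
    rfl
  set r := Int.gcdA u.1 u.2
  set s := Int.gcdB u.1 u.2
  simp only [dot] at hm
  refine ⟨r * m.2 - s * m.1, ?_⟩
  ext
  · simp only [Prod.smul_fst, rot, smul_eq_mul]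
    linear_combination m.1 * hg + r * hm
  · simp only [Prod.smul_snd, rot, smul_eq_mul]
    linear_combination m.2 * hg + s * hm

/-- Both second characters are `± rot u`, and the first characters pair equally with `u`, so they
differ by a multiple of `rot u`. -/
theorem ToricChange.exists_change (hu : IsPrimitive u) (Φ Φ' : ToricChange u) :
    ∃ k ε : ℤ, (ε = 1 ∨ ε = -1) ∧ Φ'.mx = Φ.mx + k • Φ.my ∧ Φ'.my = ε • Φ.my := by
  obtain ⟨s, hs, hmy, hmx⟩ := Φ.exists_sign hu
  obtain ⟨s', hs', hmy', hmx'⟩ := Φ'.exists_sign hu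
  obtain ⟨k, hk⟩ := exists_smul_rot hu (m := Φ'.mx - Φ.mx) (by
    simp only [dot, Prod.fst_sub, Prod.snd_sub] at hmx hmx' ⊢
    linear_combination hmx' - hmx)
  have hss : s * s = 1 := by rcases hs with rfl | rfl <;> rfl
  refine ⟨k * s, s' * s, ?_, ?_, ?_⟩
  · rcases hs with rfl | rfl <;> rcases hs' with rfl | rfl <;> simp
  · rw [hmy, smul_smul, mul_assoc, hss, mul_one, ← hk, add_sub_cancel]
  · rw [hmy, hmy', smul_smul, mul_assoc, hss, mul_one]

theorem monom_smul_left {F : Type*} [Field F] (a b c d : F) (m : ℤ × ℤ) :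
    monom (a * c) (b * d) m = monom a b m * monom c d m := by
  rw [monom, monom, monom, mul_zpow, mul_zpow]
  ring

end Changes

/-! ### The invariant of a modification datum of an unmarked edge -/

section Invariant

open Polynomial

variable {u : ℤ × ℤ} {ℓ : ℕ}

/-- The `ℓ`-th power of the invariant of all coherent modification data. -/
def BranchPair.kappa (S : BranchPair u) (ℓ : ℕ) : ℂ :=
  ((dot (rot u) S.h₁ : ℂ) * dot (rot u) S.h₂) ^ ℓ *
    (monom S.a₁ S.b₁ (Int.gcdA u.1 u.2, Int.gcdB u.1 u.2) /
      monom S.a₂ S.b₂ (Int.gcdA u.1 u.2, Int.gcdB u.1 u.2))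

/-- Two choices of `mx` differ by a multiple of `rot u`, which cancels in the quotient of the two
branches by the matching condition, and the sign of `my` enters twice. Thus the product depends on
`Φ` only through `η`. -/
theorem BranchPair.theta_mul_theta (hu : IsPrimitive u) (S : BranchPair u) (Φ : ToricChange u) :
    S.theta₁ ℓ Φ * S.theta₂ ℓ Φ = S.kappa ℓ * (S.eta Φ ^ 2) ^ ℓ := by
  obtain ⟨s, hs, hmy, hmx⟩ := Φ.exists_sign hu
  set m : ℤ × ℤ := (Int.gcdA u.1 u.2, Int.gcdB u.1 u.2) with hm
  have hmu : dot m u = 1 := by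
    have hg : (1 : ℤ) = u.1 * Int.gcdA u.1 u.2 + u.2 * Int.gcdB u.1 u.2 := by
      rw [← Int.gcd_eq_gcd_ab, hu]
      rfl
    rw [hg, hm, dot]
    ring
  obtain ⟨k, hk⟩ := exists_smul_rot hu (m := Φ.mx - m) (by
    simp only [dot, Prod.fst_sub, Prod.snd_sub] at hmx hmu ⊢
    linear_combination hmx - hmu)
  have hk' : Φ.mx = m + k • rot u := by rw [← hk, add_sub_cancel]
  have hr : monom S.a₁ S.b₁ Φ.mx / monom S.a₂ S.b₂ Φ.mx =
      monom S.a₁ S.b₁ m / monom S.a₂ S.b₂ m := by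
    rw [hk', monom_add S.ha₁ S.hb₁, monom_add S.ha₂ S.hb₂, monom_smul, monom_smul, S.matching]
    exact mul_div_mul_right _ _ (zpow_ne_zero _ (monom_ne_zero S.ha₂ S.hb₂ _))
  have hd : ∀ h : ℤ × ℤ, dot Φ.my h = s * dot (rot u) h := by
    intro h
    rw [hmy]
    simp only [dot, Prod.smul_fst, Prod.smul_snd, smul_eq_mul]
    ring
  have hss : (s : ℂ) * s = 1 := by rcases hs with rfl | rfl <;> norm_num
  rw [BranchPair.theta₁, BranchPair.theta₂, BranchPair.kappa, ← hr, hd, hd]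
  push_cast
  have : (S.eta Φ * (s * dot (rot u) S.h₁)) ^ ℓ * (S.eta Φ * (s * dot (rot u) S.h₂)) ^ ℓ =
      ((dot (rot u) S.h₁ : ℂ) * dot (rot u) S.h₂) ^ ℓ * (S.eta Φ ^ 2) ^ ℓ := by
    rw [← mul_pow, ← mul_pow]
    congr 1
    linear_combination (S.eta Φ ^ 2 * dot (rot u) S.h₁ * dot (rot u) S.h₂) * hss
  linear_combination (monom S.a₁ S.b₁ Φ.mx / monom S.a₂ S.b₂ Φ.mx) * this

theorem BranchPair.kappa_ne_zero (S : BranchPair u) (hu : IsPrimitive u) : S.kappa ℓ ≠ 0 := by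
  obtain ⟨Φ⟩ := exists_toricChange hu
  intro h
  have := S.theta_mul_theta (ℓ := ℓ) hu Φ
  rw [h, zero_mul] at this
  exact mul_ne_zero (S.theta₁_ne_zero ℓ Φ) (S.theta₂_ne_zero ℓ Φ) this

theorem UnmarkedDatum.eq_dickson (D : UnmarkedDatum u ℓ) (hℓ : 0 < ℓ) {θ₁ θ₂ : ℂ} (hθ₁ : θ₁ ≠ 0)
    (hθ₂ : θ₂ ≠ 0) (h₁ : restrict (leftEdge ℓ) D.f = binomialEq (-1) ℓ θ₁)
    (h₂ : restrict (rightEdge ℓ) D.f = binomialEq 1 ℓ θ₂) :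
    ∃ α, α ^ ℓ = θ₁ * θ₂ ∧ D.f = curve θ₁ θ₂ (dickson 1 α ℓ) := by
  obtain ⟨P, hPd, hP⟩ := exists_eq_curve (f := D.f) (ℓ := ℓ) (fun i j hij => by
    refine lattice_points_of_mem_convexHull hℓ (m := (i, j)) ?_
      (D.newton ▸ toReal_mem_newtonPolygon hij)
    rintro b (rfl | rfl | rfl) <;> simp)
  rw [coeff_of_restrict_leftEdge h₁, coeff_of_restrict_rightEdge h₂] at hP
  obtain ⟨n, rfl⟩ : ∃ n, ℓ = n + 1 := ⟨ℓ - 1, by omega⟩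
  have h1 := D.normalized
  have h0 := D.vanishing
  rw [show ((n + 1 : ℕ) : ℤ) - 1 = (n : ℤ) by push_cast; ring] at h0
  rw [hP, curve_coeff_zero] at h1 h0
  obtain ⟨φ, hφ⟩ := D.rational
  rw [hP] at hφ
  obtain ⟨α, hα, rfl⟩ := hφ.eq_dickson hθ₁ hθ₂ hPd h1 h0
  exact ⟨α, hα, hP⟩

/-- The modification datum of an unmarked edge with given invariant `z`. -/
def BranchPair.HasInvariant (S : BranchPair u) (D : UnmarkedDatum u ℓ) (z : ℂ) : Prop :=
  z ^ ℓ = S.kappa ℓ ∧ D.ζ.IsIntegral ∧ D.ζ.atZero = S.eta D.Φ ∧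
    D.f = curve (S.theta₁ ℓ D.Φ) (S.theta₂ ℓ D.Φ) (dickson 1 (z * S.eta D.Φ ^ 2) ℓ)

/-- The Dickson parameter `α` satisfies `α ^ ℓ = θ₁ θ₂`. Dividing `α` by `η ^ 2` removes its
dependence on the toric change, leaving an `ℓ`-th root of `S.kappa ℓ`. -/
theorem BranchPair.coherent_iff (S : BranchPair u) (hu : IsPrimitive u) (hℓ : 0 < ℓ)
    {F₁ F₂ : Laurent} (hS : S.Equations ℓ F₁ F₂) (D : UnmarkedDatum u ℓ) :
    D.Coherent F₁ F₂ ↔ ∃ z, S.HasInvariant D z := by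
  constructor
  · rintro ⟨hint, θ₁, θ₂, hloc, h₁, h₂⟩
    obtain ⟨hη, rfl, rfl⟩ := (S.localEquations_iff hu hℓ hS D.Φ _ _ _).1 hloc
    obtain ⟨α, hα, hf⟩ := D.eq_dickson hℓ (S.theta₁_ne_zero ℓ _) (S.theta₂_ne_zero ℓ _) h₁ h₂
    have hη0 : S.eta D.Φ ^ 2 ≠ 0 := pow_ne_zero 2 (S.eta_ne_zero _)
    refine ⟨α / S.eta D.Φ ^ 2, ?_, hint, hη, ?_⟩
    · rw [div_pow, hα, S.theta_mul_theta hu, mul_div_cancel_right₀ _ (pow_ne_zero _ hη0)]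
    · rwa [div_mul_cancel₀ _ hη0]
  · rintro ⟨z, hz, hint, hη, hf⟩
    refine ⟨hint, S.theta₁ ℓ D.Φ, S.theta₂ ℓ D.Φ,
      (S.localEquations_iff hu hℓ hS D.Φ _ _ _).2 ⟨hη, rfl, rfl⟩, ?_, ?_⟩
    · rw [hf]
      exact restrict_leftEdge_curve hℓ (dickson_coeff_self _ hℓ)
    · rw [hf]
      exact restrict_rightEdge_curve hℓ (dickson_coeff_self _ hℓ)

/-- The constant Puiseux series. -/
def Puiseux.const (c : ℂ) : Puiseux := ⟨HahnSeries.C c, 1, one_pos, fun a ha => by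
  refine ⟨0, ?_⟩
  have := HahnSeries.support_single_subset ha
  simpa using this⟩

theorem Puiseux.const_isIntegral (c : ℂ) : (Puiseux.const c).IsIntegral := fun a ha => by
  simp [Puiseux.const, HahnSeries.C_apply, HahnSeries.coeff_single_of_ne ha.ne]

theorem Puiseux.const_atZero (c : ℂ) : (Puiseux.const c).atZero = c := by
  simp [Puiseux.const, Puiseux.atZero, HahnSeries.C_apply]

theorem BranchPair.exists_hasInvariant (S : BranchPair u) (hu : IsPrimitive u) (hℓ : 0 < ℓ) {z : ℂ}
    (hz : z ^ ℓ = S.kappa ℓ) : ∃ D : UnmarkedDatum u ℓ, S.HasInvariant D z := by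
  obtain ⟨Φ⟩ := exists_toricChange hu
  have h1 := S.theta₁_ne_zero ℓ Φ
  have h2 := S.theta₂_ne_zero ℓ Φ
  have hc := dickson_coeff_self (z * S.eta Φ ^ 2) hℓ
  refine ⟨⟨Φ, Puiseux.const (S.eta Φ),
    curve (S.theta₁ ℓ Φ) (S.theta₂ ℓ Φ) (dickson 1 (z * S.eta Φ ^ 2) ℓ),
    newtonPolygon_curve_both h1 h2 hℓ (dickson_natDegree_le _ _) (by rw [hc]; exact one_ne_zero),
    by rw [curve_coeff_zero, hc], isRationalCurve_dickson h1 h2 hℓ ?_, ?_⟩, hz,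
    Puiseux.const_isIntegral _, Puiseux.const_atZero _, rfl⟩
  · rw [S.theta_mul_theta hu, mul_pow, hz]
  · obtain ⟨n, rfl⟩ : ∃ n, ℓ = n + 1 := ⟨ℓ - 1, by omega⟩
    rw [show ((n + 1 : ℕ) : ℤ) - 1 = (n : ℤ) by push_cast; ring, curve_coeff_zero,
      dickson_coeff_succ]

/-! ### Behaviour of the modification curves under scaling, and equivalence of unmarked data. -/

theorem scale_coeff (a b : ℂ) (f : Laurent) (m : ℤ × ℤ) :
    (scale a b f).coeff m = f.coeff m * monom a b m := by
  classical
  rw [scale, Finsupp.sum, AddMonoidAlgebra.coeff_sum, Finsupp.finsetSum_apply]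
  simp only [AddMonoidAlgebra.coeff_single, Finsupp.single_apply]
  rw [Finset.sum_ite_eq']
  split_ifs with h
  · rfl
  · rw [Finsupp.notMem_support_iff.1 h, zero_mul]

theorem scale_curve {a b : ℂ} (θ₁ θ₂ : ℂ) (P : ℂ[X]) :
    scale a b (curve θ₁ θ₂ P) = curve (θ₁ * a⁻¹) (θ₂ * a) (P.comp (C b * X)) := by
  ext ⟨i, j⟩
  rw [scale_coeff, curve_coeff, curve_coeff, add_mul, add_mul, ite_mul, ite_mul, ite_mul]
  simp only [zero_mul]
  congr 1
  · congr 1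
    · split_ifs with h
      · obtain ⟨rfl, rfl⟩ := h
        simp [monom]
      · rfl
    · split_ifs with h
      · obtain ⟨rfl, rfl⟩ := h
        simp [monom]
      · rfl
  · split_ifs with h
    · subst h
      rcases lt_or_ge j 0 with hj | hj
      · rw [toLaurent_coeff_of_neg _ hj, toLaurent_coeff_of_neg _ hj, zero_mul]
      · lift j to ℕ using hj
        rw [toLaurent_coeff_natCast, toLaurent_coeff_natCast, comp_C_mul_X_coeff]
        simp [monom]
    · rfl

theorem single_mul_curve (c θ₁ θ₂ : ℂ) (P : ℂ[X]) :
    AddMonoidAlgebra.single (0, 0) c * curve θ₁ θ₂ P = curve (c * θ₁) (c * θ₂) (C c * P) := by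
  rw [curve, curve, mul_add, mul_add, AddMonoidAlgebra.single_mul_single,
    AddMonoidAlgebra.single_mul_single, map_mul, map_mul, yHom_toLaurent_C]
  simp

theorem associated_curve_C_mul {c : ℂ} (hc : c ≠ 0) (θ₁ θ₂ : ℂ) (P : ℂ[X]) :
    Associated (curve (c * θ₁) (c * θ₂) (C c * P)) (curve θ₁ θ₂ P) := by
  rw [← single_mul_curve]
  exact associated_unit_mul_left _ _ (isUnit_single _ hc)

theorem Parametrizes.transcendental_Y {φ : TorusMap} {θ₁ θ₂ : ℂ} (hθ₂ : θ₂ ≠ 0) {P : ℂ[X]}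
    (h : Parametrizes φ (curve θ₁ θ₂ P)) : Transcendental ℂ φ.Y := by
  obtain ⟨⟨-, hev⟩, hgen⟩ := h
  rw [evalAt_curve φ.X_ne_zero φ.Y_ne_zero] at hev
  have hrel : algebraMap ℂ (RatFunc ℂ) θ₁ + algebraMap ℂ (RatFunc ℂ) θ₂ * φ.X ^ 2 +
      aeval φ.Y P * φ.X = 0 := by
    have := congrArg (· * φ.X) hev
    simp only [zero_mul] at this
    rw [← this]
    have := φ.X_ne_zero
    field_simp
  obtain ⟨-, hm0⟩ := finrank_adjoin_le_two hgen hθ₂ hrel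
  rw [RatFunc.finrank_eq_max_natDegree] at hm0
  refine RatFunc.transcendental_of_ne_C _ ?_
  rintro ⟨c, hc⟩
  rw [hc] at hm0
  simp at hm0

/-- Both equations vanish on the same parametrized curve, so their difference `(Q - P)(y)` does, and
`y` is transcendental there. -/
theorem eq_of_associated_curve {θ₁ θ₂ : ℂ} (hθ₂ : θ₂ ≠ 0) {P Q : ℂ[X]}
    (hP : IsRationalCurve (curve θ₁ θ₂ P)) (h : Associated (curve θ₁ θ₂ Q) (curve θ₁ θ₂ P)) :
    Q = P := by
  obtain ⟨φ, hφ⟩ := hP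
  have htr := hφ.transcendental_Y hθ₂
  have h1 := hφ.1.2
  have h2 : evalAt φ.X φ.Y (curve θ₁ θ₂ Q) = 0 := by
    obtain ⟨c, hc⟩ := h.symm.dvd
    rw [hc, ← evalHom_apply _ _ φ.X_ne_zero φ.Y_ne_zero, map_mul, evalHom_apply, h1, zero_mul]
  rw [evalAt_curve φ.X_ne_zero φ.Y_ne_zero] at h1 h2
  by_contra hne
  exact htr ⟨Q - P, sub_ne_zero.2 hne, by rw [map_sub]; linear_combination h2 - h1⟩

/-- The second pair arises from the first by multiplying the torus coordinates by `A` and `B`. -/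
structure BranchPair.ScaledBy (A B : ℂ) (S S' : BranchPair u) : Prop where
  a₁ : S'.a₁ = A * S.a₁
  b₁ : S'.b₁ = B * S.b₁
  a₂ : S'.a₂ = A * S.a₂
  b₂ : S'.b₂ = B * S.b₂
  h₁ : S'.h₁ = S.h₁
  h₂ : S'.h₂ = S.h₂

theorem BranchPair.scaledBy_one (S : BranchPair u) : S.ScaledBy 1 1 S := by
  constructor <;> simp

theorem BranchPair.ScaledBy.kappa {A B : ℂ} {S S' : BranchPair u} (h : S.ScaledBy A B S')
    (hA : A ≠ 0) (hB : B ≠ 0) : S'.kappa ℓ = S.kappa ℓ := by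
  rw [BranchPair.kappa, BranchPair.kappa, h.h₁, h.h₂, h.a₁, h.b₁, h.a₂, h.b₂, monom_smul_left,
    monom_smul_left A, mul_div_mul_left _ _ (monom_ne_zero hA hB _)]

theorem BranchPair.ScaledBy.eta {A B : ℂ} {S S' : BranchPair u} (h : S.ScaledBy A B S')
    {Φ Φ' : ToricChange u} {ε : ℤ} (hy : Φ'.my = ε • Φ.my) :
    S'.eta Φ' = monom A B Φ'.my * S.eta Φ ^ ε := by
  rw [BranchPair.eta, h.a₁, h.b₁, monom_smul_left, hy, monom_smul S.a₁, BranchPair.eta]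

theorem dot_smul_left (m n : ℤ × ℤ) (k : ℤ) : dot (k • m) n = k * dot m n := by
  simp only [dot, Prod.smul_fst, Prod.smul_snd, smul_eq_mul]
  ring

/-- The leading coefficients transform as the coefficients of a curve under scaling. -/
theorem BranchPair.ScaledBy.theta {A B : ℂ} {S S' : BranchPair u} (h : S.ScaledBy A B S')
    (hu : IsPrimitive u) {Φ Φ' : ToricChange u} {k ε : ℤ}
    (hx : Φ'.mx = Φ.mx + k • Φ.my) (hy : Φ'.my = ε • Φ.my) {a b : ℂ}
    (ha : a = monom A B Φ'.mx * S.eta Φ ^ k)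
    (hb : b = monom A B Φ'.my * ((ε : ℂ) * S.eta Φ ^ (ε - 1))) :
    S'.theta₁ ℓ Φ' = a * b ^ ℓ * S.theta₁ ℓ Φ ∧ S'.theta₂ ℓ Φ' = b ^ ℓ * a⁻¹ * S.theta₂ ℓ Φ := by
  have hη := S.eta_ne_zero Φ
  have hd : ∀ h : ℤ × ℤ, (dot Φ'.my h : ℂ) = ε * dot Φ.my h := by
    intro h
    rw [hy, dot_smul_left]
    push_cast
    rfl
  have hb' : ∀ d : ℂ, S'.eta Φ' * (ε * d) = b * (S.eta Φ * d) := by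
    intro d
    rw [h.eta hy, hb, zpow_sub₀ hη, zpow_one]
    field_simp
  constructor
  · rw [BranchPair.theta₁, BranchPair.theta₁, h.h₁, hd, hb', h.a₁, h.b₁, monom_smul_left A B S.a₁,
      hx, monom_add S.ha₁ S.hb₁, monom_smul S.a₁, ← hx, mul_pow, ha, BranchPair.eta]
    ring
  · rw [BranchPair.theta₂, BranchPair.theta₂, h.h₂, hd, hb', h.a₂, h.b₂, monom_smul_left A B S.a₂,
      hx, monom_add S.ha₂ S.hb₂, monom_smul S.a₂, ← hx, mul_pow, ha, S.eta_eq hu, mul_inv]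
    rw [div_eq_mul_inv, mul_inv, mul_inv, div_eq_mul_inv]
    ring

/-- Both `η ^ 2` and the Dickson parameter scale by `b ^ 2`. So the transformed curve of `D'` is, up
to the factor `b ^ ℓ`, the curve with the coefficients `θ₁`, `θ₂` of `D` and Dickson parameter `z' η
^ 2`. The Dickson polynomials agree exactly when `z = z'`. General factors `A`, `B` are allowed
because the datum `Ω` of a marked edge undergoes a scaling. -/
theorem UnmarkedDatum.related_iff {A B : ℂ} (hA : A ≠ 0) (hB : B ≠ 0) {S S' : BranchPair u}
    (h : S.ScaledBy A B S') (hu : IsPrimitive u) (hℓ : 0 < ℓ) {D D' : UnmarkedDatum u ℓ}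
    {z z' : ℂ} (hD : S.HasInvariant D z) (hD' : S'.HasInvariant D' z') :
    UnmarkedDatum.Related A B D D' ↔ z = z' := by
  obtain ⟨hz, -, hζ, hf⟩ := hD
  obtain ⟨hz', -, hζ', hf'⟩ := hD'
  have hη := S.eta_ne_zero D.Φ
  have key : ∀ k ε : ℤ, (ε = 1 ∨ ε = -1) → D'.Φ.mx = D.Φ.mx + k • D.Φ.my → D'.Φ.my = ε • D.Φ.my →
      (Associated (scale (monom A B D'.Φ.mx * D.ζ.atZero ^ k)
        (monom A B D'.Φ.my * ((ε : ℂ) * D.ζ.atZero ^ (ε - 1))) D'.f) D.f ↔ z = z') := by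
    intro k ε hε hx hy
    have hε0 : (ε : ℂ) ≠ 0 := by rcases hε with rfl | rfl <;> norm_num
    have hε2 : (ε : ℂ) ^ 2 = 1 := by rcases hε with rfl | rfl <;> norm_num
    rw [hζ]
    set a := monom A B D'.Φ.mx * S.eta D.Φ ^ k with ha
    set b := monom A B D'.Φ.my * ((ε : ℂ) * S.eta D.Φ ^ (ε - 1)) with hb
    have ha0 : a ≠ 0 := mul_ne_zero (monom_ne_zero hA hB _) (zpow_ne_zero _ hη)
    have hb0 : b ≠ 0 := mul_ne_zero (monom_ne_zero hA hB _)
      (mul_ne_zero hε0 (zpow_ne_zero _ hη))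
    obtain ⟨e1, e2⟩ := h.theta (ℓ := ℓ) hu hx hy ha hb
    -- Without the squares this holds only up to the sign `ε`, which is part of `b`.
    have e3 : S'.eta D'.Φ ^ 2 = b ^ 2 * S.eta D.Φ ^ 2 := by
      rw [h.eta hy, hb, zpow_sub₀ hη, zpow_one, mul_pow, mul_pow _ _ 2, mul_pow, hε2, div_pow]
      field_simp
    have e4 : scale a b D'.f = curve (b ^ ℓ * S.theta₁ ℓ D.Φ) (b ^ ℓ * S.theta₂ ℓ D.Φ)
        (C (b ^ ℓ) * dickson 1 (z' * S.eta D.Φ ^ 2) ℓ) := by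
      rw [hf', scale_curve, e1, e2, e3, mul_left_comm z', dickson_scale]
      congr 1
      · field_simp
      · field_simp
    have hα : (z * S.eta D.Φ ^ 2) ^ ℓ = S.theta₁ ℓ D.Φ * S.theta₂ ℓ D.Φ := by
      rw [S.theta_mul_theta hu, mul_pow, hz]
    have hα' : (z' * S.eta D.Φ ^ 2) ^ ℓ = (z * S.eta D.Φ ^ 2) ^ ℓ := by
      rw [mul_pow, mul_pow, hz, hz', h.kappa hA hB]
    have hθ₁ := S.theta₁_ne_zero ℓ D.Φ
    have hθ₂ := S.theta₂_ne_zero ℓ D.Φ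
    have hass := associated_curve_C_mul (pow_ne_zero ℓ hb0) (S.theta₁ ℓ D.Φ) (S.theta₂ ℓ D.Φ)
      (dickson 1 (z' * S.eta D.Φ ^ 2) ℓ)
    rw [e4, hf]
    constructor
    · intro h1
      have h2 := eq_of_associated_curve hθ₂ (isRationalCurve_dickson hθ₁ hθ₂ hℓ hα)
        (hass.symm.trans h1)
      exact (mul_right_cancel₀ (pow_ne_zero 2 hη) (dickson_injective hℓ hα' h2)).symm
    · rintro rfl
      exact hass
  constructor
  · rintro ⟨k, ε, hε, hx, hy, -, hass⟩
    exact (key k ε hε hx hy).1 hass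
  · intro hzz
    obtain ⟨k, ε, hε, hx, hy⟩ := D.Φ.exists_change hu D'.Φ
    refine ⟨k, ε, hε, hx, hy, ?_, (key k ε hε hx hy).2 hzz⟩
    rw [hζ, hζ', h.eta hy]

end Invariant

/-! ### Modification data of a marked edge -/

section Marked

open Polynomial

variable {u : ℤ × ℤ} {ℓ : ℕ}

/-- The Newton triangle excludes the monomial `x` and makes the constant term nonzero; unibranchness
then turns the polynomial in `y` into a pure power. -/
theorem MarkedDatum.eq_curve₁ (D : MarkedDatum u ℓ) (hℓ : 0 < ℓ) {θ : ℂ} (hθ : θ ≠ 0)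
    (h : restrict (leftEdge ℓ) D.f₁ = binomialEq (-1) ℓ θ) :
    ∃ ξ : ℂ, ξ ≠ 0 ∧ D.f₁ = curve θ 0 ((X - C ξ) ^ ℓ) := by
  have hB : ∀ b ∈ ({((-1 : ℝ), (0 : ℝ)), (0, 0), (0, (ℓ : ℝ))} : Set (ℝ × ℝ)),
      b = (-1, 0) ∨ b = (1, 0) ∨ b = (0, 0) ∨ b = (0, (ℓ : ℝ)) := by
    rintro b (rfl | rfl | rfl) <;> simp
  have hle : ∀ m : ℤ × ℤ, toReal m ∈ convexHull ℝ
      ({((-1 : ℝ), (0 : ℝ)), (0, 0), (0, (ℓ : ℝ))} : Set (ℝ × ℝ)) → m.1 ≤ 0 := by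
    intro m hm
    have := convexHull_subset_halfSpace (a := 1) (b := 0) (c := 0)
      (by rintro p (rfl | rfl | rfl) <;> simp) _ hm
    simpa [toReal] using this
  obtain ⟨P, hPd, hP⟩ := exists_eq_curve (f := D.f₁) (ℓ := ℓ) (fun i j hij =>
    lattice_points_of_mem_convexHull hℓ hB (m := (i, j))
      (D.newton₁ ▸ toReal_mem_newtonPolygon hij))
  have hr : D.f₁.coeff (1, 0) = 0 := by
    by_contra hne
    have := hle (1, 0) (D.newton₁ ▸ toReal_mem_newtonPolygon hne)
    norm_num at this
  rw [coeff_of_restrict_leftEdge h, hr] at hP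
  have h1 := D.normalized₁
  rw [hP, curve_coeff_zero] at h1
  have h0 : P.coeff 0 ≠ 0 := by
    -- The form `i - j` is `0` at the origin and at most `-1` at all other lattice points of the
    -- triangle.
    have := exists_vertex_coeff_ne_zero (a := 1) (b := -1) (c := -1) (v := (0, 0)) D.newton₁
      (by simp [toReal]) (by norm_num) (by
        rintro ⟨i, j⟩ hm hne
        have hi := hle _ hm
        rcases lattice_points_of_mem_convexHull hℓ hB hm with ⟨h1, h2⟩ | ⟨h1, h2⟩ | ⟨h1, h2, -⟩ <;>
          simp only at hi h1 h2 <;> subst h1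
        · simp [h2]
        · omega
        · have : 1 ≤ j := by
            rcases h2.lt_or_eq with h | h
            · exact h
            · exact absurd (by rw [h]) hne
          have : (1 : ℝ) ≤ j := by exact_mod_cast this
          simp only [Int.cast_zero]
          linarith)
    rw [hP] at this
    rwa [← curve_coeff_zero θ 0 P 0]
  have hdeg : P.natDegree = ℓ :=
    natDegree_eq_of_le_of_coeff_ne_zero hPd (by rw [h1]; exact one_ne_zero)
  have hub := D.unibranch₁
  rw [hP, curve_zero_right] at hub
  obtain ⟨ξ, hξ, rfl⟩ := eq_pow_of_unibranch (Or.inr rfl) hθ hdeg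
    (by rw [Monic, leadingCoeff, hdeg, h1]) h0 hℓ hub
  exact ⟨ξ, hξ, hP⟩

theorem MarkedDatum.eq_curve₂ (D : MarkedDatum u ℓ) (hℓ : 0 < ℓ) {θ : ℂ} (hθ : θ ≠ 0)
    (h : restrict (rightEdge ℓ) D.f₂ = binomialEq 1 ℓ θ) :
    ∃ ξ : ℂ, ξ ≠ 0 ∧ D.f₂ = curve 0 θ ((X - C ξ) ^ ℓ) := by
  have hB : ∀ b ∈ ({((0 : ℝ), (0 : ℝ)), (1, 0), (0, (ℓ : ℝ))} : Set (ℝ × ℝ)),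
      b = (-1, 0) ∨ b = (1, 0) ∨ b = (0, 0) ∨ b = (0, (ℓ : ℝ)) := by
    rintro b (rfl | rfl | rfl) <;> simp
  have hle : ∀ m : ℤ × ℤ, toReal m ∈ convexHull ℝ
      ({((0 : ℝ), (0 : ℝ)), (1, 0), (0, (ℓ : ℝ))} : Set (ℝ × ℝ)) → 0 ≤ m.1 := by
    intro m hm
    have := convexHull_subset_halfSpace (a := -1) (b := 0) (c := 0)
      (by rintro p (rfl | rfl | rfl) <;> simp) _ hm
    simpa [toReal] using this
  obtain ⟨P, hPd, hP⟩ := exists_eq_curve (f := D.f₂) (ℓ := ℓ) (fun i j hij =>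
    lattice_points_of_mem_convexHull hℓ hB (m := (i, j))
      (D.newton₂ ▸ toReal_mem_newtonPolygon hij))
  have hr : D.f₂.coeff (-1, 0) = 0 := by
    by_contra hne
    have := hle (-1, 0) (D.newton₂ ▸ toReal_mem_newtonPolygon hne)
    norm_num at this
  rw [coeff_of_restrict_rightEdge h, hr] at hP
  have h1 := D.normalized₂
  rw [hP, curve_coeff_zero] at h1
  have h0 : P.coeff 0 ≠ 0 := by
    -- On the mirrored triangle the form `-i - j` isolates the origin.
    have := exists_vertex_coeff_ne_zero (a := -1) (b := -1) (c := -1) (v := (0, 0)) D.newton₂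
      (by simp [toReal]) (by norm_num) (by
        rintro ⟨i, j⟩ hm hne
        have hi := hle _ hm
        rcases lattice_points_of_mem_convexHull hℓ hB hm with ⟨h1, h2⟩ | ⟨h1, h2⟩ | ⟨h1, h2, -⟩ <;>
          simp only at hi h1 h2 <;> subst h1
        · omega
        · simp [h2]
        · have : 1 ≤ j := by
            rcases h2.lt_or_eq with h | h
            · exact h
            · exact absurd (by rw [h]) hne
          have : (1 : ℝ) ≤ j := by exact_mod_cast this
          simp only [Int.cast_zero]
          linarith)
    rw [hP] at this
    rwa [← curve_coeff_zero 0 θ P 0]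
  have hdeg : P.natDegree = ℓ :=
    natDegree_eq_of_le_of_coeff_ne_zero hPd (by rw [h1]; exact one_ne_zero)
  have hub := D.unibranch₂
  rw [hP, curve_zero_left] at hub
  obtain ⟨ξ, hξ, rfl⟩ := eq_pow_of_unibranch (Or.inl rfl) hθ hdeg
    (by rw [Monic, leadingCoeff, hdeg, h1]) h0 hℓ hub
  exact ⟨ξ, hξ, hP⟩

/-! ### The limit curves of the second modification -/

theorem X_sub_one_eq (ξ : ℂ) : algebraMap ℂ (RatFunc ℂ) ξ * RatFunc.X - algebraMap ℂ (RatFunc ℂ) ξ =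
    algebraMap ℂ (RatFunc ℂ) ξ * (RatFunc.X - 1) := by ring

theorem transcendental_C_mul_X {ξ : ℂ} (hξ : ξ ≠ 0) :
    Transcendental ℂ (algebraMap ℂ (RatFunc ℂ) ξ * RatFunc.X) := by
  refine transcendental_of_intDegree_ne_zero ?_
  rw [RatFunc.algebraMap_eq_C, RatFunc.intDegree_mul (by simpa using hξ) RatFunc.X_ne_zero,
    RatFunc.intDegree_C, RatFunc.intDegree_X]
  norm_num

/-- With `y = ξ T` and `x ^ ε = a ^ ε (T - 1) ^ ℓ`, the relation `θ a ^ ε = -ξ ^ ℓ` makes the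
equation vanish. In this way the refined modification is again an instance of the unmarked
situation. -/
theorem isBranchEquation_sideCurve {ε : ℤ} (hε : ε = 1 ∨ ε = -1) {a θ ξ : ℂ} (hθ : θ ≠ 0)
    (hξ : ξ ≠ 0) (ha0 : a ≠ 0) (ha : θ * a ^ ε = -ξ ^ ℓ) :
    IsBranchEquation a ξ (0, 1) ((-ε * ℓ) • ((1, 0) : ℤ × ℤ))
      (sideCurve ε θ ((X - C ξ) ^ ℓ)) := by
  have hX : branchFun a (0, (1 : ℤ)).1 ((-ε * (ℓ : ℤ)) • ((1, 0) : ℤ × ℤ)).1 ^ ε =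
      algebraMap ℂ (RatFunc ℂ) (a ^ ε) * (RatFunc.X - 1) ^ ℓ := by
    rw [branchFun_zpow, branchFun]
    simp only [zero_mul, zpow_zero, mul_one, Prod.smul_fst, smul_eq_mul, RatFunc.algebraMap_eq_C]
    have : -(-ε * ℓ * ε) = (ℓ : ℤ) := by rcases hε with rfl | rfl <;> ring
    rw [this, zpow_natCast]
  have hY : branchFun ξ (0, (1 : ℤ)).2 ((-ε * (ℓ : ℤ)) • ((1, 0) : ℤ × ℤ)).2 =
      algebraMap ℂ (RatFunc ℂ) ξ * RatFunc.X := by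
    simp [branchFun, RatFunc.algebraMap_eq_C]
  have hx0 := branchFun_ne_zero ha0 (0, (1 : ℤ)).1 ((-ε * (ℓ : ℤ)) • ((1, 0) : ℤ × ℤ)).1
  have hy0 := branchFun_ne_zero hξ (0, (1 : ℤ)).2 ((-ε * (ℓ : ℤ)) • ((1, 0) : ℤ × ℤ)).2
  have hev : evalAt (branchFun a (0, (1 : ℤ)).1 ((-ε * (ℓ : ℤ)) • ((1, 0) : ℤ × ℤ)).1)
      (branchFun ξ (0, (1 : ℤ)).2 ((-ε * (ℓ : ℤ)) • ((1, 0) : ℤ × ℤ)).2)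
      (sideCurve ε θ ((X - C ξ) ^ ℓ)) = 0 := by
    rw [evalAt_sideCurve hx0 hy0, hX, hY, map_pow, map_sub, aeval_X, aeval_C, X_sub_one_eq,
      mul_pow, ← mul_assoc, ← map_mul, ha, ← map_pow, ← add_mul, ← map_add, neg_add_cancel, map_zero,
      zero_mul]
  exact ⟨irreducible_sideCurve hε hθ hx0 hy0 (by rw [hY]; exact transcendental_C_mul_X hξ) hev, hev⟩

/-- The branches of the curves `θ₁ * x⁻¹ + (y - ξ) ^ ℓ` and `θ₂ * x + (y - ξ) ^ ℓ` at `y = ξ`. -/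
def markedPair (ℓ : ℕ) {θ₁ θ₂ ξ : ℂ} (h₁ : θ₁ ≠ 0) (h₂ : θ₂ ≠ 0) (hξ : ξ ≠ 0) :
    BranchPair (1, 0) where
  a₁ := -θ₁ / ξ ^ ℓ
  b₁ := ξ
  h₁ := (0, 1)
  a₂ := -ξ ^ ℓ / θ₂
  b₂ := ξ
  h₂ := (0, 1)
  ha₁ := div_ne_zero (neg_ne_zero.2 h₁) (pow_ne_zero _ hξ)
  hb₁ := hξ
  ha₂ := div_ne_zero (neg_ne_zero.2 (pow_ne_zero _ hξ)) h₂
  hb₂ := hξ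
  hdet₁ := by simp [det2]
  hdet₂ := by simp [det2]
  matching := by simp [rot, monom]

theorem isPrimitive_one_zero : IsPrimitive (1, 0) := rfl

theorem isBranchEquation_left {θ ξ : ℂ} (h : θ ≠ 0) (hξ : ξ ≠ 0) :
    IsBranchEquation (-θ / ξ ^ ℓ) ξ (0, 1) ((-(-1) * (ℓ : ℤ)) • ((1, 0) : ℤ × ℤ))
      (curve θ 0 ((X - C ξ) ^ ℓ)) := by
  rw [curve_zero_right]
  refine isBranchEquation_sideCurve (Or.inr rfl) h hξ
    (div_ne_zero (neg_ne_zero.2 h) (pow_ne_zero _ hξ)) ?_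
  rw [zpow_neg_one]
  field_simp

theorem isBranchEquation_right {θ ξ : ℂ} (h : θ ≠ 0) (hξ : ξ ≠ 0) :
    IsBranchEquation (-ξ ^ ℓ / θ) ξ (0, 1) ((-1 * (ℓ : ℤ)) • ((1, 0) : ℤ × ℤ))
      (curve 0 θ ((X - C ξ) ^ ℓ)) := by
  rw [curve_zero_left]
  refine isBranchEquation_sideCurve (Or.inl rfl) h hξ
    (div_ne_zero (neg_ne_zero.2 (pow_ne_zero _ hξ)) h) ?_
  rw [zpow_one]
  field_simp

theorem markedPair_equations {θ₁ θ₂ ξ : ℂ} (h₁ : θ₁ ≠ 0) (h₂ : θ₂ ≠ 0) (hξ : ξ ≠ 0) :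
    (markedPair ℓ h₁ h₂ hξ).Equations ℓ (curve θ₁ 0 ((X - C ξ) ^ ℓ))
      (curve 0 θ₂ ((X - C ξ) ^ ℓ)) := by
  constructor
  · have := isBranchEquation_left (ℓ := ℓ) h₁ hξ
    rwa [show (-(-1) * (ℓ : ℤ)) • ((1, 0) : ℤ × ℤ) = ℓ • ((1, 0) : ℤ × ℤ) by simp] at this
  · have := isBranchEquation_right (ℓ := ℓ) h₂ hξ
    rwa [show (-1 * (ℓ : ℤ)) • ((1, 0) : ℤ × ℤ) = -(ℓ • ((1, 0) : ℤ × ℤ)) by simp] at this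

/-- The two curves touch the common divisor at `y = ξ₁` and `y = ξ₂`, and a coherent `Ω` needs one
common point. -/
theorem eq_of_localEquations (hℓ : 0 < ℓ) {Φ : ToricChange (1, 0)} {η t₁ t₂ θ₁ θ₂ ξ₁ ξ₂ : ℂ}
    (h₁ : θ₁ ≠ 0) (h₂ : θ₂ ≠ 0) (hξ₁ : ξ₁ ≠ 0) (hξ₂ : ξ₂ ≠ 0)
    (h : LocalEquations Φ ℓ η t₁ t₂ (curve θ₁ 0 ((X - C ξ₁) ^ ℓ)) (curve 0 θ₂ ((X - C ξ₂) ^ ℓ))) :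
    ξ₁ = ξ₂ := by
  obtain ⟨g₁, g₂, a₁, a₂, l₁, l₂⟩ := h
  have e₁ := ((isBranchEquation_left h₁ hξ₁).localForm_unique isPrimitive_one_zero (Or.inr rfl) hℓ
    (div_ne_zero (neg_ne_zero.2 h₁) (pow_ne_zero _ hξ₁)) hξ₁ Φ a₁ l₁).1
  have e₂ := ((isBranchEquation_right h₂ hξ₂).localForm_unique isPrimitive_one_zero (Or.inl rfl) hℓ
    (div_ne_zero (neg_ne_zero.2 (pow_ne_zero _ hξ₂)) h₂) hξ₂ Φ a₂ l₂).1
  obtain ⟨s, hs, hmy, -⟩ := Φ.exists_sign isPrimitive_one_zero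
  rw [e₁, hmy, monom_smul, monom_smul] at e₂
  simp only [rot, monom, neg_zero, zpow_zero, one_mul, zpow_one] at e₂
  rcases hs with rfl | rfl
  · simpa using e₂
  · simpa using e₂

theorem markedPair_kappa {θ₁ θ₂ ξ : ℂ} (h₁ : θ₁ ≠ 0) (h₂ : θ₂ ≠ 0) (hξ : ξ ≠ 0) :
    (markedPair ℓ h₁ h₂ hξ).kappa ℓ = θ₁ * θ₂ / (ξ ^ 2) ^ ℓ := by
  have hg : Int.gcdA 1 0 = 1 := by
    have := Int.gcd_eq_gcd_ab 1 0
    simp only [one_mul, zero_mul, add_zero] at this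
    rw [← this]
    rfl
  simp only [BranchPair.kappa, markedPair, dot, rot, monom, hg]
  -- The second Bézout coefficient need not be known: both branches have `b = ξ`, so its
  -- contribution cancels.
  have := zpow_ne_zero (Int.gcdB 1 0) hξ
  rw [mul_div_mul_right _ _ this]
  simp only [zpow_one, neg_zero, zero_mul, zero_add, mul_one, Int.cast_one, one_pow, one_mul]
  field_simp
  ring

/-! ### The invariants of a modification datum of a marked edge -/

/-- The `ℓ`-th power of the first invariant of all coherent modification data. -/
def BranchPair.kappa₁ (S : BranchPair u) (ℓ : ℕ) (q : TorusPoint) : ℂ :=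
  (-(dot (rot u) S.h₁ : ℂ)) ^ ℓ *
    (monom S.a₁ S.b₁ (Int.gcdA u.1 u.2, Int.gcdB u.1 u.2) /
      q.iniChar (Int.gcdA u.1 u.2, Int.gcdB u.1 u.2))

theorem TorusPoint.iniChar_ne_zero (q : TorusPoint) (m : ℤ × ℤ) : q.iniChar m ≠ 0 :=
  monom_ne_zero (HahnSeries.leadingCoeff_ne_zero.2 q.X_ne_zero)
    (HahnSeries.leadingCoeff_ne_zero.2 q.Y_ne_zero) m

theorem BranchPair.kappa₁_ne_zero (S : BranchPair u) (hu : IsPrimitive u) (q : TorusPoint) :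
    S.kappa₁ ℓ q ≠ 0 := by
  refine mul_ne_zero (pow_ne_zero _ (neg_ne_zero.2 (Int.cast_ne_zero.2 ?_)))
    (div_ne_zero (monom_ne_zero S.ha₁ S.hb₁ _) (q.iniChar_ne_zero _))
  intro h0
  obtain ⟨Φ⟩ := exists_toricChange hu
  obtain ⟨s, -, hmy, -⟩ := Φ.exists_sign hu
  exact Φ.dot_my_ne_zero S.hdet₁ (by rw [hmy, dot_smul_left, h0, mul_zero])

theorem BranchPair.iniChar_my (S : BranchPair u) (hu : IsPrimitive u) {q : TorusPoint}
    (hq : q.iniChar (rot u) = monom S.a₁ S.b₁ (rot u)) (Φ : ToricChange u) :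
    q.iniChar Φ.my = S.eta Φ := by
  obtain ⟨s, -, hmy, -⟩ := Φ.exists_sign hu
  rw [BranchPair.eta, hmy, TorusPoint.iniChar, monom_smul, monom_smul, ← hq]
  rfl

/-- The marked point plays the role of the second branch in `theta_mul_theta`: its character values
along `rot u` agree with those of the first branch, so the choice of `mx` cancels. The sign of `my`
enters only once here and has to be carried along. -/
theorem BranchPair.kappa₁_eq (S : BranchPair u) (hu : IsPrimitive u) {q : TorusPoint}
    (hq : q.iniChar (rot u) = monom S.a₁ S.b₁ (rot u)) (Φ : ToricChange u) {s : ℤ}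
    (hs : s = 1 ∨ s = -1) (hmy : Φ.my = s • rot u) :
    S.kappa₁ ℓ q * S.eta Φ ^ ℓ = (-s) ^ ℓ * (-S.theta₁ ℓ Φ / q.iniChar Φ.mx) := by
  obtain ⟨-, -, -, hmx⟩ := Φ.exists_sign hu
  set m : ℤ × ℤ := (Int.gcdA u.1 u.2, Int.gcdB u.1 u.2) with hm
  have hmu : dot m u = 1 := by
    have hg : (1 : ℤ) = u.1 * Int.gcdA u.1 u.2 + u.2 * Int.gcdB u.1 u.2 := by
      rw [← Int.gcd_eq_gcd_ab, hu]
      rfl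
    rw [hg, hm, dot]
    ring
  obtain ⟨k, hk⟩ := exists_smul_rot hu (m := Φ.mx - m) (by
    simp only [dot, Prod.fst_sub, Prod.snd_sub] at hmx hmu ⊢
    linear_combination hmx - hmu)
  have hk' : Φ.mx = m + k • rot u := by rw [← hk, add_sub_cancel]
  have hqX : q.X.ini ≠ 0 := HahnSeries.leadingCoeff_ne_zero.2 q.X_ne_zero
  have hqY : q.Y.ini ≠ 0 := HahnSeries.leadingCoeff_ne_zero.2 q.Y_ne_zero
  have hr : monom S.a₁ S.b₁ Φ.mx / q.iniChar Φ.mx = monom S.a₁ S.b₁ m / q.iniChar m := by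
    simp only [TorusPoint.iniChar] at hq ⊢
    rw [hk', monom_add S.ha₁ S.hb₁, monom_add hqX hqY, monom_smul, monom_smul, ← hq]
    exact mul_div_mul_right _ _ (zpow_ne_zero _ (monom_ne_zero hqX hqY _))
  have hss : (s : ℂ) * s = 1 := by rcases hs with rfl | rfl <;> norm_num
  have hpow : (-(s : ℂ)) ^ ℓ * (S.eta Φ * (s * dot (rot u) S.h₁)) ^ ℓ =
      (-(dot (rot u) S.h₁ : ℂ)) ^ ℓ * S.eta Φ ^ ℓ := by
    rw [← mul_pow, ← mul_pow]
    congr 1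
    linear_combination (-S.eta Φ * dot (rot u) S.h₁) * hss
  rw [BranchPair.kappa₁, BranchPair.theta₁, ← hr, hmy, dot_smul_left]
  push_cast
  linear_combination -(monom S.a₁ S.b₁ Φ.mx / q.iniChar Φ.mx) * hpow

/-- The modification datum of a marked edge with given invariants `w` and `z`. -/
def BranchPair.HasMarkedInvariants (S : BranchPair u) (q : TorusPoint) (D : MarkedDatum u ℓ)
    (w z : ℂ) : Prop :=
  w ^ ℓ = S.kappa₁ ℓ q ∧ ∃ (ξ : ℂ) (hξ : ξ ≠ 0) (s : ℤ), (s = 1 ∨ s = -1) ∧ D.Φ.my = s • rot u ∧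
    s * ξ = w * S.eta D.Φ ∧
    D.f₁ = curve (S.theta₁ ℓ D.Φ) 0 ((X - C ξ) ^ ℓ) ∧
    D.f₂ = curve 0 (S.theta₂ ℓ D.Φ) ((X - C ξ) ^ ℓ) ∧
    (markedPair ℓ (S.theta₁_ne_zero ℓ D.Φ) (S.theta₂_ne_zero ℓ D.Φ) hξ).HasInvariant D.Ω z

theorem natDegree_X_sub_C_pow (ξ : ℂ) (ℓ : ℕ) : ((X - C ξ) ^ ℓ : ℂ[X]).natDegree = ℓ := by
  rw [natDegree_pow, natDegree_X_sub_C, mul_one]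

theorem X_sub_C_pow_coeff_self (ξ : ℂ) (ℓ : ℕ) : ((X - C ξ) ^ ℓ : ℂ[X]).coeff ℓ = 1 := by
  have h := (monic_X_sub_C ξ).pow ℓ
  rwa [Monic, leadingCoeff, natDegree_X_sub_C_pow] at h

theorem X_sub_C_pow_coeff_zero (ξ : ℂ) (ℓ : ℕ) : ((X - C ξ) ^ ℓ : ℂ[X]).coeff 0 = (-ξ) ^ ℓ := by
  rw [coeff_zero_eq_eval_zero]
  simp

theorem pow_sign_mul {s : ℤ} {w ξ η : ℂ} (h : s * ξ = w * η) (ℓ : ℕ) :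
    w ^ ℓ * η ^ ℓ = (-s) ^ ℓ * (-ξ) ^ ℓ := by
  rw [← mul_pow, ← h, ← mul_pow, neg_mul_neg]

/-- The condition on the bottom edge reads `(-ξ) ^ ℓ = -θ₁ / x₀`, where `x₀` is the first coordinate
of the marked point. Under `y' = y ^ ε` the root `ξ` scales by `ε η ^ (ε - 1)`, while `η` becomes `η
^ ε`. Hence `w = s ξ / η`, with `s` the sign of `my`, is the quantity free of choices, and its
`ℓ`-th power is `kappa₁`. -/
theorem BranchPair.marked_coherent_iff (S : BranchPair u) (hu : IsPrimitive u) (hℓ : 0 < ℓ)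
    {q : TorusPoint} (hq : q.iniChar (rot u) = monom S.a₁ S.b₁ (rot u))
    {F₁ F₂ : Laurent} (hS : S.Equations ℓ F₁ F₂) (D : MarkedDatum u ℓ) :
    D.Coherent q F₁ F₂ ↔ ∃ w z, S.HasMarkedInvariants q D w z := by
  have hη := S.eta_ne_zero D.Φ
  have hθ₁ := S.theta₁_ne_zero ℓ D.Φ
  have hθ₂ := S.theta₂_ne_zero ℓ D.Φ
  have hx₀ := q.iniChar_ne_zero D.Φ.mx
  constructor
  · rintro ⟨hΩ, hbot, θ₁, θ₂, hloc, h₁, h₂⟩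
    obtain ⟨-, rfl, rfl⟩ := (S.localEquations_iff hu hℓ hS D.Φ _ _ _).1 hloc
    obtain ⟨ξ, hξ, e₁⟩ := D.eq_curve₁ hℓ hθ₁ h₁
    obtain ⟨ξ₂, hξ₂, e₂⟩ := D.eq_curve₂ hℓ hθ₂ h₂
    obtain rfl : ξ = ξ₂ := by
      obtain ⟨-, t₁, t₂, hl, -⟩ := hΩ
      rw [e₁, e₂] at hl
      exact eq_of_localEquations hℓ hθ₁ hθ₂ hξ hξ₂ hl
    rw [e₁, e₂] at hΩ
    obtain ⟨z, hz⟩ := ((markedPair ℓ hθ₁ hθ₂ hξ).coherent_iff isPrimitive_one_zero hℓ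
      (markedPair_equations hθ₁ hθ₂ hξ) D.Ω).1 hΩ
    obtain ⟨s, hs, hmy, -⟩ := D.Φ.exists_sign hu
    have hsw : s * ξ = s * ξ / S.eta D.Φ * S.eta D.Φ := by field_simp
    refine ⟨s * ξ / S.eta D.Φ, z, ?_, ξ, hξ, s, hs, hmy, hsw, e₁, e₂, hz⟩
    rw [e₁, evalAt_restrict_bottom hx₀, X_sub_C_pow_coeff_zero] at hbot
    apply mul_right_cancel₀ (pow_ne_zero ℓ hη)
    rw [pow_sign_mul hsw, S.kappa₁_eq hu hq D.Φ hs hmy, eq_neg_of_add_eq_zero_right hbot]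
    ring
  · rintro ⟨w, z, hw, ξ, hξ, s, hs, hmy, hsw, e₁, e₂, hz⟩
    refine ⟨?_, ?_, S.theta₁ ℓ D.Φ, S.theta₂ ℓ D.Φ,
      (S.localEquations_iff hu hℓ hS D.Φ _ _ _).2 ⟨S.iniChar_my hu hq D.Φ, rfl, rfl⟩, ?_, ?_⟩
    · rw [e₁, e₂]
      exact ((markedPair ℓ hθ₁ hθ₂ hξ).coherent_iff isPrimitive_one_zero hℓ
        (markedPair_equations hθ₁ hθ₂ hξ) D.Ω).2 ⟨z, hz⟩
    · rw [e₁, evalAt_restrict_bottom hx₀, X_sub_C_pow_coeff_zero]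
      have h1 := S.kappa₁_eq (ℓ := ℓ) hu hq D.Φ hs hmy
      rw [← hw, pow_sign_mul hsw] at h1
      have hs0 : (-(s : ℂ)) ^ ℓ ≠ 0 := pow_ne_zero _ (by rcases hs with rfl | rfl <;> norm_num)
      rw [mul_left_cancel₀ hs0 h1]
      ring
    · rw [e₁]
      exact restrict_leftEdge_curve hℓ (X_sub_C_pow_coeff_self ξ ℓ)
    · rw [e₂]
      exact restrict_rightEdge_curve hℓ (X_sub_C_pow_coeff_self ξ ℓ)

/-- Since `ξ ^ 2 = w ^ 2 η ^ 2`, the constant of the refined datum depends only on `w ^ ℓ`.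
Therefore every choice of `w` admits the same set of second invariants `z`. -/
theorem BranchPair.marked_kappa (S : BranchPair u) (hu : IsPrimitive u) {Φ : ToricChange u}
    {s : ℤ} (hs : s = 1 ∨ s = -1) {w ξ c : ℂ} (hξ : ξ ≠ 0) (hsw : s * ξ = w * S.eta Φ)
    (hw : w ^ ℓ = c) :
    (markedPair ℓ (S.theta₁_ne_zero ℓ Φ) (S.theta₂_ne_zero ℓ Φ) hξ).kappa ℓ =
      S.kappa ℓ / c ^ 2 := by
  have hη := S.eta_ne_zero Φ
  have hs2 : (s : ℂ) ^ 2 = 1 := by rcases hs with rfl | rfl <;> norm_num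
  have hξ2 : ξ ^ 2 = w ^ 2 * S.eta Φ ^ 2 := by
    rw [← mul_pow, ← hsw, mul_pow, hs2, one_mul]
  have hw0 : w ≠ 0 := by
    rintro rfl
    rw [zero_pow two_ne_zero, zero_mul] at hξ2
    exact pow_ne_zero 2 hξ hξ2
  rw [markedPair_kappa, S.theta_mul_theta hu, hξ2, mul_pow,
    mul_div_mul_right _ _ (pow_ne_zero _ (pow_ne_zero _ hη)), ← hw]
  ring

theorem BranchPair.exists_hasMarkedInvariants (S : BranchPair u) (hu : IsPrimitive u) (hℓ : 0 < ℓ)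
    {q : TorusPoint} {w z : ℂ} (hw : w ^ ℓ = S.kappa₁ ℓ q)
    (hz : z ^ ℓ = S.kappa ℓ / S.kappa₁ ℓ q ^ 2) :
    ∃ D : MarkedDatum u ℓ, S.HasMarkedInvariants q D w z := by
  obtain ⟨Φ⟩ := exists_toricChange hu
  obtain ⟨s, hs, hmy, -⟩ := Φ.exists_sign hu
  have hθ₁ := S.theta₁_ne_zero ℓ Φ
  have hθ₂ := S.theta₂_ne_zero ℓ Φ
  have hw0 : w ≠ 0 := by
    rintro rfl
    rw [zero_pow hℓ.ne'] at hw
    exact S.kappa₁_ne_zero hu q hw.symm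
  have hs0 : (s : ℂ) ≠ 0 := by rcases hs with rfl | rfl <;> norm_num
  have hs2 : (s : ℂ) * s = 1 := by rcases hs with rfl | rfl <;> norm_num
  have hξ : s * (w * S.eta Φ) ≠ 0 := mul_ne_zero hs0 (mul_ne_zero hw0 (S.eta_ne_zero Φ))
  have hsw : s * (s * (w * S.eta Φ)) = w * S.eta Φ := by rw [← mul_assoc, hs2, one_mul]
  set ξ := s * (w * S.eta Φ) with hξe
  have hP1 : ((X - C ξ) ^ ℓ : ℂ[X]).coeff ℓ ≠ 0 := by
    rw [X_sub_C_pow_coeff_self]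
    exact one_ne_zero
  have hP0 : ((X - C ξ) ^ ℓ : ℂ[X]).coeff 0 ≠ 0 := by
    rw [X_sub_C_pow_coeff_zero]
    exact pow_ne_zero _ (neg_ne_zero.2 hξ)
  obtain ⟨Ω, hΩ⟩ := (markedPair ℓ hθ₁ hθ₂ hξ).exists_hasInvariant isPrimitive_one_zero hℓ
    (z := z) (by rw [S.marked_kappa hu hs hξ hsw hw, hz])
  refine ⟨⟨Φ, curve (S.theta₁ ℓ Φ) 0 ((X - C ξ) ^ ℓ), curve 0 (S.theta₂ ℓ Φ) ((X - C ξ) ^ ℓ), Ω,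
    newtonPolygon_curve_left hθ₁ hℓ (natDegree_X_sub_C_pow _ _).le hP1 hP0,
    newtonPolygon_curve_right hθ₂ hℓ (natDegree_X_sub_C_pow _ _).le hP1 hP0,
    by rw [curve_coeff_zero, X_sub_C_pow_coeff_self], by rw [curve_coeff_zero, X_sub_C_pow_coeff_self],
    ?_, ?_⟩, hw, ξ, hξ, s, hs, hmy, hsw, rfl, rfl, hΩ⟩
  · rw [curve_zero_right]
    exact isUnibranch_sideCurve (Or.inr rfl) hθ₁ hξ hℓ
  · rw [curve_zero_left]
    exact isUnibranch_sideCurve (Or.inl rfl) hθ₂ hξ hℓ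

/-- If `ξ' ≠ ξ`, the curve of `ξ` has a point of the torus with `y = ξ'`. The curve of `ξ'` has
none, because there `y = ξ'` forces `x ^ ε = 0`. -/
theorem eq_of_associated_sideCurve {ε : ℤ} (hε : ε = 1 ∨ ε = -1) {θ ξ ξ' : ℂ} (hθ : θ ≠ 0)
    (hξ' : ξ' ≠ 0) (hℓ : 0 < ℓ) (h : Associated (sideCurve ε θ ((X - C ξ') ^ ℓ))
      (sideCurve ε θ ((X - C ξ) ^ ℓ))) : ξ' = ξ := by
  by_contra hne
  set w := -θ⁻¹ * (ξ' - ξ) ^ ℓ with hw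
  have hw0 : w ≠ 0 := mul_ne_zero (neg_ne_zero.2 (inv_ne_zero hθ))
    (pow_ne_zero _ (sub_ne_zero.2 hne))
  have hx0 : w ^ ε ≠ 0 := zpow_ne_zero _ hw0
  have hxx : (w ^ ε) ^ ε = w := by
    rw [← zpow_mul]
    rcases hε with rfl | rfl <;> simp
  have h0 : evalAt (w ^ ε) ξ' (sideCurve ε θ ((X - C ξ) ^ ℓ)) = 0 := by
    rw [evalAt_sideCurve hx0 hξ', hxx, hw]
    simp [hθ]
  have h1 : evalAt (w ^ ε) ξ' (sideCurve ε θ ((X - C ξ') ^ ℓ)) = 0 := by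
    obtain ⟨c, hc⟩ := h.symm.dvd
    rw [hc, ← evalHom_apply _ _ hx0 hξ', map_mul, evalHom_apply, h0, zero_mul]
  rw [evalAt_sideCurve hx0 hξ', hxx] at h1
  simp [hℓ.ne', hθ, hw0] at h1

theorem markedPair_scaledBy {a b θ₁ θ₂ ξ θ₁' θ₂' ξ' : ℂ} (ha : a ≠ 0) (hb : b ≠ 0) (h₁ : θ₁ ≠ 0)
    (h₂ : θ₂ ≠ 0) (hξ : ξ ≠ 0) (h₁' : θ₁' ≠ 0) (h₂' : θ₂' ≠ 0) (hξ' : ξ' ≠ 0)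
    (e₁ : θ₁' = a * b ^ ℓ * θ₁) (e₂ : θ₂' = b ^ ℓ * a⁻¹ * θ₂) (e : ξ' = b * ξ) :
    (markedPair ℓ h₁ h₂ hξ).ScaledBy a b (markedPair ℓ h₁' h₂' hξ') := by
  subst e₁ e₂ e
  constructor
  · simp only [markedPair]
    field_simp
    rw [mul_pow]
  · rfl
  · simp only [markedPair]
    field_simp
    rw [mul_pow]
  · rfl
  · rfl
  · rfl

theorem scale_curve_X_sub_C_pow {a b θ₁ θ₂ ξ' : ℂ} (hb : b ≠ 0) :
    scale a b (curve θ₁ θ₂ ((X - C ξ') ^ ℓ)) = curve (b ^ ℓ * ((b ^ ℓ)⁻¹ * a⁻¹ * θ₁))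
      (b ^ ℓ * ((b ^ ℓ)⁻¹ * a * θ₂)) (C (b ^ ℓ) * (X - C (b⁻¹ * ξ')) ^ ℓ) := by
  have hb' := pow_ne_zero ℓ hb
  rw [scale_curve]
  congr 1
  · field_simp
  · field_simp
  · rw [map_pow, ← mul_pow, mul_sub, ← C_mul, mul_inv_cancel_left₀ hb, pow_comp, sub_comp, X_comp,
      C_comp]

/-- The first two curves correspond exactly when `ξ' = b ξ`, that is when `w = w'`. In that case the
refined branches differ by the scaling `(a, b)`, and `UnmarkedDatum.related_iff` compares the data
`Ω`. -/
theorem MarkedDatum.related_iff {S : BranchPair u} (hu : IsPrimitive u) (hℓ : 0 < ℓ)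
    {q : TorusPoint} (hq : q.iniChar (rot u) = monom S.a₁ S.b₁ (rot u)) {D D' : MarkedDatum u ℓ}
    {w z w' z' : ℂ} (hD : S.HasMarkedInvariants q D w z)
    (hD' : S.HasMarkedInvariants q D' w' z') :
    MarkedDatum.Related q D D' ↔ w = w' ∧ z = z' := by
  obtain ⟨-, ξ, hξ, s, hs, hmy, hsw, e₁, e₂, hΩ⟩ := hD
  obtain ⟨-, ξ', hξ', s', hs', hmy', hsw', e₁', e₂', hΩ'⟩ := hD'
  have hη := S.eta_ne_zero D.Φ
  have hθ₁ := S.theta₁_ne_zero ℓ D.Φ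
  have hθ₂ := S.theta₂_ne_zero ℓ D.Φ
  have hqη := S.iniChar_my hu hq D.Φ
  have key : ∀ k ε : ℤ, (ε = 1 ∨ ε = -1) → D'.Φ.mx = D.Φ.mx + k • D.Φ.my → D'.Φ.my = ε • D.Φ.my →
      ((Associated (scale (q.iniChar D.Φ.my ^ k) ((ε : ℂ) * q.iniChar D.Φ.my ^ (ε - 1)) D'.f₁) D.f₁ ∧
        Associated (scale (q.iniChar D.Φ.my ^ k) ((ε : ℂ) * q.iniChar D.Φ.my ^ (ε - 1)) D'.f₂) D.f₂ ∧
        UnmarkedDatum.Related (q.iniChar D.Φ.my ^ k) ((ε : ℂ) * q.iniChar D.Φ.my ^ (ε - 1)) D.Ω D'.Ω)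
        ↔ w = w' ∧ z = z') := by
    intro k ε hε hx hy
    have hε0 : (ε : ℂ) ≠ 0 := by rcases hε with rfl | rfl <;> norm_num
    have hε2 : (ε : ℂ) * ε = 1 := by rcases hε with rfl | rfl <;> norm_num
    have hs0 : (s : ℂ) ≠ 0 := by rcases hs with rfl | rfl <;> norm_num
    rw [hqη]
    set a := S.eta D.Φ ^ k with ha
    set b := (ε : ℂ) * S.eta D.Φ ^ (ε - 1) with hb
    have ha0 : a ≠ 0 := zpow_ne_zero _ hη
    have hb0 : b ≠ 0 := mul_ne_zero hε0 (zpow_ne_zero _ hη)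
    have hbl := pow_ne_zero ℓ hb0
    obtain ⟨t₁, t₂⟩ := S.scaledBy_one.theta (ℓ := ℓ) hu hx hy (a := a) (b := b)
      (by simp [monom, ha]) (by simp [monom, hb])
    -- The signs of the two second characters differ by `ε`, which compensates the sign contained in
    -- `b`.
    have hss : s' = s * ε := by
      rw [hmy, smul_smul, hmy'] at hy
      have hr : (rot u).1 ≠ 0 ∨ (rot u).2 ≠ 0 := by
        by_contra! h0
        rw [IsPrimitive] at hu
        simp only [rot, neg_eq_zero] at h0
        rw [h0.1, h0.2] at hu
        simp at hu
      rcases hr with hr | hr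
      · have := congrArg Prod.fst hy
        simp only [Prod.smul_fst, smul_eq_mul] at this
        rw [mul_right_cancel₀ hr this, mul_comm]
      · have := congrArg Prod.snd hy
        simp only [Prod.smul_snd, smul_eq_mul] at this
        rw [mul_right_cancel₀ hr this, mul_comm]
    have hξξ : b⁻¹ * ξ' = ξ ↔ w = w' := by
      have h1 : s * ξ' = w' * S.eta D.Φ * b := by
        rw [hss, S.scaledBy_one.eta hy] at hsw'
        push_cast at hsw'
        rw [hb, zpow_sub₀ hη, zpow_one]
        simp only [monom, one_zpow, mul_one, one_mul] at hsw'
        field_simp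
        linear_combination ε * hsw' - s * ξ' * hε2
      have h2 : s * (b⁻¹ * ξ') = w' * S.eta D.Φ := by
        rw [mul_left_comm, h1]
        field_simp
      constructor
      · intro h3
        rw [h3, hsw] at h2
        exact mul_right_cancel₀ hη h2
      · rintro rfl
        rw [← hsw] at h2
        exact mul_left_cancel₀ hs0 h2
    have u₁ : scale a b D'.f₁ = curve (b ^ ℓ * S.theta₁ ℓ D.Φ) (b ^ ℓ * 0)
        (C (b ^ ℓ) * (X - C (b⁻¹ * ξ')) ^ ℓ) := by
      rw [e₁', scale_curve_X_sub_C_pow hb0, t₁]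
      congr 1
      · field_simp
      · ring
    have u₂ : scale a b D'.f₂ = curve (b ^ ℓ * 0) (b ^ ℓ * S.theta₂ ℓ D.Φ)
        (C (b ^ ℓ) * (X - C (b⁻¹ * ξ')) ^ ℓ) := by
      rw [e₂', scale_curve_X_sub_C_pow hb0, t₂]
      congr 1
      · ring
      · field_simp
    have hb' : b⁻¹ * ξ' ≠ 0 := mul_ne_zero (inv_ne_zero hb0) hξ'
    rw [u₁, u₂, e₁, e₂]
    have hΩz : b⁻¹ * ξ' = ξ → (UnmarkedDatum.Related a b D.Ω D'.Ω ↔ z = z') := by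
      intro h1
      exact UnmarkedDatum.related_iff ha0 hb0 (markedPair_scaledBy ha0 hb0 hθ₁ hθ₂ hξ
        (S.theta₁_ne_zero ℓ D'.Φ) (S.theta₂_ne_zero ℓ D'.Φ) hξ' t₁ t₂ (by rw [← h1]; field_simp))
        isPrimitive_one_zero hℓ hΩ hΩ'
    constructor
    · rintro ⟨h1, -, h3⟩
      have h4 : b⁻¹ * ξ' = ξ := by
        have h5 := (associated_curve_C_mul hbl (S.theta₁ ℓ D.Φ) 0
          ((X - C (b⁻¹ * ξ')) ^ ℓ)).symm.trans h1
        rw [curve_zero_right, curve_zero_right] at h5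
        exact eq_of_associated_sideCurve (Or.inr rfl) hθ₁ hb' hℓ h5
      exact ⟨hξξ.1 h4, (hΩz h4).1 h3⟩
    · rintro ⟨h1, h2⟩
      have h4 := hξξ.2 h1
      refine ⟨?_, ?_, (hΩz h4).2 h2⟩
      · rw [h4]
        exact associated_curve_C_mul hbl _ _ _
      · rw [h4]
        exact associated_curve_C_mul hbl _ _ _
  constructor
  · rintro ⟨k, ε, hε, hx, hy, hass⟩
    exact (key k ε hε hx hy).1 hass
  · intro hh
    obtain ⟨k, ε, hε, hx, hy⟩ := D.Φ.exists_change hu D'.Φ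
    exact ⟨k, ε, hε, hx, hy, (key k ε hε hx hy).2 hh⟩

end Marked

/-! ### Counting equivalence classes -/

section Counting

theorem natCard_quot {α β : Type*} {r : α → α → Prop} {inv : α → β}
    (hs : Function.Surjective inv) (h : ∀ a b, r a b ↔ inv a = inv b) :
    Nat.card (Quot r) = Nat.card β := by
  refine Nat.card_congr (Equiv.ofBijective (Quot.lift inv fun a b hab => (h a b).1 hab) ⟨?_, ?_⟩)
  · rintro ⟨a⟩ ⟨b⟩ hab
    exact Quot.sound ((h a b).2 hab)
  · intro b
    obtain ⟨a, rfl⟩ := hs b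
    exact ⟨Quot.mk r a, rfl⟩

/-- The hypothesis `h`, applied with `a = a'`, makes the value attached to `a` unique, so any choice
function serves as the invariant. -/
theorem exists_invariant {α β : Type*} {r : α → α → Prop} (R : α → β → Prop)
    (h₁ : ∀ a, ∃ b, R a b) (h₂ : ∀ b, ∃ a, R a b)
    (h : ∀ a a' b b', R a b → R a' b' → (r a a' ↔ b = b')) :
    ∃ inv : α → β, Function.Surjective inv ∧ ∀ a a', r a a' ↔ inv a = inv a' := by
  choose inv hinv using h₁
  refine ⟨inv, fun b => ?_, fun a a' => h a a' _ _ (hinv a) (hinv a')⟩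
  obtain ⟨a, ha⟩ := h₂ b
  exact ⟨a, (h a a _ _ (hinv a) ha).1 ((h a a _ _ (hinv a) (hinv a)).2 rfl)⟩

theorem exists_type_of_invariant {α : Type*} {β : Type} {r : α → α → Prop} {N : ℕ}
    (R : α → β → Prop) (hN : Nat.card β = N) (h₁ : ∀ a, ∃ b, R a b) (h₂ : ∀ b, ∃ a, R a b)
    (h : ∀ a a' b b', R a b → R a' b' → (r a a' ↔ b = b')) :
    ∃ (β : Type) (inv : α → β), Function.Surjective inv ∧ (∀ a a', r a a' ↔ inv a = inv a') ∧
      Nat.card β = N := by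
  obtain ⟨inv, h1, h2⟩ := exists_invariant R h₁ h₂ h
  exact ⟨β, inv, h1, h2, hN⟩

theorem natCard_roots {n : ℕ} (hn : 0 < n) {c : ℂ} (hc : c ≠ 0) :
    Nat.card {z : ℂ // z ^ n = c} = n := by
  classical
  have hζ := Complex.isPrimitiveRoot_exp n hn.ne'
  have h1 : ∀ z : ℂ, z ^ n = c ↔ z ∈ (Polynomial.nthRoots n c).toFinset := by
    intro z
    rw [Multiset.mem_toFinset, Polynomial.mem_nthRoots hn]
  rw [Nat.card_congr (Equiv.subtypeEquivRight h1), Nat.card_eq_fintype_card, Fintype.card_coe,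
    Multiset.toFinset_card_of_nodup (hζ.nthRoots_nodup hc), hζ.card_nthRoots,
    if_pos (IsAlgClosed.exists_pow_nat_eq c hn)]

/-! ### Classes on a single edge, and the product over all edges. -/

variable {V E L : Type*} [Fintype V] [Fintype E] [Fintype L] [DecidableEq V]
variable {Γ : PlaneTropicalCurve V E L} {n r : ℕ}

-- The invariant is a root `z` on an unmarked edge, a pair of roots `(w, z)` on a marked edge of
-- weight above one, and trivial on a marked edge of weight one. In the last case the count `1`
-- agrees with the square of the weight.
open Classical in
theorem exists_edge_invariant (hΓ : Γ.Trivalent) {p : Marking Γ n r}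
    (hp : ∀ i j e, p.OnEdge i e → p.OnEdge j e → i = j) (Φ : Enhancement Γ)
    (P : PointConditions n r) (hP : Satisfies p Φ P) (e : E) :
    ∃ (β : Type) (inv : CoherentEdgeDatum p Φ P e → β), Function.Surjective inv ∧
      (∀ D D', D.1.Related P D'.1 ↔ inv D = inv D') ∧
      Nat.card β = Γ.wt e * if ∃ i, p.OnEdge i e then Γ.wt e else 1 := by
  have hu := Γ.dir_primitive e
  have hℓ := Γ.wt_pos e
  obtain ⟨S, hS, hSq⟩ := Φ.exists_branchPair hΓ e
  -- These equations witness coherence when a datum with prescribed invariants is constructed.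
  obtain ⟨F₁, F₂, hF⟩ := S.exists_equations hu hℓ
  by_cases hm : ∃ i, p.OnEdge i e
  · obtain ⟨i, hi⟩ := hm
    rw [if_pos ⟨i, hi⟩]
    have hq : (P.inner i).iniChar (rot (Γ.dir e)) = monom S.a₁ S.b₁ (rot (Γ.dir e)) := by
      rw [← hSq, hP.2.1 i e hi]
    rcases Nat.lt_or_ge 1 (Γ.wt e) with hw | hw
    · have hk₁ := S.kappa₁_ne_zero (ℓ := Γ.wt e) hu (P.inner i)
      have hk : S.kappa (Γ.wt e) / S.kappa₁ (Γ.wt e) (P.inner i) ^ 2 ≠ 0 :=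
        div_ne_zero (S.kappa_ne_zero hu) (pow_ne_zero 2 hk₁)
      refine exists_type_of_invariant
        (α := CoherentEdgeDatum p Φ P e)
        (β := {w : ℂ // w ^ Γ.wt e = S.kappa₁ (Γ.wt e) (P.inner i)} ×
          {z : ℂ // z ^ Γ.wt e = S.kappa (Γ.wt e) / S.kappa₁ (Γ.wt e) (P.inner i) ^ 2})
        (r := fun D D' => D.1.Related P D'.1)
        (fun D b => ∃ D₀, D.1 = .marked i hi hw D₀ ∧
          S.HasMarkedInvariants (P.inner i) D₀ b.1.1 b.2.1) ?_ ?_ ?_ ?_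
      · rw [Nat.card_prod, natCard_roots hℓ hk₁, natCard_roots hℓ hk]
      · rintro ⟨D, hD⟩
        cases D with
        | unmarked h D => exact absurd hi (h i)
        | trivial j h hw' => omega
        | marked j h hw' D =>
          obtain rfl := hp i j e hi h
          obtain ⟨G₁, G₂, hG₁, hG₂, hcoh⟩ := hD
          obtain ⟨w, z, hwz⟩ := (S.marked_coherent_iff hu hℓ hq ((hS _ _).1 ⟨hG₁, hG₂⟩) D).1 hcoh
          have hwz' := hwz
          obtain ⟨hw1, ξ, hξ, s, hs, -, hsw, -, -, hz⟩ := hwz'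
          exact ⟨⟨⟨w, hw1⟩, ⟨z, by rw [hz.1, S.marked_kappa hu hs hξ hsw hw1]⟩⟩, D, rfl, hwz⟩
      · rintro ⟨⟨w, hw1⟩, ⟨z, hz⟩⟩
        obtain ⟨D, hD⟩ := S.exists_hasMarkedInvariants hu hℓ hw1 hz
        obtain ⟨hF₁, hF₂⟩ := (hS F₁ F₂).2 hF
        exact ⟨⟨.marked i hi hw D, F₁, F₂, hF₁, hF₂,
          (S.marked_coherent_iff hu hℓ hq hF D).2 ⟨w, z, hD⟩⟩, D, rfl, hD⟩
      · rintro ⟨_, hD⟩ ⟨_, hD'⟩ ⟨⟨w, hw1⟩, ⟨z, hz⟩⟩ ⟨⟨w', hw1'⟩, ⟨z', hz'⟩⟩ ⟨D₀, rfl, h0⟩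
          ⟨D₀', rfl, h0'⟩
        rw [Prod.mk.injEq, Subtype.mk.injEq, Subtype.mk.injEq,
          ← MarkedDatum.related_iff hu hℓ hq h0 h0']
        exact and_iff_right rfl
    · have hw1 : Γ.wt e = 1 := by omega
      refine exists_type_of_invariant
        (α := CoherentEdgeDatum p Φ P e) (β := Unit)
        (r := fun D D' => D.1.Related P D'.1)
        (fun D _ => D.1 = .trivial i hi hw1) ?_ ?_ ?_ ?_
      · simp [hw1]
      · rintro ⟨D, hD⟩
        cases D with
        | unmarked h D => exact absurd hi (h i)
        | marked j h hw' D => omega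
        | trivial j h hw' =>
          obtain rfl := hp i j e hi h
          exact ⟨(), rfl⟩
      · rintro ⟨⟩
        exact ⟨⟨.trivial i hi hw1, trivial⟩, rfl⟩
      · rintro ⟨_, hD⟩ ⟨_, hD'⟩ ⟨⟩ ⟨⟩ rfl rfl
        exact iff_of_true rfl rfl
  · rw [if_neg hm, mul_one]
    have hm' : ∀ i, ¬ p.OnEdge i e := not_exists.1 hm
    refine exists_type_of_invariant
      (α := CoherentEdgeDatum p Φ P e) (β := {z : ℂ // z ^ Γ.wt e = S.kappa (Γ.wt e)})
      (r := fun D D' => D.1.Related P D'.1)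
      (fun D b => ∃ D₀, D.1 = .unmarked hm' D₀ ∧ S.HasInvariant D₀ b.1) ?_ ?_ ?_ ?_
    · exact natCard_roots hℓ (S.kappa_ne_zero hu)
    · rintro ⟨D, hD⟩
      cases D with
      | marked j h hw' D => exact absurd h (hm' j)
      | trivial j h hw' => exact absurd h (hm' j)
      | unmarked h D =>
        obtain ⟨G₁, G₂, hG₁, hG₂, hcoh⟩ := hD
        obtain ⟨z, hz⟩ := (S.coherent_iff hu hℓ ((hS _ _).1 ⟨hG₁, hG₂⟩) D).1 hcoh
        exact ⟨⟨z, hz.1⟩, D, rfl, hz⟩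
    · rintro ⟨z, hz⟩
      obtain ⟨D, hD⟩ := S.exists_hasInvariant hu hℓ hz
      obtain ⟨hF₁, hF₂⟩ := (hS F₁ F₂).2 hF
      exact ⟨⟨.unmarked hm' D, F₁, F₂, hF₁, hF₂, (S.coherent_iff hu hℓ hF D).2 ⟨z, hD⟩⟩, D, rfl, hD⟩
    · rintro ⟨_, hD⟩ ⟨_, hD'⟩ ⟨z, hz⟩ ⟨z', hz'⟩ ⟨D₀, rfl, h0⟩ ⟨D₀', rfl, h0'⟩
      rw [Subtype.mk.injEq]
      exact UnmarkedDatum.related_iff one_ne_zero one_ne_zero S.scaledBy_one hu hℓ h0 h0'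

-- Each factor is spread over all edges and the products are interchanged. An edge contains at most
-- one marked point, so it contributes its weight once or not at all.
open Classical in
theorem prod_boundedWeight {p : Marking Γ n r} (hp : ∀ i j e, p.OnEdge i e → p.OnEdge j e → i = j) :
    ∏ i : Fin n, p.boundedWeight i = ∏ e : E, if ∃ i, p.OnEdge i e then Γ.wt e else 1 := by
  have h1 : ∀ i, p.boundedWeight i = ∏ e : E, if p.OnEdge i e then Γ.wt e else 1 := by
    intro i
    have key : ∀ o : Option E, o.elim 1 Γ.wt = ∏ e : E, if o = some e then Γ.wt e else 1 := by
      rintro (_ | a) <;> simp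
    exact (key _).trans (Finset.prod_congr rfl fun e _ => if_congr Iff.rfl rfl rfl)
  simp only [h1]
  rw [Finset.prod_comm]
  refine Finset.prod_congr rfl fun e _ => ?_
  split_ifs with h
  · obtain ⟨i, hi⟩ := h
    rw [Finset.prod_eq_single i, if_pos hi]
    · exact fun j _ hj => if_neg fun h => hj (hp j i e h hi)
    · exact fun h => absurd (Finset.mem_univ i) h
  · exact Finset.prod_eq_one fun i _ => if_neg fun h' => h ⟨i, h'⟩

end Counting

end TropMod

end

theorem mainTheorem4 {V E L : Type*} [Fintype V] [Fintype E] [Fintype L] [DecidableEq V]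
    (Γ : TropMod.PlaneTropicalCurve V E L) (hΓ : Γ.Trivalent) {n r : ℕ}
    (p : TropMod.Marking Γ n r)
    (hp : ∀ i j e, p.OnEdge i e → p.OnEdge j e → i = j)
    (Φ : TropMod.Enhancement Γ) (P : TropMod.PointConditions n r)
    (hP : TropMod.Satisfies p Φ P) :
    Nat.card (TropMod.ModificationClasses p Φ P) =
        (∏ e : E, Γ.wt e) * ∏ i : Fin n, p.boundedWeight i ∧
      (∀ e : E, (∀ i, ¬ p.OnEdge i e) →
        Nat.card (TropMod.EdgeModificationClasses p Φ P e) = Γ.wt e) ∧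
      (∀ e : E, (∃ i, p.OnEdge i e) →
        Nat.card (TropMod.EdgeModificationClasses p Φ P e) = Γ.wt e ^ 2) := by

  classical
  choose β inv hs hr hc using TropMod.exists_edge_invariant hΓ hp Φ P hP
  have hcard : ∀ e, Nat.card (TropMod.EdgeModificationClasses p Φ P e) =
      Γ.wt e * if ∃ i, p.OnEdge i e then Γ.wt e else 1 := fun e =>
    (TropMod.natCard_quot (hs e) (hr e)).trans (by rw [hc])
  refine ⟨?_, fun e he => ?_, fun e he => ?_⟩
  · rw [TropMod.prod_boundedWeight hp, ← Finset.prod_mul_distrib]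
    -- Equivalence is edgewise, so the tuple of edge invariants classifies the data of the whole
    -- curve.
    refine (TropMod.natCard_quot (β := ∀ e, β e) (inv := fun D e => inv e (D e)) ?_ ?_).trans ?_
    · intro b
      choose D hD using fun e => hs e (b e)
      exact ⟨D, funext hD⟩
    · intro D D'
      rw [funext_iff]
      exact forall_congr' fun e => hr e (D e) (D' e)
    · rw [Nat.card_pi]
      exact Finset.prod_congr rfl fun e _ => by rw [hc]
  · rw [hcard, if_neg (not_exists.2 he), mul_one]
  · rw [hcard, if_pos he, pow_two]
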